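/- Let $d,m\ge 1$ be integers, $p\in(1,\infty)$, and let $\Omega\subset\mathbb{R}^d$ be a bounded open set. Let $\lambda$ (also $|\cdot|$) be Lebesgue measure, let $\mathbb{M}^{m\times d}$ be the space of real $m\times d$ matrices, and let $Q_\rho(x)$ be the open cube with centre $x$, sides parallel to the axes and side length $\rho$. Let $L:\mathbb{R}^d\times\mathbb{M}^{m\times d}\to[0,\infty)$ be Borel measurable and $p$-coercive: there is $\alpha>0$ with $\alpha|\xi|^p\le L(x,\xi)$ for all $(x,\xi)\in\mathbb{R}^d\times\mathbb{M}^{m\times d}$. For $\varepsilon>0$, $u\in W^{1,p}(\Omega;\mathbb{R}^m)$ and open $O\subset\Omega$ put $$F_\varepsilon(u;O)=\int_O L\Big(\frac{x}{\varepsilon},\nabla u(x)\Big)dx,\qquad m_\varepsilon(u;O)=\inf\{F_\varepsilon(v;O): v\in W^{1,p}(\Omega;\mathbb{R}^m),\ v=u\text{ a.e. in }\Omega\setminus O\},$$ and for $\xi\in\mathbb{M}^{m\times d}$ and open $O\subset\mathbb{R}^d$ put $$\mathcal S_\xi^L(O)=\inf\Big\{\int_O L(y,\xi+\nabla\varphi(y))\,dy:\varphi\in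 W^{1,p}_0(O;\mathbb{R}^m)\Big\}.$$ Assume: (G$_1$) there are $\beta>0$ and a finite Borel measure $\nu$ on $\Omega$, absolutely continuous with respect to $\lambda$, such that for every nonempty open $V\subset\Omega$, every $u\in W^{1,p}(\Omega;\mathbb{R}^m)$ and every $\varepsilon\in(0,1]$ $$\frac{m_\varepsilon(u;V)}{|V|}\le\beta\Big(\frac{\nu(V)}{|V|}+\frac1{|V|}\int_V|u|^p\,dx+\frac1{|V|}\int_V|\nabla u|^p\,dx\Big);$$ ($\mathscr H$) $L$ is an H-integrand: for every $\xi\in\mathbb{M}^{m\times d}$, for a.e. $x\in\Omega$, $$\limsup_{\rho\to0}\limsup_{t\to\infty}\frac{\mathcal S_\xi^L(tQ_\rho(x))}{\lambda(tQ_\rho(x))}=\liminf_{\rho\to0}\liminf_{t\to\infty}\frac{\mathcal S_\xi^L(tQ_\rho(x))}{\lambda(tQ_\rho(x))}.$$ For $x\in\Omega$ and $\xi\in\mathbb{M}^{m\times d}$ let $L_{\rm hom}(x,\xi)=\limsup_{\rho\to0}\limsup_{t\to\infty}\mathcal S_\xi^L(tQ_\rho(x))/\lambda(tQ_\rho(x))$.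 Then for every open $O\subset\Omega$ the following hold. (i) For every $u\in W^{1,p}(\Omega;\mathbb{R}^m)$ the function $x\mapsto L_{\rm hom}(x,\nabla u(x))$ is Lebesgue measurable on $O$, and the family $\{F_\varepsilon(\cdot;O)\}_\varepsilon$ $\Gamma(L^p)$-converges at $u$ to $\int_O L_{\rm hom}(x,\nabla u(x))\,dx$; that is, $$\inf_{u_\varepsilon\to u}\liminf_{\varepsilon\to0}F_\varepsilon(u_\varepsilon;O)=\inf_{u_\varepsilon\to u}\limsup_{\varepsilon\to0}F_\varepsilon(u_\varepsilon;O)=\int_O L_{\rm hom}(x,\nabla u(x))\,dx,$$ the infima being over families $(u_\varepsilon)_{\varepsilon>0}$ in $W^{1,p}(\Omega;\mathbb{R}^m)$ that converge to $u$ in $L^p(\Omega;\mathbb{R}^m)$ as $\varepsilon\to0$. (ii) For all $x\in O$, $\xi\in\mathbb{M}^{m\times d}$ and $v\in\mathbb{R}^m$, $$L_{\rm hom}(x,\xi)=L_0(x,\xi):=\limsup_{\rho\to0}\limsup_{\varepsilon\to0}\frac{m_\varepsilon(v+\xi(\cdot-x);Q_\rho(x))}{\rho^d}.$$ -/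

import Mathlib

open Set Filter Topology MeasureTheory
open scoped ENNReal NNReal Pointwise ContDiff

namespace Homogenization

/-- Euclidean space `ℝⁿ`. -/
abbrev E (n : ℕ) : Type := EuclideanSpace ℝ (Fin n)

/-- The space `𝕄^{m×d}` of real `m × d` matrices, with the Euclidean norm of the entries. -/
abbrev Mat (m d : ℕ) : Type := EuclideanSpace ℝ (Fin m × Fin d)

variable {d m : ℕ}

/-- The product `ξ y` of the matrix `ξ` and the vector `y`. -/
noncomputable def Mat.mulVec (ξ : Mat m d) (y : E d) : E m :=
  WithLp.toLp 2 fun i => ∑ j, ξ (i, j) * y j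

/-- The partial derivative `∂_j f(x)`. -/
noncomputable def partialDeriv (j : Fin d) (f : E d → ℝ) (x : E d) : ℝ :=
  fderiv ℝ f x (EuclideanSpace.single j 1)

/-- The Jacobian matrix `(∂_j ψ_i(x))_{i,j}` of a differentiable map `ψ`. -/
noncomputable def jacobian (ψ : E d → E m) (x : E d) : Mat m d :=
  WithLp.toLp 2 fun ij => partialDeriv ij.2 (fun y => ψ y ij.1) x

/-- `G` is a weak (distributional) gradient of `u` in the open set `Ω`. -/
def IsWeakGradient (Ω : Set (E d)) (u : E d → E m) (G : E d → Mat m d) : Prop :=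
  ∀ φ : E d → ℝ, ContDiff ℝ ∞ φ → HasCompactSupport φ → tsupport φ ⊆ Ω →
    ∀ (i : Fin m) (j : Fin d),
      ∫ x in Ω, partialDeriv j φ x * u x i = - ∫ x in Ω, φ x * G x (i, j)

/-- An element of the Sobolev space `W^{1,p}(Ω;ℝᵐ)`, given by a representative of the function and
a representative of its weak gradient (which is unique almost everywhere in `Ω`). -/
structure Sobolev (Ω : Set (E d)) (p : ℝ) (m : ℕ) where
  toFun : E d → E m
  grad : E d → Mat m d
  memLp_toFun : MemLp toFun (ENNReal.ofReal p) (volume.restrict Ω)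
  memLp_grad : MemLp grad (ENNReal.ofReal p) (volume.restrict Ω)
  isWeakGradient : IsWeakGradient Ω toFun grad

/-- `φ ∈ W^{1,p}(O;ℝᵐ)` belongs to `W^{1,p}_0(O;ℝᵐ)`, the closure of `C_c^∞(O;ℝᵐ)` in the norm of
`W^{1,p}(O;ℝᵐ)`. -/
def Sobolev.IsZeroBoundary {O : Set (E d)} {p : ℝ} (φ : Sobolev O p m) : Prop :=
  ∃ ψ : ℕ → E d → E m,
    (∀ n, ContDiff ℝ ∞ (ψ n) ∧ HasCompactSupport (ψ n) ∧ tsupport (ψ n) ⊆ O) ∧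
    Tendsto (fun n => eLpNorm (fun x => φ.toFun x - ψ n x) (ENNReal.ofReal p)
      (volume.restrict O)) atTop (𝓝 0) ∧
    Tendsto (fun n => eLpNorm (fun x => φ.grad x - jacobian (ψ n) x) (ENNReal.ofReal p)
      (volume.restrict O)) atTop (𝓝 0)

/-- The open cube `Q_ρ(x)` with centre `x` and side length `ρ`. -/
def cube (x : E d) (ρ : ℝ) : Set (E d) := {y | ∀ i, |y i - x i| < ρ / 2}

/-- The functional `F_ε(u;O) = ∫_O L(x/ε, ∇u(x)) dx` on `W^{1,p}(Ω;ℝᵐ)`, for `O ⊆ Ω`. -/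
noncomputable def energy (L : E d → Mat m d → ℝ≥0) {Ω : Set (E d)} {p : ℝ} (ε : ℝ)
    (O : Set (E d)) (u : Sobolev Ω p m) : ℝ≥0∞ :=
  ∫⁻ x in O, (L (ε⁻¹ • x) (u.grad x) : ℝ≥0∞)

/-- The infimum `m_ε(u;O)` of the local Dirichlet problem: the infimum of `F_ε(v;O)` over all
`v ∈ W^{1,p}(Ω;ℝᵐ)` with `v = u` almost everywhere in `Ω \ O`. -/
noncomputable def dirichletInf (Ω : Set (E d)) (p : ℝ) (L : E d → Mat m d → ℝ≥0) (ε : ℝ)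
    (u : E d → E m) (O : Set (E d)) : ℝ≥0∞ :=
  ⨅ (v : Sobolev Ω p m) (_ : ∀ᵐ x ∂(volume.restrict (Ω \ O)), v.toFun x = u x), energy L ε O v

/-- The growth condition (G₁): there are `β > 0` and a finite measure `ν ≪ λ` such that
`m_ε(u;V)/|V| ≤ β (ν(V)/|V| + ⨍_V |u|^p + ⨍_V |∇u|^p)` for all open `V ⊆ Ω`,
`u ∈ W^{1,p}(Ω;ℝᵐ)` and `ε ∈ ]0,1]`. -/
def GrowthG1 (Ω : Set (E d)) (p : ℝ) (L : E d → Mat m d → ℝ≥0) : Prop :=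
  ∃ (β : ℝ≥0) (ν : Measure (E d)), 0 < β ∧ IsFiniteMeasure ν ∧ ν ≪ volume ∧
    ∀ (V : Set (E d)) (u : Sobolev Ω p m) (ε : ℝ), IsOpen V → V ⊆ Ω → 0 < ε → ε ≤ 1 →
      dirichletInf Ω p L ε u.toFun V / volume V ≤
        β * (ν V / volume V + (⨍⁻ x in V, ‖u.toFun x‖ₑ ^ p ∂volume) +
          ⨍⁻ x in V, ‖u.grad x‖ₑ ^ p ∂volume)

/-- `S_ξ^L(O) = inf {∫_O L(y, ξ + ∇φ(y)) dy : φ ∈ W^{1,p}_0(O;ℝᵐ)}`. -/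
noncomputable def cellInf (p : ℝ) (L : E d → Mat m d → ℝ≥0) (ξ : Mat m d) (O : Set (E d)) :
    ℝ≥0∞ :=
  ⨅ (φ : Sobolev O p m) (_ : φ.IsZeroBoundary), ∫⁻ y in O, (L y (ξ + φ.grad y) : ℝ≥0∞)

/-- `limsup_{ρ→0} limsup_{t→∞} S_ξ^L(t Q_ρ(x)) / λ(t Q_ρ(x))`; this is `L_hom(x,ξ)`. -/
noncomputable def Lhom (p : ℝ) (L : E d → Mat m d → ℝ≥0) (x : E d) (ξ : Mat m d) : ℝ≥0∞ :=
  limsup (fun ρ : ℝ => limsup (fun t : ℝ =>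
    cellInf p L ξ (t • cube x ρ) / volume (t • cube x ρ)) atTop) (𝓝[>] 0)

/-- `liminf_{ρ→0} liminf_{t→∞} S_ξ^L(t Q_ρ(x)) / λ(t Q_ρ(x))`. -/
noncomputable def LhomInf (p : ℝ) (L : E d → Mat m d → ℝ≥0) (x : E d) (ξ : Mat m d) : ℝ≥0∞ :=
  liminf (fun ρ : ℝ => liminf (fun t : ℝ =>
    cellInf p L ξ (t • cube x ρ) / volume (t • cube x ρ)) atTop) (𝓝[>] 0)

/-- `L` is an H-integrand: for every `ξ`, the two iterated limits agree for a.e. `x ∈ Ω`. -/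
def IsHIntegrand (Ω : Set (E d)) (p : ℝ) (L : E d → Mat m d → ℝ≥0) : Prop :=
  ∀ ξ : Mat m d, ∀ᵐ x ∂(volume.restrict Ω), Lhom p L x ξ = LhomInf p L x ξ

/-- `L₀(x,v,ξ) = limsup_{ρ→0} limsup_{ε→0} m_ε(v + ξ(· - x); Q_ρ(x)) / ρ^d`. -/
noncomputable def L0 (Ω : Set (E d)) (p : ℝ) (L : E d → Mat m d → ℝ≥0) (x : E d) (v : E m)
    (ξ : Mat m d) : ℝ≥0∞ :=
  limsup (fun ρ : ℝ => limsup (fun ε : ℝ =>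
    dirichletInf Ω p L ε (fun y => v + ξ.mulVec (y - x)) (cube x ρ)) (𝓝[>] 0) /
      ENNReal.ofReal ρ ^ d) (𝓝[>] 0)

/-- The family `v ε ∈ W^{1,p}(Ω;ℝᵐ)` converges to `u` in `L^p(Ω;ℝᵐ)` as `ε → 0⁺`. -/
def ConvergesLp {Ω : Set (E d)} {p : ℝ} (v : ℝ → Sobolev Ω p m) (u : Sobolev Ω p m) : Prop :=
  Tendsto (fun ε => eLpNorm (fun x => (v ε).toFun x - u.toFun x) (ENNReal.ofReal p)
    (volume.restrict Ω)) (𝓝[>] 0) (𝓝 0)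

/-- The `Γ(L^p)`-lower limit at `u`, as `ε → 0⁺`, of a family of functionals on `W^{1,p}`. -/
noncomputable def gammaLiminf {Ω : Set (E d)} {p : ℝ} (F : ℝ → Sobolev Ω p m → ℝ≥0∞)
    (u : Sobolev Ω p m) : ℝ≥0∞ :=
  ⨅ (v : ℝ → Sobolev Ω p m) (_ : ConvergesLp v u), liminf (fun ε => F ε (v ε)) (𝓝[>] 0)

/-- The `Γ(L^p)`-upper limit at `u`, as `ε → 0⁺`, of a family of functionals on `W^{1,p}`. -/
noncomputable def gammaLimsup {Ω : Set (E d)} {p : ℝ} (F : ℝ → Sobolev Ω p m → ℝ≥0∞)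
    (u : Sobolev Ω p m) : ℝ≥0∞ :=
  ⨅ (v : ℝ → Sobolev Ω p m) (_ : ConvergesLp v u), limsup (fun ε => F ε (v ε)) (𝓝[>] 0)

/-- The family `F` `Γ(L^p)`-converges at `u`, with `Γ`-limit `ℓ`. -/
def GammaConvergesAt {Ω : Set (E d)} {p : ℝ} (F : ℝ → Sobolev Ω p m → ℝ≥0∞)
    (u : Sobolev Ω p m) (ℓ : ℝ≥0∞) : Prop :=
  gammaLiminf F u = ℓ ∧ gammaLimsup F u = ℓ

end Homogenization

/-! ### Cubes in Euclidean space -/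

namespace Homogenization

variable {d m : ℕ}

/-! Everything is expressed through the set functions O ↦ m_ε(u;O). Condition (G₁) bounds them by β
μ, where μ is the measure ν + (|u|^p + |∇u|^p) dx on Ω (`Sobolev.growthMeasure`), and gluing makes
them subadditive when a closed cube is removed from an open set (`dirichletInf_le_add`). There is no
pointwise upper bound on L, so the energy of a modified function cannot be estimated directly. In a
transition region it is replaced by a Dirichlet infimum, which (G₁) controls
(`GrowthBound.exists_transition`).

Let g(x) be the upper density of limsup_ε m_ε(u;Q_r(x)) with respect to r^d as r → 0. For an affine
u, a change of variables turns m_ε on a cube into a cell problem (`dirichletInf_affine_eq`). Its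
additive constant is irrelevant, and g(x) is L_hom at the gradient when x is the base point; this is
(ii). A general u is compared with an affine function of gradient ξ on the cubes of sides r and s r.
Poincaré's inequality and the transition estimate bound the difference by μ and |ξ|^p times Lebesgue
measure on the region between the cubes, and by the integral of |∇u - ξ|^p. Dividing by r^d, letting
r → 0 at a differentiation point and then s → 1 gives g = L_hom(·,∇u) almost everywhere
(`ae_density_eq`). The exceptional null set in (H) depends on ξ, so (H) is used only on a countable
dense set of matrices. This is enough to show that the lower density of u equals g, without any
continuity of L_hom in ξ.

It remains to identify both Γ-limits with ∫_O g. On small cubes Q around almost every point, ∫_Q g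
and the lower and upper limits of m_ε(u;Q) agree up to δ|Q| (`ae_eventually_close`), and Vitali's
theorem fills O with disjoint cubes of this kind. For the lower bound, a family v_ε → u is joined to
u near the boundary of Q in the best of N layers. Coercivity makes the cost small, so the energies
are asymptotically at least m_ε(u;Q) (`lowerInf_le_liminf_energy`), and Fatou's lemma sums over the
cubes. For the upper bound, near minimizers on cubes of side less than η are glued. Coercivity and
Poincaré's inequality make the L^p distance to u of order η (`exists_competitor`).

Measurability of g comes from monotonicity: the defect β μ(Q) - limsup_ε m_ε(u;Q) increases with the
cube Q, so infima of its quotients over small cubes are upper semicontinuous in the centre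
(`aemeasurable_upperDensity`). -/

/-- The closed cube with centre `x` and side length `ρ`. -/
def closedCube (x : E d) (ρ : ℝ) : Set (E d) := {y | ∀ i, |y i - x i| ≤ ρ / 2}

lemma cube_eq_preimage_ball (x : E d) {ρ : ℝ} (hρ : 0 < ρ) :
    cube x ρ = WithLp.ofLp ⁻¹' Metric.ball (WithLp.ofLp x) (ρ / 2) := by
  ext y
  simp [cube, dist_pi_lt_iff (half_pos hρ), Real.dist_eq]

lemma closedCube_eq_preimage_closedBall (x : E d) {ρ : ℝ} (hρ : 0 ≤ ρ) :
    closedCube x ρ = WithLp.ofLp ⁻¹' Metric.closedBall (WithLp.ofLp x) (ρ / 2) := by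
  ext y
  simp [closedCube, dist_pi_le_iff (div_nonneg hρ zero_le_two), Real.dist_eq]

lemma isOpen_cube (x : E d) (ρ : ℝ) : IsOpen (cube x ρ) := by
  simp only [cube, ofPred_forall]
  exact isOpen_iInter_of_finite fun i => isOpen_lt (by fun_prop) continuous_const

lemma isClosed_closedCube (x : E d) (ρ : ℝ) : IsClosed (closedCube x ρ) := by
  simp only [closedCube, ofPred_forall]
  exact isClosed_iInter fun i => isClosed_le (by fun_prop) continuous_const

lemma measurableSet_cube (x : E d) (ρ : ℝ) : MeasurableSet (cube x ρ) :=
  (isOpen_cube x ρ).measurableSet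

lemma measurableSet_closedCube (x : E d) (ρ : ℝ) : MeasurableSet (closedCube x ρ) :=
  (isClosed_closedCube x ρ).measurableSet

lemma cube_subset_closedCube (x : E d) (ρ : ℝ) : cube x ρ ⊆ closedCube x ρ :=
  fun _ hy i => (hy i).le

lemma closedCube_subset_cube (x : E d) {a b : ℝ} (h : a < b) : closedCube x a ⊆ cube x b :=
  fun _ hy i => (hy i).trans_lt (by linarith)

lemma cube_mono (x : E d) {a b : ℝ} (h : a ≤ b) : cube x a ⊆ cube x b :=
  fun _ hy i => (hy i).trans_le (by linarith)

lemma closedCube_mono (x : E d) {a b : ℝ} (h : a ≤ b) : closedCube x a ⊆ closedCube x b :=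
  fun _ hy i => (hy i).trans (by linarith)

lemma mem_cube_self (x : E d) {ρ : ℝ} (hρ : 0 < ρ) : x ∈ cube x ρ :=
  fun i => by simpa using hρ

lemma convex_cube (x : E d) (ρ : ℝ) : Convex ℝ (cube x ρ) := by
  intro y hy z hz a b ha hb hab i
  have h : (a • y + b • z) i - x i = a * (y i - x i) + b * (z i - x i) := by
    have : x i = (a + b) * x i := by rw [hab, one_mul]
    simp only [PiLp.add_apply, PiLp.smul_apply, smul_eq_mul]
    linear_combination -this
  rw [h]
  have h1 := abs_add_le (a * (y i - x i)) (b * (z i - x i))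
  rw [abs_mul, abs_mul, abs_of_nonneg ha, abs_of_nonneg hb] at h1
  -- The strict inequality must come from a point with positive weight: from `z` if `a = 0`, from
  -- `y` otherwise.
  rcases ha.eq_or_lt with rfl | ha
  · have : b = 1 := by linarith
    subst this
    linarith [hz i]
  · have h2 : (a + b) * (ρ / 2) = ρ / 2 := by rw [hab, one_mul]
    linarith [mul_lt_mul_of_pos_left (hy i) ha, mul_le_mul_of_nonneg_left (hz i).le hb]

lemma volume_cube (x : E d) {ρ : ℝ} (hρ : 0 < ρ) : volume (cube x ρ) = ENNReal.ofReal ρ ^ d := by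
  rw [cube_eq_preimage_ball x hρ, (PiLp.volume_preserving_ofLp (Fin d)).measure_preimage
    measurableSet_ball.nullMeasurableSet, Real.volume_pi_ball _ (half_pos hρ)]
  simp [mul_div_cancel₀, ENNReal.ofReal_pow hρ.le]

lemma volume_closedCube (x : E d) {ρ : ℝ} (hρ : 0 ≤ ρ) :
    volume (closedCube x ρ) = ENNReal.ofReal ρ ^ d := by
  rw [closedCube_eq_preimage_closedBall x hρ, (PiLp.volume_preserving_ofLp (Fin d)).measure_preimage
    measurableSet_closedBall.nullMeasurableSet, Real.volume_pi_closedBall _ (div_nonneg hρ zero_le_two)]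
  simp [mul_div_cancel₀, ENNReal.ofReal_pow hρ]

lemma volume_closedCube_diff_cube (x : E d) {ρ : ℝ} (hρ : 0 < ρ) :
    volume (closedCube x ρ \ cube x ρ) = 0 := by
  rw [measure_sdiff (cube_subset_closedCube x ρ) (measurableSet_cube x ρ).nullMeasurableSet
    (by rw [volume_cube x hρ]; exact ENNReal.pow_ne_top ENNReal.ofReal_ne_top),
    volume_cube x hρ, volume_closedCube x hρ.le, tsub_self]

lemma isBounded_closedCube (x : E d) (ρ : ℝ) : Bornology.IsBounded (closedCube x ρ) := by
  -- A negative side gives the empty set, except for `d = 0`, where the whole space is a single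
  -- point.
  rcases lt_or_ge ρ 0 with h | h
  · rcases isEmpty_or_nonempty (Fin d) with hd | ⟨⟨i⟩⟩
    · exact (Set.toFinite _).isBounded
    · convert Bornology.isBounded_empty (α := E d)
      ext y
      simp only [closedCube, mem_ofPred_eq, mem_empty_iff_false, iff_false, not_forall, not_le]
      exact ⟨i, by linarith [abs_nonneg (y i - x i)]⟩
  · rw [closedCube_eq_preimage_closedBall x h]
    exact (PiLp.antilipschitzWith_ofLp 2 (fun _ : Fin d => ℝ)).isBounded_preimage
      Metric.isBounded_closedBall

lemma isCompact_closedCube (x : E d) (ρ : ℝ) : IsCompact (closedCube x ρ) :=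
  Metric.isCompact_of_isClosed_isBounded (isClosed_closedCube x ρ) (isBounded_closedCube x ρ)

lemma norm_sub_le_of_mem_closedCube {x y : E d} {ρ : ℝ} (hρ : 0 ≤ ρ) (hy : y ∈ closedCube x ρ) :
    ‖y - x‖ ≤ √d * ρ := by
  rw [EuclideanSpace.norm_eq]
  have : ∑ i, ‖(y - x) i‖ ^ 2 ≤ ∑ _i : Fin d, ρ ^ 2 := Finset.sum_le_sum fun i _ => by
    have := hy i
    gcongr
    simp only [PiLp.sub_apply, Real.norm_eq_abs]
    linarith
  refine (Real.sqrt_le_sqrt this).trans ?_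
  simp [Real.sqrt_sq hρ]

lemma eventually_closedCube_subset {x : E d} {O : Set (E d)} (hO : IsOpen O) (hx : x ∈ O) :
    ∀ᶠ r in 𝓝[>] (0 : ℝ), closedCube x r ⊆ O := by
  obtain ⟨δ, hδ, hb⟩ := Metric.isOpen_iff.1 hO x hx
  have h : Tendsto (fun r : ℝ => √d * r) (𝓝[>] 0) (𝓝 0) := by
    have : Tendsto (fun r : ℝ => √d * r) (𝓝 0) (𝓝 (√d * 0)) :=
      (continuous_const.mul continuous_id).tendsto 0
    simpa using this.mono_left nhdsWithin_le_nhds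
  filter_upwards [h.eventually (gt_mem_nhds hδ), self_mem_nhdsWithin] with r hr h0 y hy
  exact hb (mem_ball_iff_norm.2 ((norm_sub_le_of_mem_closedCube (le_of_lt h0) hy).trans_lt hr))

lemma ofReal_pow_ne_zero {ρ : ℝ} (hρ : 0 < ρ) : ENNReal.ofReal ρ ^ d ≠ 0 := by
  simp [hρ]

lemma ofReal_pow_ne_top {ρ : ℝ} : ENNReal.ofReal ρ ^ d ≠ ⊤ :=
  ENNReal.pow_ne_top ENNReal.ofReal_ne_top

lemma smul_cube (x : E d) (ρ : ℝ) {t : ℝ} (ht : 0 < t) : t • cube x ρ = cube (t • x) (t * ρ) := by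
  ext y
  rw [mem_smul_set_iff_inv_smul_mem₀ ht.ne']
  refine forall_congr' fun i => ?_
  have : (t⁻¹ • y) i - x i = t⁻¹ * (y i - (t • x) i) := by
    simp only [PiLp.smul_apply, smul_eq_mul]
    field_simp
  rw [this, abs_mul, abs_of_pos (inv_pos.2 ht), inv_mul_lt_iff₀ ht, mul_div_assoc]

end Homogenization

/-! ### Weak partial derivatives of scalar functions -/

namespace Homogenization

variable {d m : ℕ} {Ω : Set (E d)}

/-- `g` is the weak partial derivative `∂_j f` in `Ω`. -/
def IsWeakDeriv (Ω : Set (E d)) (j : Fin d) (f g : E d → ℝ) : Prop :=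
  ∀ φ : E d → ℝ, ContDiff ℝ ∞ φ → HasCompactSupport φ → tsupport φ ⊆ Ω →
    ∫ x in Ω, partialDeriv j φ x * f x = - ∫ x in Ω, φ x * g x

lemma isWeakGradient_iff {u : E d → E m} {G : E d → Mat m d} :
    IsWeakGradient Ω u G ↔ ∀ i j, IsWeakDeriv Ω j (fun x => u x i) (fun x => G x (i, j)) :=
  ⟨fun h i j φ h1 h2 h3 => h φ h1 h2 h3 i j, fun h φ h1 h2 h3 i j => h i j φ h1 h2 h3⟩

lemma continuous_partialDeriv {φ : E d → ℝ} (hφ : ContDiff ℝ ∞ φ) (j : Fin d) :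
    Continuous (partialDeriv j φ) :=
  (hφ.continuous_fderiv (by simp)).clm_apply continuous_const

lemma hasCompactSupport_partialDeriv {φ : E d → ℝ} (hφ : HasCompactSupport φ) (j : Fin d) :
    HasCompactSupport (partialDeriv j φ) := hφ.fderiv_apply ℝ _

lemma tsupport_partialDeriv_subset (φ : E d → ℝ) (j : Fin d) :
    tsupport (partialDeriv j φ) ⊆ tsupport φ := tsupport_fderiv_apply_subset ℝ _

lemma partialDeriv_mul {φ χ : E d → ℝ} (hφ : ContDiff ℝ ∞ φ) (hχ : ContDiff ℝ ∞ χ) (j : Fin d)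
    (x : E d) : partialDeriv j (fun y => φ y * χ y) x =
      partialDeriv j φ x * χ x + φ x * partialDeriv j χ x := by
  unfold partialDeriv
  rw [fderiv_fun_mul (hφ.differentiable (by simp) x) (hχ.differentiable (by simp) x)]
  simp only [add_apply, smul_apply, smul_eq_mul]
  ring

lemma integrable_mul_of_hasCompactSupport {μ : Measure (E d)} {φ f : E d → ℝ} (hφ : Continuous φ)
    (hc : HasCompactSupport φ) (hf : LocallyIntegrable f μ) : Integrable (fun x => φ x * f x) μ :=
  hf.integrable_smul_left_of_hasCompactSupport hφ hc

/-- The value 1 is attained on a neighbourhood of `K`, not only on `K`, so that the derivatives of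
`χ` vanish at the points of `K`. -/
lemma exists_cutoff {K Ω : Set (E d)} (hK : IsCompact K) (hΩ : IsOpen Ω) (hKΩ : K ⊆ Ω) :
    ∃ χ : E d → ℝ, ContDiff ℝ ∞ χ ∧ HasCompactSupport χ ∧ tsupport χ ⊆ Ω ∧ ∃ U, IsOpen U ∧ K ⊆ U ∧ ∀ x ∈ U, χ x = 1 := by
  obtain ⟨K', hK', hKK', hK'Ω⟩ := exists_compact_between hK hΩ hKΩ
  obtain ⟨χ, h1, h0, -⟩ := exists_contMDiffMap_one_nhds_of_subset_interior (n := (⊤ : ℕ∞))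
    (modelWithCornersSelf ℝ (E d)) hK.isClosed hKK'
  obtain ⟨U, hU, hKU, h1⟩ := eventually_nhdsSet_iff_exists.1 h1
  have hs : tsupport χ ⊆ K' := closure_minimal (fun x hx => by_contra fun h => hx (h0 x h)) hK'.isClosed
  exact ⟨χ, χ.contMDiff.contDiff, hK'.of_isClosed_subset (isClosed_tsupport _) hs, hs.trans hK'Ω,
    U, hU, hKU, h1⟩

namespace IsWeakDeriv

variable {j : Fin d} {f g f' g' : E d → ℝ}

lemma add (h : IsWeakDeriv Ω j f g) (h' : IsWeakDeriv Ω j f' g')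
    (hf : LocallyIntegrable f (volume.restrict Ω)) (hg : LocallyIntegrable g (volume.restrict Ω))
    (hf' : LocallyIntegrable f' (volume.restrict Ω))
    (hg' : LocallyIntegrable g' (volume.restrict Ω)) :
    IsWeakDeriv Ω j (fun x => f x + f' x) (fun x => g x + g' x) := by
  intro φ h1 h2 h3
  have hd := continuous_partialDeriv h1 j
  have hs := hasCompactSupport_partialDeriv h2 j
  simp only [mul_add]
  rw [integral_add (integrable_mul_of_hasCompactSupport hd hs hf)
    (integrable_mul_of_hasCompactSupport hd hs hf'),
    integral_add (integrable_mul_of_hasCompactSupport h1.continuous h2 hg)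
    (integrable_mul_of_hasCompactSupport h1.continuous h2 hg'), h φ h1 h2 h3, h' φ h1 h2 h3]
  ring

lemma const_mul (h : IsWeakDeriv Ω j f g) (c : ℝ) :
    IsWeakDeriv Ω j (fun x => c * f x) (fun x => c * g x) := by
  intro φ h1 h2 h3
  simp only [mul_left_comm _ c]
  rw [integral_const_mul, integral_const_mul, h φ h1 h2 h3, mul_neg]

lemma setIntegral_eq_of_tsupport_subset {O : Set (E d)} {φ : E d → ℝ} (hφ : tsupport φ ⊆ O)
    (hO : O ⊆ Ω) (f : E d → ℝ) :
    ∫ x in Ω, φ x * f x = ∫ x in O, φ x * f x := by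
  have h : ∀ x, x ∉ O → φ x * f x = 0 := fun x hx => by
    rw [image_eq_zero_of_notMem_tsupport fun h => hx (hφ h), zero_mul]
  rw [setIntegral_eq_integral_of_forall_compl_eq_zero h,
    setIntegral_eq_integral_of_forall_compl_eq_zero fun x hx => h x fun h' => hx (hO h')]

lemma mono (h : IsWeakDeriv Ω j f g) {O : Set (E d)} (hO : O ⊆ Ω) : IsWeakDeriv O j f g := by
  intro φ h1 h2 h3
  rw [← setIntegral_eq_of_tsupport_subset ((tsupport_partialDeriv_subset φ j).trans h3) hO,
    ← setIntegral_eq_of_tsupport_subset h3 hO, h φ h1 h2 (h3.trans hO)]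

lemma of_contDiff {f : E d → ℝ} (hf : ContDiff ℝ ∞ f) (Ω : Set (E d)) (j : Fin d) :
    IsWeakDeriv Ω j f (partialDeriv j f) := by
  have h : IsWeakDeriv univ j f (partialDeriv j f) := by
    intro φ h1 h2 _
    simp only [Measure.restrict_univ]
    have hd := continuous_partialDeriv h1 j
    have hs := hasCompactSupport_partialDeriv h2 j
    have := integral_mul_fderiv_eq_neg_fderiv_mul_of_integrable (μ := (volume : Measure (E d)))
      (f := f) (g := φ) (v := EuclideanSpace.single j 1)
      ((integrable_mul_of_hasCompactSupport h1.continuous h2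
        (continuous_partialDeriv hf j).locallyIntegrable).congr
        (ae_of_all _ fun x => mul_comm _ _))
      ((integrable_mul_of_hasCompactSupport hd hs hf.continuous.locallyIntegrable).congr
        (ae_of_all _ fun x => mul_comm _ _))
      ((integrable_mul_of_hasCompactSupport h1.continuous h2 hf.continuous.locallyIntegrable).congr
        (ae_of_all _ fun x => mul_comm _ _))
      (fun x _ => hf.differentiable (by simp) x) (fun x _ => h1.differentiable (by simp) x)
    simpa only [partialDeriv, mul_comm] using this
  exact h.mono (subset_univ _)

/-- Test the weak derivative of `f` with `φ * χ`, which is admissible because its support lies in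
that of `φ`, and move the term with `∂_j χ` to the other side. -/
lemma mul_contDiff (h : IsWeakDeriv Ω j f g) {χ : E d → ℝ} (hχ : ContDiff ℝ ∞ χ)
    (hf : LocallyIntegrable f (volume.restrict Ω)) (hg : LocallyIntegrable g (volume.restrict Ω)) :
    IsWeakDeriv Ω j (fun x => χ x * f x) (fun x => χ x * g x + partialDeriv j χ x * f x) := by
  intro φ h1 h2 h3
  have h4 := h (fun x => φ x * χ x) (h1.mul hχ) h2.mul_right
    ((tsupport_mul_subset_left).trans h3)
  simp only [partialDeriv_mul h1 hχ, add_mul] at h4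
  have i1 : Integrable (fun x => partialDeriv j φ x * χ x * f x) (volume.restrict Ω) :=
    integrable_mul_of_hasCompactSupport ((continuous_partialDeriv h1 j).mul hχ.continuous)
    (hasCompactSupport_partialDeriv h2 j).mul_right hf
  have i2 : Integrable (fun x => φ x * partialDeriv j χ x * f x) (volume.restrict Ω) :=
    integrable_mul_of_hasCompactSupport (h1.continuous.mul (continuous_partialDeriv hχ j))
    h2.mul_right hf
  have i3 : Integrable (fun x => φ x * χ x * g x) (volume.restrict Ω) :=
    integrable_mul_of_hasCompactSupport (h1.continuous.mul hχ.continuous) h2.mul_right hg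
  rw [integral_add i1 i2] at h4
  have h5 : ∫ x in Ω, φ x * (χ x * g x + partialDeriv j χ x * f x) =
      (∫ x in Ω, φ x * χ x * g x) + ∫ x in Ω, φ x * partialDeriv j χ x * f x := by
    rw [← integral_add i3 i2]
    exact integral_congr_ae (ae_of_all _ fun x => by ring)
  rw [h5]
  simp only [← mul_assoc] at *
  linarith

/-- Weak derivatives are local: test functions supported in `O` only see `f = 0`, and the
fundamental lemma of the calculus of variations then gives `g = 0`. -/
lemma ae_eq_zero (h : IsWeakDeriv Ω j f g) {O : Set (E d)} (hO : IsOpen O) (hOΩ : O ⊆ Ω)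
    (hg : LocallyIntegrable g (volume.restrict Ω)) (hf : ∀ᵐ x ∂volume.restrict O, f x = 0) :
    ∀ᵐ x ∂volume.restrict O, g x = 0 := by
  have h1 : LocallyIntegrable g (volume.restrict O) :=
    hg.mono_measure (Measure.restrict_mono hOΩ le_rfl)
  have h2 := hO.ae_eq_zero_of_integral_contDiff_smul_eq_zero (f := g) (μ := volume.restrict O)
    (h1.locallyIntegrableOn _) fun φ c1 c2 c3 => by
      have := (h.mono hOΩ) φ c1 c2 c3
      rw [integral_eq_zero_of_ae (hf.mono fun x hx => by simp [hx])] at this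
      simp only [smul_eq_mul]
      linarith
  filter_upwards [h2, ae_restrict_mem hO.measurableSet] with x hx hx' using hx hx'

/-- Extension by zero of a function with compact support in `Ω`. -/
lemma indicator (h : IsWeakDeriv Ω j f g) (hΩ : IsOpen Ω)
    (hg : LocallyIntegrable g (volume.restrict Ω))
    {K : Set (E d)} (hK : IsCompact K) (hKΩ : K ⊆ Ω)
    (hf0 : ∀ᵐ x ∂volume.restrict (Ω \ K), f x = 0) :
    IsWeakDeriv univ j (Ω.indicator f) (Ω.indicator g) := by
  -- A test function `φ` on the whole space is admissible in `Ω` only after multiplication by `χ`.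
  -- Since `f` and `g` vanish almost everywhere in `Ω` off `K`, and `χ = 1` near `K`, this changes
  -- neither integral.
  obtain ⟨χ, hχ, -, hχs, U, hU, hKU, hχ1⟩ := exists_cutoff hK hΩ hKΩ
  have hg0 : ∀ᵐ x ∂volume.restrict (Ω \ K), g x = 0 :=
    h.ae_eq_zero (hΩ.sdiff hK.isClosed) sdiff_subset hg hf0
  have key : ∀ (a b k : E d → ℝ), (∀ᵐ x ∂volume.restrict (Ω \ K), k x = 0) →
      (∀ x ∈ K, a x = b x) → ∫ x in Ω, a x * k x = ∫ x in Ω, b x * k x := by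
    intro a b k hk hab
    refine setIntegral_congr_ae hΩ.measurableSet ?_
    rw [ae_restrict_iff' (hΩ.measurableSet.diff hK.measurableSet)] at hk
    filter_upwards [hk] with x hx hxΩ
    by_cases hxK : x ∈ K
    · rw [hab x hxK]
    · rw [hx ⟨hxΩ, hxK⟩, mul_zero, mul_zero]
  have ind : ∀ (a k : E d → ℝ), ∫ x in univ, a x * Ω.indicator k x = ∫ x in Ω, a x * k x := by
    intro a k
    rw [← integral_indicator hΩ.measurableSet, Measure.restrict_univ]
    exact integral_congr_ae (ae_of_all _ fun x => by by_cases hx : x ∈ Ω <;> simp [hx])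
  intro φ h1 h2 _
  have h4 := h (fun x => φ x * χ x) (h1.mul hχ) h2.mul_right (tsupport_mul_subset_right.trans hχs)
  rw [ind, ind]
  refine (key _ _ f hf0 fun x hx => ?_).trans (h4.trans (congrArg _ (key _ _ g hg0 fun x hx => ?_)))
  · have : (fun y => φ y * χ y) =ᶠ[𝓝 x] φ := by
      filter_upwards [hU.mem_nhds (hKU hx)] with y hy
      rw [hχ1 y hy, mul_one]
    rw [partialDeriv, partialDeriv, this.fderiv_eq]
  · rw [hχ1 x (hKU hx), mul_one]

/-- Change of variables `x ↦ c • x + b`. -/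
lemma comp_affine (h : IsWeakDeriv univ j f g) {c : ℝ} (hc : c ≠ 0) (b : E d) :
    IsWeakDeriv univ j (fun x => c⁻¹ * f (c • x + b)) (fun x => g (c • x + b)) := by
  intro φ h1 h2 _
  simp only [Measure.restrict_univ]
  let e : E d ≃ₜ E d := (Homeomorph.smulOfNeZero c hc).trans (Homeomorph.addRight b)
  have he : ∀ x, e x = c • x + b := fun x => rfl
  have hes : ∀ x, e.symm x = c⁻¹ • (x - b) := fun x => by
    rw [Homeomorph.symm_apply_eq, he, smul_inv_smul₀ hc, sub_add_cancel]
  have cov : ∀ F : E d → ℝ, ∫ x, F (c • x + b) = |(c ^ d)⁻¹| * ∫ x, F x := fun F => by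
    rw [Measure.integral_comp_smul volume (fun x => F (x + b)) c, integral_add_right_eq_self F b]
    simp
  -- The test function is transported by the inverse affine map; its derivative produces the factor
  -- `c⁻¹` that appears in front of `f`.
  have hψ : ContDiff ℝ ∞ fun x => φ (c⁻¹ • (x - b)) := h1.comp (by fun_prop)
  have hψc : HasCompactSupport fun x => φ (c⁻¹ • (x - b)) := by
    have := h2.comp_homeomorph e.symm
    simpa only [Function.comp_def, hes] using this
  have hψd : ∀ x, partialDeriv j (fun x => φ (c⁻¹ • (x - b))) (c • x + b) =
      c⁻¹ * partialDeriv j φ x := by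
    intro x
    have e1 : c⁻¹ • (c • x + b - b) = x := by rw [add_sub_cancel_right, inv_smul_smul₀ hc]
    have hd : HasFDerivAt (fun y : E d => c⁻¹ • (y - b)) (c⁻¹ • ContinuousLinearMap.id ℝ (E d))
        (c • x + b) := ((hasFDerivAt_id _).sub_const b).const_smul c⁻¹
    have h3 : HasFDerivAt φ (fderiv ℝ φ x) (c⁻¹ • (c • x + b - b)) := by
      rw [e1]; exact (h1.differentiable (by simp) x).hasFDerivAt
    unfold partialDeriv
    have h4 := (h3.comp (c • x + b) hd).fderiv
    rw [Function.comp_def] at h4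
    rw [h4]
    simp
  have h3 := h _ hψ hψc (subset_univ _)
  simp only [Measure.restrict_univ] at h3
  have h4 := cov fun x => partialDeriv j (fun x => φ (c⁻¹ • (x - b))) x * f x
  have h5 := cov fun x => φ (c⁻¹ • (x - b)) * g x
  simp only [hψd, add_sub_cancel_right, inv_smul_smul₀ hc] at h4 h5
  rw [h5, ← mul_neg, ← h3, ← h4]
  exact integral_congr_ae (ae_of_all _ fun x => by ring)

/-- Continuous functions with compact support lie in the conjugate Lebesgue space, so Hölder's
inequality passes to the limit on both sides of the integration by parts formula. -/
lemma of_tendsto {q : ℝ≥0∞} (hq : 1 ≤ q) {F G : ℕ → E d → ℝ} (h : ∀ n, IsWeakDeriv Ω j (F n) (G n))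
    (hF : ∀ n, MemLp (F n) q (volume.restrict Ω)) (hG : ∀ n, MemLp (G n) q (volume.restrict Ω))
    (hf : MemLp f q (volume.restrict Ω)) (hg : MemLp g q (volume.restrict Ω))
    (hFf : Tendsto (fun n => eLpNorm (f - F n) q (volume.restrict Ω)) atTop (𝓝 0))
    (hGg : Tendsto (fun n => eLpNorm (g - G n) q (volume.restrict Ω)) atTop (𝓝 0)) :
    IsWeakDeriv Ω j f g := by
  intro φ h1 h2 h3
  have key : ∀ (θ : E d → ℝ), Continuous θ → HasCompactSupport θ → ∀ (k : E d → ℝ)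
      (K : ℕ → E d → ℝ), MemLp k q (volume.restrict Ω) → (∀ n, MemLp (K n) q (volume.restrict Ω)) →
      Tendsto (fun n => eLpNorm (k - K n) q (volume.restrict Ω)) atTop (𝓝 0) →
      Tendsto (fun n => ∫ x in Ω, θ x * K n x) atTop (𝓝 (∫ x in Ω, θ x * k x)) := by
    intro θ hθ hθc k K hk hK ht
    have hθm : MemLp θ q.conjExponent (volume.restrict Ω) := hθ.memLp_of_hasCompactSupport hθc
    refine tendsto_integral_of_L1 _ ?_ (Eventually.of_forall fun n => ?_) ?_
    · exact (integrable_mul_of_hasCompactSupport hθ hθc (hk.locallyIntegrable hq)).1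
    · exact integrable_mul_of_hasCompactSupport hθ hθc ((hK n).locallyIntegrable hq)
    · have hle : ∀ n, ∫⁻ x in Ω, ‖θ x * K n x - θ x * k x‖ₑ ≤
          eLpNorm θ q.conjExponent (volume.restrict Ω) * eLpNorm (k - K n) q (volume.restrict Ω) := by
        intro n
        have : ENNReal.HolderTriple q.conjExponent q 1 := by
          have := ENNReal.HolderConjugate.conjExponent hq
          exact ENNReal.HolderConjugate.symm
        have := eLpNorm_smul_le_mul_eLpNorm (p := q.conjExponent) (q := q) (r := 1)
          (hk.sub (hK n)).1 hθm.1
        refine le_trans (le_of_eq ?_) this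
        rw [eLpNorm_one_eq_lintegral_enorm]
        refine lintegral_congr fun x => ?_
        rw [← mul_sub, Pi.smul_apply', smul_eq_mul, enorm_mul, enorm_mul, Pi.sub_apply,
          ← enorm_neg (k x - K n x), neg_sub]
      have h0 := ENNReal.Tendsto.const_mul ht (Or.inr hθm.2.ne)
      rw [mul_zero] at h0
      exact tendsto_of_tendsto_of_tendsto_of_le_of_le tendsto_const_nhds h0
        (fun _ => zero_le) hle
  have t1 := key _ (continuous_partialDeriv h1 j) (hasCompactSupport_partialDeriv h2 j) f F hf hF hFf
  have t2 := key φ h1.continuous h2 g G hg hG hGg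
  exact tendsto_nhds_unique t1 ((t2.neg).congr fun n => (h n φ h1 h2 h3).symm)

end IsWeakDeriv

end Homogenization

/-! ### Operations on Sobolev functions -/

namespace Homogenization

variable {d m : ℕ} {Ω : Set (E d)} {p : ℝ}

lemma one_le_ofReal (hp : 1 < p) : 1 ≤ ENNReal.ofReal p := by
  rw [← ENNReal.ofReal_one]; exact ENNReal.ofReal_le_ofReal hp.le

namespace Sobolev

lemma memLp_coord (u : Sobolev Ω p m) (i : Fin m) :
    MemLp (fun x => u.toFun x i) (ENNReal.ofReal p) (volume.restrict Ω) :=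
  u.memLp_toFun.eval_piLp i

lemma memLp_grad_coord (u : Sobolev Ω p m) (ij : Fin m × Fin d) :
    MemLp (fun x => u.grad x ij) (ENNReal.ofReal p) (volume.restrict Ω) :=
  u.memLp_grad.eval_piLp ij

lemma locallyIntegrable_coord (hp : 1 < p) (u : Sobolev Ω p m) (i : Fin m) :
    LocallyIntegrable (fun x => u.toFun x i) (volume.restrict Ω) :=
  (u.memLp_coord i).locallyIntegrable (one_le_ofReal hp)

lemma locallyIntegrable_grad_coord (hp : 1 < p) (u : Sobolev Ω p m) (ij : Fin m × Fin d) :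
    LocallyIntegrable (fun x => u.grad x ij) (volume.restrict Ω) :=
  (u.memLp_grad_coord ij).locallyIntegrable (one_le_ofReal hp)

lemma isWeakDeriv (u : Sobolev Ω p m) (i : Fin m) (j : Fin d) :
    IsWeakDeriv Ω j (fun x => u.toFun x i) (fun x => u.grad x (i, j)) :=
  isWeakGradient_iff.1 u.isWeakGradient i j

/-- Sum of two Sobolev functions. -/
def add (hp : 1 < p) (u v : Sobolev Ω p m) : Sobolev Ω p m where
  toFun x := u.toFun x + v.toFun x
  grad x := u.grad x + v.grad x
  memLp_toFun := u.memLp_toFun.add v.memLp_toFun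
  memLp_grad := u.memLp_grad.add v.memLp_grad
  isWeakGradient := isWeakGradient_iff.2 fun i j =>
    (u.isWeakDeriv i j).add (v.isWeakDeriv i j) (u.locallyIntegrable_coord hp i)
      (u.locallyIntegrable_grad_coord hp _) (v.locallyIntegrable_coord hp i)
      (v.locallyIntegrable_grad_coord hp _)

/-- Scalar multiple of a Sobolev function. -/
def smul (c : ℝ) (u : Sobolev Ω p m) : Sobolev Ω p m where
  toFun x := c • u.toFun x
  grad x := c • u.grad x
  memLp_toFun := u.memLp_toFun.const_smul c
  memLp_grad := u.memLp_grad.const_smul c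
  isWeakGradient := isWeakGradient_iff.2 fun i j => (u.isWeakDeriv i j).const_mul c

/-- Difference of two Sobolev functions. -/
def sub (hp : 1 < p) (u v : Sobolev Ω p m) : Sobolev Ω p m where
  toFun x := u.toFun x - v.toFun x
  grad x := u.grad x - v.grad x
  memLp_toFun := u.memLp_toFun.sub v.memLp_toFun
  memLp_grad := u.memLp_grad.sub v.memLp_grad
  isWeakGradient := by
    have := (u.add hp (v.smul (-1))).isWeakGradient
    simpa only [add, smul, neg_one_smul, ← sub_eq_add_neg] using this

/-- Restriction of a Sobolev function to a smaller set. -/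
def restrict (u : Sobolev Ω p m) {O : Set (E d)} (hO : O ⊆ Ω) : Sobolev O p m where
  toFun := u.toFun
  grad := u.grad
  memLp_toFun := u.memLp_toFun.mono_measure (Measure.restrict_mono hO le_rfl)
  memLp_grad := u.memLp_grad.mono_measure (Measure.restrict_mono hO le_rfl)
  isWeakGradient := isWeakGradient_iff.2 fun i j => (u.isWeakDeriv i j).mono hO

lemma _root_.HasCompactSupport.memLp_mul {μ : Measure (E d)} {χ f : E d → ℝ} (hc : HasCompactSupport χ)
    (hχ : Continuous χ) {q : ℝ≥0∞} (hf : MemLp f q μ) : MemLp (fun x => χ x * f x) q μ :=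
  hf.mul' (r := q) (p := ⊤) (hχ.memLp_top_of_hasCompactSupport hc μ)

/-- Product of a Sobolev function with a smooth function of compact support. -/
noncomputable def mul (hp : 1 < p) (u : Sobolev Ω p m) {χ : E d → ℝ} (hχ : ContDiff ℝ ∞ χ)
    (hc : HasCompactSupport χ) : Sobolev Ω p m where
  toFun x := χ x • u.toFun x
  grad x := WithLp.toLp 2 fun ij => χ x * u.grad x ij + partialDeriv ij.2 χ x * u.toFun x ij.1
  memLp_toFun := MemLp.of_eval_piLp fun i => hc.memLp_mul hχ.continuous (u.memLp_coord i)
  memLp_grad := MemLp.of_eval_piLp fun ij =>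
    (hc.memLp_mul hχ.continuous (u.memLp_grad_coord ij)).add
      ((hasCompactSupport_partialDeriv hc _).memLp_mul (continuous_partialDeriv hχ _)
        (u.memLp_coord ij.1))
  isWeakGradient := isWeakGradient_iff.2 fun i j =>
    (u.isWeakDeriv i j).mul_contDiff hχ (u.locallyIntegrable_coord hp i)
      (u.locallyIntegrable_grad_coord hp _)

lemma contDiff_mulVec (c : E m) (ξ : Mat m d) (x : E d) :
    ContDiff ℝ ∞ fun y => c + ξ.mulVec (y - x) := by
  refine contDiff_const.add ?_
  unfold Mat.mulVec
  rw [contDiff_piLp]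
  intro i
  simp only [PiLp.sub_apply]
  fun_prop

lemma partialDeriv_mulVec (c : E m) (ξ : Mat m d) (x y : E d) (i : Fin m) (j : Fin d) :
    partialDeriv j (fun y => (c + ξ.mulVec (y - x)) i) y = ξ (i, j) := by
  unfold partialDeriv Mat.mulVec
  simp only [PiLp.add_apply, PiLp.sub_apply]
  have h : HasFDerivAt (fun y : E d => c i + ∑ k, ξ (i, k) * (y k - x k))
      (∑ k, ξ (i, k) • (EuclideanSpace.proj k : E d →L[ℝ] ℝ)) y := by
    refine HasFDerivAt.const_add _ (HasFDerivAt.fun_sum fun k _ => ?_)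
    exact (((EuclideanSpace.proj k : E d →L[ℝ] ℝ).hasFDerivAt).sub_const (x k)).const_mul (ξ (i, k))
  rw [h.fderiv]
  simp

lemma memLp_of_continuous (hΩb : Bornology.IsBounded Ω) (hΩ : MeasurableSet Ω) {F : Type*}
    [NormedAddCommGroup F] [SecondCountableTopology F] {f : E d → F} (hf : Continuous f) (q : ℝ≥0∞) :
    MemLp f q (volume.restrict Ω) := by
  obtain ⟨C, hC⟩ := hΩb.isCompact_closure.exists_bound_of_continuousOn hf.continuousOn
  have : IsFiniteMeasure (volume.restrict Ω) := ⟨by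
    rw [Measure.restrict_apply_univ]; exact hΩb.measure_lt_top⟩
  exact MemLp.of_bound hf.aestronglyMeasurable C
    ((ae_restrict_mem hΩ).mono fun x hx => hC x (subset_closure hx))

/-- The affine function `y ↦ c + ξ (y - x)` on a bounded open set. -/
noncomputable def affine (hΩ : IsOpen Ω) (hΩb : Bornology.IsBounded Ω) (p : ℝ) (c : E m)
    (ξ : Mat m d) (x : E d) : Sobolev Ω p m where
  toFun y := c + ξ.mulVec (y - x)
  grad _ := ξ
  memLp_toFun := memLp_of_continuous hΩb hΩ.measurableSet (contDiff_mulVec c ξ x).continuous _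
  memLp_grad := memLp_of_continuous hΩb hΩ.measurableSet continuous_const _
  isWeakGradient := isWeakGradient_iff.2 fun i j => by
    have h : ContDiff ℝ ∞ fun y => (c + ξ.mulVec (y - x)) i :=
      (contDiff_piLp 2).1 (contDiff_mulVec c ξ x) i
    have := IsWeakDeriv.of_contDiff h Ω j
    simpa only [funext fun y => partialDeriv_mulVec c ξ x y i j] using this

/-- A function of class `C^∞` with compact support, as a Sobolev function. -/
noncomputable def ofContDiff {ψ : E d → E m} (hψ : ContDiff ℝ ∞ ψ) (hc : HasCompactSupport ψ)
    (Ω : Set (E d)) (p : ℝ) : Sobolev Ω p m where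
  toFun := ψ
  grad := jacobian ψ
  memLp_toFun := hψ.continuous.memLp_of_hasCompactSupport hc
  memLp_grad := MemLp.of_eval_piLp fun ij =>
    (continuous_partialDeriv ((contDiff_piLp 2).1 hψ ij.1) ij.2).memLp_of_hasCompactSupport
      (hasCompactSupport_partialDeriv (hc.comp_left (g := fun v : E m => v ij.1) rfl) _)
  isWeakGradient := isWeakGradient_iff.2 fun i j =>
    IsWeakDeriv.of_contDiff ((contDiff_piLp 2).1 hψ i) Ω j

lemma ae_eq_of_coord {n : Type*} [Fintype n] {μ : Measure (E d)} {f g : E d → EuclideanSpace ℝ n}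
    (h : ∀ i, ∀ᵐ x ∂μ, f x i = g x i) : ∀ᵐ x ∂μ, f x = g x := by
  filter_upwards [ae_all_iff.2 h] with x hx
  ext i
  exact hx i

lemma grad_ae_eq_zero (hp : 1 < p) (u : Sobolev Ω p m) {O : Set (E d)} (hO : IsOpen O)
    (hOΩ : O ⊆ Ω) (h : ∀ᵐ x ∂volume.restrict O, u.toFun x = 0) :
    ∀ᵐ x ∂volume.restrict O, u.grad x = 0 :=
  ae_eq_of_coord fun ij => (u.isWeakDeriv ij.1 ij.2).ae_eq_zero hO hOΩ
    (u.locallyIntegrable_grad_coord hp _) (h.mono fun x hx => by rw [hx]; rfl)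

lemma grad_ae_eq (hp : 1 < p) (u v : Sobolev Ω p m) {O : Set (E d)} (hO : IsOpen O)
    (hOΩ : O ⊆ Ω) (h : ∀ᵐ x ∂volume.restrict O, u.toFun x = v.toFun x) :
    ∀ᵐ x ∂volume.restrict O, u.grad x = v.grad x := by
  have := (u.sub hp v).grad_ae_eq_zero hp hO hOΩ (h.mono fun x hx => sub_eq_zero.2 hx)
  exact this.mono fun x hx => sub_eq_zero.1 hx

/-- Extension by zero of a Sobolev function with compact support. -/
noncomputable def extend (hp : 1 < p) (hΩ : IsOpen Ω) (u : Sobolev Ω p m) {K : Set (E d)}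
    (hK : IsCompact K) (hKΩ : K ⊆ Ω) (h0 : ∀ᵐ x ∂volume.restrict (Ω \ K), u.toFun x = 0) :
    Sobolev (univ : Set (E d)) p m where
  toFun := Ω.indicator u.toFun
  grad := Ω.indicator u.grad
  memLp_toFun := by
    rw [Measure.restrict_univ, memLp_indicator_iff_restrict hΩ.measurableSet]
    exact u.memLp_toFun
  memLp_grad := by
    rw [Measure.restrict_univ, memLp_indicator_iff_restrict hΩ.measurableSet]
    exact u.memLp_grad
  isWeakGradient := isWeakGradient_iff.2 fun i j => by
    have h := (u.isWeakDeriv i j).indicator hΩ (u.locallyIntegrable_grad_coord hp _) hK hKΩ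
      (h0.mono fun x hx => by rw [hx]; rfl)
    convert h using 1 <;> ext x <;> by_cases hx : x ∈ Ω <;> simp [hx]

lemma quasiMeasurePreserving_affine {c : ℝ} (hc : c ≠ 0) (b : E d) :
    Measure.map (fun x : E d => c • x + b) volume = ENNReal.ofReal |(c ^ d)⁻¹| • volume := by
  have : (fun x : E d => c • x + b) = (fun x => x + b) ∘ fun x => c • x := rfl
  rw [this, ← Measure.map_map (by fun_prop) (by fun_prop), Measure.map_addHaar_smul _ hc]
  rw [Measure.map_smul, map_add_right_eq_self]
  simp

lemma lintegral_comp_affine {c : ℝ} (hc : c ≠ 0) (b : E d) (f : E d → ℝ≥0∞) :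
    ∫⁻ x, f (c • x + b) = ENNReal.ofReal |(c ^ d)⁻¹| * ∫⁻ x, f x := by
  let e : E d ≃ₜ E d := (Homeomorph.smulOfNeZero c hc).trans (Homeomorph.addRight b)
  have h : ∫⁻ x, f (e x) = ∫⁻ x, f x ∂(Measure.map e volume) :=
    (e.toMeasurableEquiv.measurableEmbedding.lintegral_map f).symm
  have h2 : Measure.map e volume = ENNReal.ofReal |(c ^ d)⁻¹| • (volume : Measure (E d)) :=
    quasiMeasurePreserving_affine hc b
  rw [h2, lintegral_smul_measure] at h
  exact h

lemma memLp_comp_affine {F : Type*} [NormedAddCommGroup F] {c : ℝ} (hc : c ≠ 0) (b : E d)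
    {f : E d → F} {q : ℝ≥0∞} (hf : MemLp f q volume) : MemLp (fun x => f (c • x + b)) q volume := by
  have h := quasiMeasurePreserving_affine hc b
  have h1 : MemLp f q (Measure.map (fun x : E d => c • x + b) volume) := by
    rw [h]; exact hf.smul_measure ENNReal.ofReal_ne_top
  exact h1.comp_of_map (by fun_prop)

/-- The rescaled function `x ↦ c⁻¹ u(c x + b)`, whose gradient is `x ↦ ∇u(c x + b)`. -/
noncomputable def rescale (u : Sobolev (univ : Set (E d)) p m) {c : ℝ} (hc : c ≠ 0) (b : E d) :
    Sobolev (univ : Set (E d)) p m where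
  toFun x := c⁻¹ • u.toFun (c • x + b)
  grad x := u.grad (c • x + b)
  memLp_toFun := by
    have := u.memLp_toFun
    rw [Measure.restrict_univ] at this ⊢
    exact (memLp_comp_affine hc b this).const_smul c⁻¹
  memLp_grad := by
    have := u.memLp_grad
    rw [Measure.restrict_univ] at this ⊢
    exact memLp_comp_affine hc b this
  isWeakGradient := isWeakGradient_iff.2 fun i j => (u.isWeakDeriv i j).comp_affine hc b

end Sobolev

end Homogenization

/-! ### Growth bound, gluing of competitors, cutoffs between cubes -/

namespace Homogenization

variable {d m : ℕ} {Ω : Set (E d)} {p : ℝ} {L : E d → Mat m d → ℝ≥0} {ε : ℝ}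

/-- The growth condition in integrated form. -/
def GrowthBound (Ω : Set (E d)) (p : ℝ) (L : E d → Mat m d → ℝ≥0) (β : ℝ≥0)
    (ν : Measure (E d)) : Prop :=
  ∀ (V : Set (E d)) (u : Sobolev Ω p m) (ε : ℝ), IsOpen V → V ⊆ Ω → 0 < ε → ε ≤ 1 →
    dirichletInf Ω p L ε u.toFun V ≤
      β * (ν V + (∫⁻ x in V, ‖u.toFun x‖ₑ ^ p) + ∫⁻ x in V, ‖u.grad x‖ₑ ^ p)

lemma dirichletInf_le {u : E d → E m} {O : Set (E d)} (v : Sobolev Ω p m)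
    (h : ∀ᵐ x ∂(volume.restrict (Ω \ O)), v.toFun x = u x) :
    dirichletInf Ω p L ε u O ≤ energy L ε O v := iInf₂_le v h

lemma dirichletInf_congr {u u' : E d → E m} {O : Set (E d)}
    (h : ∀ᵐ x ∂(volume.restrict (Ω \ O)), u x = u' x) :
    dirichletInf Ω p L ε u O = dirichletInf Ω p L ε u' O := by
  unfold dirichletInf
  refine iInf_congr fun v => iInf_congr_Prop ?_ fun _ => rfl
  constructor <;> intro h' <;> filter_upwards [h, h'] with x h1 h2
  · rw [h2, h1]
  · rw [h2, h1]

lemma energy_congr {O : Set (E d)} {u v : Sobolev Ω p m}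
    (h : ∀ᵐ x ∂(volume.restrict O), u.grad x = v.grad x) : energy L ε O u = energy L ε O v :=
  lintegral_congr_ae (h.mono fun x hx => by simp only [hx])

lemma energy_mono {O O' : Set (E d)} (h : O ⊆ O') (u : Sobolev Ω p m) :
    energy L ε O u ≤ energy L ε O' u := lintegral_mono_set h

lemma GrowthG1.exists_growthBound (hΩb : Bornology.IsBounded Ω) (h : GrowthG1 Ω p L) :
    ∃ (β : ℝ≥0) (ν : Measure (E d)), IsFiniteMeasure ν ∧ ν ≪ volume ∧ GrowthBound Ω p L β ν := by
  obtain ⟨β, ν, -, hν, hac, h⟩ := h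
  refine ⟨β, ν, hν, hac, fun V u ε hV hVΩ h0 h1 => ?_⟩
  -- The quotient in (G₁) carries no information for empty `V`, but then the energy is zero.
  -- Otherwise the volume is positive and finite, and multiplying by it is legitimate.
  rcases V.eq_empty_or_nonempty with rfl | hne
  · refine (dirichletInf_le u (ae_of_all _ fun _ => rfl)).trans ?_
    simp [energy]
  · have hv0 : volume V ≠ 0 := (hV.measure_pos volume hne).ne'
    have hvt : volume V ≠ ⊤ := (hΩb.subset hVΩ).measure_lt_top.ne
    have h2 := h V u ε hV hVΩ h0 h1
    rw [setLAverage_eq, setLAverage_eq, ENNReal.div_add_div_same, ENNReal.div_add_div_same,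
      ← mul_div_assoc] at h2
    rwa [ENNReal.div_le_iff hv0 hvt, ENNReal.div_mul_cancel hv0 hvt] at h2

/-- Gluing of two competitors on disjoint open sets. -/
lemma dirichletInf_le_add (hp : 1 < p) (w : Sobolev Ω p m) {O O' C : Set (E d)}
    (hO : IsOpen O) (hO' : IsOpen O') (hC : IsClosed C) (hO'C : O' ⊆ C) (hCO : C ⊆ O)
    (hnull : volume (C \ O') = 0) (hOΩ : O ⊆ Ω) :
    dirichletInf Ω p L ε w.toFun O ≤
      dirichletInf Ω p L ε w.toFun O' + dirichletInf Ω p L ε w.toFun (O \ C) := by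
  have key : ∀ t₁ t₂ : Sobolev Ω p m,
      (∀ᵐ x ∂(volume.restrict (Ω \ O')), t₁.toFun x = w.toFun x) →
      (∀ᵐ x ∂(volume.restrict (Ω \ (O \ C))), t₂.toFun x = w.toFun x) →
      dirichletInf Ω p L ε w.toFun O ≤ energy L ε O' t₁ + energy L ε (O \ C) t₂ := by
    intro t₁ t₂ h₁ h₂
    have g₁ : ∀ᵐ x ∂(volume.restrict (O \ C)), t₁.grad x = w.grad x :=
      t₁.grad_ae_eq hp w (hO.sdiff hC) (sdiff_subset.trans hOΩ)
        (ae_restrict_of_ae_restrict_of_subset (s := O \ C) (t := Ω \ O')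
          (fun x hx => ⟨hOΩ hx.1, fun h => hx.2 (hO'C h)⟩) h₁)
    have g₂ : ∀ᵐ x ∂(volume.restrict O'), t₂.grad x = w.grad x :=
      t₂.grad_ae_eq hp w hO' ((hO'C.trans hCO).trans hOΩ)
        (ae_restrict_of_ae_restrict_of_subset (s := O') (t := Ω \ (O \ C))
          (fun x hx => ⟨hOΩ (hCO (hO'C hx)), fun h => h.2 (hO'C hx)⟩) h₂)
    -- On `O'` one has `t₂ = w`, on `O \ C` one has `t₁ = w`. Hence `t₁ + t₂ - w` is `t₁` on the
    -- first set and `t₂` on the second, and it is a Sobolev function without any discussion of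
    -- traces.
    refine (dirichletInf_le ((t₁.add hp t₂).sub hp w) ?_).trans ?_
    · filter_upwards [ae_restrict_of_ae_restrict_of_subset (s := Ω \ O) (t := Ω \ O')
          (fun x hx => ⟨hx.1, fun h => hx.2 (hCO (hO'C h))⟩) h₁,
        ae_restrict_of_ae_restrict_of_subset (s := Ω \ O) (t := Ω \ (O \ C))
          (fun x hx => ⟨hx.1, fun h => hx.2 h.1⟩) h₂] with x e₁ e₂
      simp [Sobolev.add, Sobolev.sub, e₁, e₂]
    · have hsub : O ⊆ O' ∪ (O \ C) ∪ (C \ O') := by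
        intro x hx
        by_cases h1 : x ∈ C <;> by_cases h2 : x ∈ O' <;> simp [h1, h2, hx]
      refine (energy_mono hsub _).trans ?_
      refine (lintegral_union_le _ _ _).trans ?_
      rw [setLIntegral_measure_zero _ _ hnull, add_zero]
      refine (lintegral_union_le _ _ _).trans (add_le_add (le_of_eq ?_) (le_of_eq ?_))
      · exact energy_congr (g₂.mono fun x hx => by simp [Sobolev.add, Sobolev.sub, hx])
      · exact energy_congr (g₁.mono fun x hx => by simp [Sobolev.add, Sobolev.sub, hx])
  unfold dirichletInf at key ⊢
  simp only [ENNReal.iInf_add, ENNReal.add_iInf]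
  exact le_iInf fun t₂ => le_iInf fun h₂ => le_iInf fun t₁ => le_iInf fun h₁ => key t₁ t₂ h₁ h₂

/-- The derivative is continuous, hence bounded on `[0,1]`, and it vanishes outside this interval.
-/
lemma exists_norm_deriv_smoothTransition_le : ∃ K : ℝ, 0 ≤ K ∧
    ∀ s t, |Real.smoothTransition s - Real.smoothTransition t| ≤ K * |s - t| := by
  have hc : ContDiff ℝ 1 Real.smoothTransition := Real.smoothTransition.contDiff
  obtain ⟨K, hK⟩ := (isCompact_Icc (a := (0 : ℝ)) (b := 1)).exists_bound_of_continuousOn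
    (hc.continuous_deriv le_rfl).continuousOn
  refine ⟨K, (norm_nonneg _).trans (hK 0 (by simp)), fun s t => ?_⟩
  refine Convex.norm_image_sub_le_of_norm_deriv_le (𝕜 := ℝ) (s := univ) (f := Real.smoothTransition)
    (fun x _ => hc.differentiable (by simp) x) (fun x _ => ?_) convex_univ (mem_univ _) (mem_univ _)
  by_cases hx : x ∈ Icc (0 : ℝ) 1
  · exact hK x hx
  · have h0 : deriv Real.smoothTransition x = 0 := by
      rw [mem_Icc, not_and_or, not_le, not_le] at hx
      rcases hx with hx | hx
      · have : Real.smoothTransition =ᶠ[𝓝 x] fun _ => 0 := by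
          filter_upwards [gt_mem_nhds hx] with y hy
          exact Real.smoothTransition.zero_of_nonpos hy.le
        rw [this.deriv_eq, deriv_const]
      · have : Real.smoothTransition =ᶠ[𝓝 x] fun _ => 1 := by
          filter_upwards [lt_mem_nhds hx] with y hy
          exact Real.smoothTransition.one_of_one_le hy.le
        rw [this.deriv_eq, deriv_const]
    rw [h0, norm_zero]
    exact (norm_nonneg _).trans (hK 0 (by simp))

/-- Smooth cutoff functions between concentric cubes. -/
lemma exists_cube_cutoff (d : ℕ) : ∃ K : ℝ, 0 ≤ K ∧ ∀ (x : E d) (a b : ℝ), a < b →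
    ∃ χ : E d → ℝ, ContDiff ℝ ∞ χ ∧ HasCompactSupport χ ∧ (∀ y, 0 ≤ χ y ∧ χ y ≤ 1) ∧
      (∀ y ∈ closedCube x a, χ y = 1) ∧ (∀ y, y ∉ cube x b → χ y = 0) ∧
      ∀ j y, |partialDeriv j χ y| ≤ K / (b - a) := by
  obtain ⟨K, hK0, hK⟩ := exists_norm_deriv_smoothTransition_le
  refine ⟨4 * K, by positivity, fun x a b hab => ?_⟩
  have hba : 0 < b - a := sub_pos.2 hab
  let σ := Real.smoothTransition
  -- One-dimensional profiles: 1 where `|t - x i| ≤ a / 2` and 0 where `|t - x i| ≥ b / 2`. Each of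
  -- the two factors is Lipschitz with constant `2 * K / (b - a)` and lies in `[0,1]`, whence the
  -- constant `4 * K`.
  let θ : Fin d → ℝ → ℝ := fun i t =>
    σ ((b - 2 * (t - x i)) / (b - a)) * σ ((b + 2 * (t - x i)) / (b - a))
  have hσ : ∀ t, 0 ≤ σ t ∧ σ t ≤ 1 := fun t =>
    ⟨Real.smoothTransition.nonneg t, Real.smoothTransition.le_one t⟩
  have hθ : ∀ i t, 0 ≤ θ i t ∧ θ i t ≤ 1 := fun i t =>
    ⟨mul_nonneg (hσ _).1 (hσ _).1, mul_le_one₀ (hσ _).2 (hσ _).1 (hσ _).2⟩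
  have hθl : ∀ i s t, |θ i s - θ i t| ≤ 4 * K / (b - a) * |s - t| := by
    intro i s t
    have h1 := hK ((b - 2 * (s - x i)) / (b - a)) ((b - 2 * (t - x i)) / (b - a))
    have h2 := hK ((b + 2 * (s - x i)) / (b - a)) ((b + 2 * (t - x i)) / (b - a))
    have e1 : (b - 2 * (s - x i)) / (b - a) - (b - 2 * (t - x i)) / (b - a) =
        -(2 / (b - a) * (s - t)) := by ring
    have e2 : (b + 2 * (s - x i)) / (b - a) - (b + 2 * (t - x i)) / (b - a) =
        2 / (b - a) * (s - t) := by ring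
    have e3 : |2 / (b - a) * (s - t)| = 2 / (b - a) * |s - t| := by
      rw [abs_mul, abs_of_pos (by positivity)]
    rw [e1, abs_neg, e3] at h1
    rw [e2, e3] at h2
    have e4 : θ i s - θ i t =
      (σ ((b - 2 * (s - x i)) / (b - a)) - σ ((b - 2 * (t - x i)) / (b - a))) *
        σ ((b + 2 * (s - x i)) / (b - a)) + σ ((b - 2 * (t - x i)) / (b - a)) *
        (σ ((b + 2 * (s - x i)) / (b - a)) - σ ((b + 2 * (t - x i)) / (b - a))) := by
      simp only [θ]; ring
    rw [e4]
    refine (abs_add_le _ _).trans ?_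
    rw [abs_mul, abs_mul, abs_of_nonneg (hσ _).1, abs_of_nonneg (hσ _).1]
    have h3 := mul_le_mul h1 (hσ ((b + 2 * (s - x i)) / (b - a))).2 (hσ _).1 (by positivity)
    have h4 := mul_le_mul (hσ ((b - 2 * (t - x i)) / (b - a))).2 h2 (abs_nonneg _) zero_le_one
    refine (add_le_add h3 h4).trans (le_of_eq ?_)
    ring
  have hθc : ∀ i, ContDiff ℝ ∞ fun y : E d => θ i (y i) := fun i => by
    have h1 : ContDiff ℝ ∞ σ := Real.smoothTransition.contDiff
    exact (h1.comp (by fun_prop)).mul (h1.comp (by fun_prop))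
  have hz : ∀ y, y ∉ cube x b → ∏ i, θ i (y i) = 0 := by
    intro y hy
    simp only [cube, mem_ofPred_eq, not_forall, not_lt] at hy
    obtain ⟨i, hi⟩ := hy
    refine Finset.prod_eq_zero (Finset.mem_univ i) ?_
    rcases le_abs.1 hi with h | h
    · have : (b - 2 * (y i - x i)) / (b - a) ≤ 0 := div_nonpos_of_nonpos_of_nonneg (by linarith) hba.le
      simp [θ, σ, Real.smoothTransition.zero_of_nonpos this]
    · have : (b + 2 * (y i - x i)) / (b - a) ≤ 0 := div_nonpos_of_nonpos_of_nonneg (by linarith) hba.le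
      simp [θ, σ, Real.smoothTransition.zero_of_nonpos this]
  have hcd : ContDiff ℝ ∞ fun y : E d => ∏ i, θ i (y i) := contDiff_prod fun i _ => hθc i
  refine ⟨fun y => ∏ i, θ i (y i), hcd, ?_, fun y => ⟨Finset.prod_nonneg fun i _ => (hθ i _).1,
    Finset.prod_le_one (fun i _ => (hθ i _).1) fun i _ => (hθ i _).2⟩, ?_, hz, ?_⟩
  · exact HasCompactSupport.intro (isCompact_closedCube x b) fun y hy =>
      hz y fun h => hy (cube_subset_closedCube x b h)
  · intro y hy
    refine Finset.prod_eq_one fun i _ => ?_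
    obtain ⟨h1, h2⟩ := abs_le.1 (hy i)
    have e1 : 1 ≤ (b - 2 * (y i - x i)) / (b - a) := by rw [le_div_iff₀ hba]; linarith
    have e2 : 1 ≤ (b + 2 * (y i - x i)) / (b - a) := by rw [le_div_iff₀ hba]; linarith
    simp [θ, σ, Real.smoothTransition.one_of_one_le e1, Real.smoothTransition.one_of_one_le e2]
  · intro j y
    have hd : HasLineDerivAt ℝ (fun y : E d => ∏ i, θ i (y i))
        (partialDeriv j (fun y : E d => ∏ i, θ i (y i)) y) y (EuclideanSpace.single j 1) :=
      (hcd.differentiable (by simp) y).hasFDerivAt.hasLineDerivAt _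
    -- Along `e_j` only the `j`-th factor of the product varies, and the others are at most 1, so
    -- its Lipschitz constant bounds the partial derivative.
    refine HasDerivAt.le_of_lip' (x₀ := (0 : ℝ)) hd (by positivity) (Eventually.of_forall fun t => ?_)
    have e : ∀ t : ℝ, ∏ i, θ i ((y + t • EuclideanSpace.single j (1 : ℝ)) i) =
        θ j (y j + t) * ∏ i ∈ Finset.univ.erase j, θ i (y i) := by
      intro t
      rw [← Finset.mul_prod_erase Finset.univ _ (Finset.mem_univ j)]
      congr 1
      · simp
      · refine Finset.prod_congr rfl fun i hi => ?_
        simp [Finset.ne_of_mem_erase hi]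
    simp only
    rw [e, e, ← sub_mul, Real.norm_eq_abs, abs_mul]
    have h1 := hθl j (y j + t) (y j + 0)
    have h2 : |∏ i ∈ Finset.univ.erase j, θ i (y i)| ≤ 1 := by
      rw [abs_of_nonneg (Finset.prod_nonneg fun i _ => (hθ i _).1)]
      exact Finset.prod_le_one (fun i _ => (hθ i _).1) fun i _ => (hθ i _).2
    have h3 := mul_le_mul h1 h2 (abs_nonneg _) (by positivity)
    refine h3.trans (le_of_eq ?_)
    simp [Real.norm_eq_abs]

end Homogenization

/-! ### Transition between two Sobolev functions -/

namespace Homogenization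

variable {d m : ℕ} {Ω : Set (E d)} {p : ℝ} {L : E d → Mat m d → ℝ≥0} {ε : ℝ}

lemma ennreal_add_rpow_le (hp : 0 ≤ p) (a b : ℝ≥0∞) : (a + b) ^ p ≤ 2 ^ p * (a ^ p + b ^ p) := by
  have h1 : a + b ≤ 2 * max a b := by
    rw [two_mul]; exact add_le_add (le_max_left _ _) (le_max_right _ _)
  refine (ENNReal.rpow_le_rpow h1 hp).trans ?_
  rw [ENNReal.mul_rpow_of_nonneg _ _ hp]
  gcongr
  rcases max_choice a b with h | h <;> rw [h]
  · exact le_self_add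
  · exact le_add_self

lemma ennreal_add_add_rpow_le (hp : 0 ≤ p) (a b c : ℝ≥0∞) :
    (a + b + c) ^ p ≤ 3 ^ p * (a ^ p + b ^ p + c ^ p) := by
  have h1 : a + b + c ≤ 3 * max (max a b) c := by
    have : (3 : ℝ≥0∞) * max (max a b) c = max (max a b) c + max (max a b) c + max (max a b) c := by
      ring
    rw [this]
    gcongr
    · exact (le_max_left _ _).trans (le_max_left _ _)
    · exact (le_max_right _ _).trans (le_max_left _ _)
    · exact le_max_right _ _
  refine (ENNReal.rpow_le_rpow h1 hp).trans ?_
  rw [ENNReal.mul_rpow_of_nonneg _ _ hp]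
  gcongr
  rcases max_choice (max a b) c with h | h <;> rw [h]
  · rcases max_choice a b with h | h <;> rw [h]
    · rw [add_assoc]; exact le_self_add
    · rw [add_right_comm]; exact le_add_self
  · exact le_add_self

/-- This controls the term `∇χ ⊗ (v - w)` in the gradient of a function modified by a cutoff. -/
lemma norm_outer_le {a : Fin d → ℝ} {M : ℝ} (hM : 0 ≤ M) (ha : ∀ j, |a j| ≤ M) (y : E m) :
    ‖(WithLp.toLp 2 fun ij : Fin m × Fin d => a ij.2 * y ij.1 : Mat m d)‖ ≤ √d * M * ‖y‖ := by
  refine le_of_sq_le_sq ?_ (by positivity)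
  rw [EuclideanSpace.norm_sq_eq, Fintype.sum_prod_type, mul_pow, mul_pow, Real.sq_sqrt (by positivity),
    EuclideanSpace.norm_sq_eq, Finset.mul_sum]
  refine Finset.sum_le_sum fun i _ => ?_
  have : ∑ j, ‖a j * y i‖ ^ 2 ≤ ∑ _j : Fin d, M ^ 2 * ‖y i‖ ^ 2 := by
    refine Finset.sum_le_sum fun j _ => ?_
    rw [norm_mul, mul_pow]
    gcongr
    exact ha j
  refine this.trans (le_of_eq ?_)
  simp [mul_assoc]

lemma aemeasurable_enorm_rpow {F : Type*} [NormedAddCommGroup F] {f : E d → F} {q : ℝ≥0∞}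
    (hf : MemLp f q (volume.restrict Ω)) {V : Set (E d)} (hV : V ⊆ Ω) :
    AEMeasurable (fun x => ‖f x‖ₑ ^ p) (volume.restrict V) :=
  ((hf.1.mono_measure (Measure.restrict_mono hV le_rfl)).enorm).pow_const p

lemma lintegral_rpow_lt_top {F : Type*} [NormedAddCommGroup F] (hp : 1 < p) {μ : Measure (E d)}
    {f : E d → F} (hf : MemLp f (ENNReal.ofReal p) μ) : ∫⁻ x, ‖f x‖ₑ ^ p ∂μ < ⊤ := by
  have h := lintegral_rpow_enorm_lt_top_of_eLpNorm_lt_top (by simp; linarith)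
    ENNReal.ofReal_ne_top hf.2
  rwa [ENNReal.toReal_ofReal (by linarith)] at h

/-- The transition estimate between two Sobolev functions on concentric cubes. -/
lemma GrowthBound.exists_transition (hp : 1 < p) (hΩo : IsOpen Ω) {β : ℝ≥0} {ν : Measure (E d)}
    (hG : GrowthBound Ω p L β ν) : ∃ C : ℝ≥0∞, C ≠ ⊤ ∧ ∀ (ε : ℝ) (x : E d) (a b ρ : ℝ)
    (v w : Sobolev Ω p m), 0 < ε → ε ≤ 1 → 0 < a → a < b → b ≤ ρ → cube x ρ ⊆ Ω →
    dirichletInf Ω p L ε w.toFun (cube x ρ) ≤ energy L ε (cube x a) v +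
      C * (ν (cube x ρ \ closedCube x a) +
        (∫⁻ y in cube x ρ \ closedCube x a, ‖w.toFun y‖ₑ ^ p) +
        (∫⁻ y in cube x ρ \ closedCube x a, ‖w.grad y‖ₑ ^ p) +
        (1 + ENNReal.ofReal (1 / (b - a)) ^ p) *
          (∫⁻ y in cube x ρ \ closedCube x a, ‖v.toFun y - w.toFun y‖ₑ ^ p) +
        ∫⁻ y in cube x b \ closedCube x a, ‖v.grad y‖ₑ ^ p) := by
  obtain ⟨K, hK0, hK⟩ := exists_cube_cutoff d
  have hp0 : 0 ≤ p := by linarith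
  set M := ENNReal.ofReal (√d * K)
  -- The factor `3 ^ p` comes from splitting `∇z` into three terms, and `M ^ p` from the derivative
  -- of the cutoff. `S` dominates every coefficient that occurs below.
  set S : ℝ≥0∞ := 3 ^ p * (1 + M ^ p) with hS
  have hSt : S ≠ ⊤ := ENNReal.mul_ne_top (ENNReal.rpow_ne_top_of_nonneg hp0 (by simp))
    (ENNReal.add_ne_top.2 ⟨by simp, ENNReal.rpow_ne_top_of_nonneg hp0 ENNReal.ofReal_ne_top⟩)
  refine ⟨β * S, ENNReal.mul_ne_top ENNReal.coe_ne_top hSt, ?_⟩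
  intro ε x a b ρ v w hε0 hε1 ha hab hbρ hΩ
  obtain ⟨χ, hχ, hχc, hχ01, hχ1, hχ0, hχd⟩ := hK x a b hab
  have hab' : 0 < b - a := sub_pos.2 hab
  set V := cube x ρ \ closedCube x a with hVdef
  have hVo : IsOpen V := (isOpen_cube x ρ).sdiff (isClosed_closedCube x a)
  have hVΩ : V ⊆ Ω := sdiff_subset.trans hΩ
  -- The function `w + χ (v - w)` is `v` on the inner cube of side `a` and `w` outside the cube of
  -- side `b`.
  set z : Sobolev Ω p m := w.add hp ((v.sub hp w).mul hp hχ hχc) with hz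
  have hzf : ∀ y, z.toFun y = w.toFun y + χ y • (v.toFun y - w.toFun y) := fun y => rfl
  have hcc : closedCube x a ⊆ cube x ρ := closedCube_subset_cube x (hab.trans_le hbρ)
  have h1 : dirichletInf Ω p L ε w.toFun (cube x ρ) = dirichletInf Ω p L ε z.toFun (cube x ρ) := by
    refine (dirichletInf_congr (ae_restrict_of_forall_mem
      (hΩo.measurableSet.diff (measurableSet_cube x ρ)) fun y hy => ?_)).symm
    rw [hzf, hχ0 y fun h => hy.2 (cube_mono x hbρ h), zero_smul, add_zero]
  have h2 := dirichletInf_le_add (L := L) (ε := ε) hp z (isOpen_cube x ρ) (isOpen_cube x a)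
    (isClosed_closedCube x a) (cube_subset_closedCube x a) hcc (volume_closedCube_diff_cube x ha) hΩ
  have h3 : dirichletInf Ω p L ε z.toFun (cube x a) ≤ energy L ε (cube x a) v := by
    refine (dirichletInf_le z (ae_of_all _ fun _ => rfl)).trans (le_of_eq (energy_congr ?_))
    refine z.grad_ae_eq hp v (isOpen_cube x a) ((cube_subset_closedCube x a).trans (hcc.trans hΩ)) ?_
    refine ae_restrict_of_forall_mem (measurableSet_cube x a) fun y hy => ?_
    rw [hzf, hχ1 y (cube_subset_closedCube x a hy), one_smul, add_sub_cancel]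
  -- On `V` the energy of `z` itself may be infinite. Gluing allows it to be replaced there by the
  -- Dirichlet infimum of `z`, to which the growth bound applies.
  have h4 := hG V z ε hVo hVΩ hε0 hε1
  have mw := aemeasurable_enorm_rpow (p := p) w.memLp_toFun hVΩ
  have mgw := aemeasurable_enorm_rpow (p := p) w.memLp_grad hVΩ
  have mvw : AEMeasurable (fun y => ‖v.toFun y - w.toFun y‖ₑ ^ p) (volume.restrict V) :=
    aemeasurable_enorm_rpow (p := p) (v.sub hp w).memLp_toFun hVΩ
  have h5 : ∫⁻ y in V, ‖z.toFun y‖ₑ ^ p ≤ 2 ^ p * ((∫⁻ y in V, ‖w.toFun y‖ₑ ^ p) +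
      ∫⁻ y in V, ‖v.toFun y - w.toFun y‖ₑ ^ p) := by
    rw [← lintegral_add_left' mw, ← lintegral_const_mul' _ _
      (ENNReal.rpow_ne_top_of_nonneg hp0 (by simp))]
    refine lintegral_mono fun y => ?_
    refine le_trans ?_ (ennreal_add_rpow_le hp0 _ _)
    refine ENNReal.rpow_le_rpow ?_ hp0
    rw [hzf]
    refine (enorm_add_le _ _).trans (add_le_add le_rfl ?_)
    rw [enorm_smul]
    refine mul_le_of_le_one_left zero_le ?_
    rw [Real.enorm_eq_ofReal (hχ01 y).1]
    exact ENNReal.ofReal_le_one.2 (hχ01 y).2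
  -- The gradient of `v` is kept only on the cube of side `b`, outside which `χ` vanishes. This
  -- localization to the layer is what later makes averaging over layers profitable.
  have hMd : ∀ y, ‖z.grad y‖ₑ ≤ ‖w.grad y‖ₑ + (cube x b).indicator (fun y => ‖v.grad y‖ₑ) y +
      M * ENNReal.ofReal (1 / (b - a)) * ‖v.toFun y - w.toFun y‖ₑ := by
    intro y
    have e : z.grad y = (1 - χ y) • w.grad y + χ y • v.grad y +
        WithLp.toLp 2 fun ij : Fin m × Fin d =>
          partialDeriv ij.2 χ y * (v.toFun y - w.toFun y) ij.1 := by
      ext ij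
      simp only [hz, Sobolev.add, Sobolev.mul, Sobolev.sub, PiLp.add_apply, PiLp.smul_apply,
        PiLp.sub_apply, smul_eq_mul]
      ring
    rw [e]
    refine (enorm_add_le _ _).trans (add_le_add ((enorm_add_le _ _).trans (add_le_add ?_ ?_)) ?_)
    · rw [enorm_smul]
      refine mul_le_of_le_one_left zero_le ?_
      rw [Real.enorm_eq_ofReal (by linarith [(hχ01 y).2])]
      exact ENNReal.ofReal_le_one.2 (by linarith [(hχ01 y).1])
    · by_cases hy : y ∈ cube x b
      · rw [indicator_of_mem hy, enorm_smul]
        refine mul_le_of_le_one_left zero_le ?_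
        rw [Real.enorm_eq_ofReal (hχ01 y).1]
        exact ENNReal.ofReal_le_one.2 (hχ01 y).2
      · simp [hχ0 y hy]
    · have := norm_outer_le (by positivity) (fun j => hχd j y) (v.toFun y - w.toFun y)
      rw [← ofReal_norm, ← ofReal_norm, ← ENNReal.ofReal_mul (by positivity),
        ← ENNReal.ofReal_mul (by positivity)]
      refine ENNReal.ofReal_le_ofReal (this.trans (le_of_eq ?_))
      ring
  set T := ENNReal.ofReal (1 / (b - a)) ^ p
  have hMt : (M * ENNReal.ofReal (1 / (b - a))) ^ p = M ^ p * T :=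
    ENNReal.mul_rpow_of_nonneg _ _ hp0
  have h6 : ∫⁻ y in V, ‖z.grad y‖ₑ ^ p ≤ 3 ^ p * ((∫⁻ y in V, ‖w.grad y‖ₑ ^ p) +
      (∫⁻ y in cube x b \ closedCube x a, ‖v.grad y‖ₑ ^ p) +
      M ^ p * T * ∫⁻ y in V, ‖v.toFun y - w.toFun y‖ₑ ^ p) := by
    have hMTt : M ^ p * T ≠ ⊤ := by
      rw [← hMt]
      exact ENNReal.rpow_ne_top_of_nonneg hp0
        (ENNReal.mul_ne_top ENNReal.ofReal_ne_top ENNReal.ofReal_ne_top)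
    have e1 : ∫⁻ y in V, (cube x b).indicator (fun y => ‖v.grad y‖ₑ ^ p) y ≤
        ∫⁻ y in cube x b \ closedCube x a, ‖v.grad y‖ₑ ^ p := by
      rw [setLIntegral_indicator (measurableSet_cube x b)]
      exact lintegral_mono_set fun y hy => ⟨hy.1, hy.2.2⟩
    refine le_trans ?_ (mul_le_mul_right (add_le_add (add_le_add le_rfl e1) le_rfl) _)
    rw [← lintegral_const_mul' _ _ hMTt, ← lintegral_add_left' mgw,
      ← lintegral_add_right' _ (mvw.const_mul _),
      ← lintegral_const_mul' _ _ (ENNReal.rpow_ne_top_of_nonneg hp0 (by simp))]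
    refine lintegral_mono fun y => ?_
    refine (ENNReal.rpow_le_rpow (hMd y) hp0).trans ((ennreal_add_add_rpow_le hp0 _ _ _).trans ?_)
    rw [ENNReal.mul_rpow_of_nonneg _ _ hp0, hMt]
    gcongr
    by_cases hy : y ∈ cube x b
    · simp [hy]
    · simp [hy, ENNReal.zero_rpow_of_pos (by linarith : 0 < p)]
  rw [h1]
  refine h2.trans (add_le_add h3 (h4.trans ?_))
  rw [mul_assoc]
  refine mul_le_mul_right ?_ _
  have hS3 : (3 : ℝ≥0∞) ^ p ≤ S := le_mul_of_one_le_right zero_le le_self_add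
  have hS2 : (2 : ℝ≥0∞) ^ p ≤ S :=
    (ENNReal.rpow_le_rpow (by norm_num) hp0).trans hS3
  have hS1 : 1 ≤ S := (ENNReal.one_le_rpow (by norm_num) (by linarith)).trans hS3
  have hSM : (3 : ℝ≥0∞) ^ p * M ^ p ≤ S := mul_le_mul_right le_add_self _
  generalize ∫⁻ y in V, ‖w.toFun y‖ₑ ^ p = W at *
  generalize ∫⁻ y in V, ‖w.grad y‖ₑ ^ p = W' at *
  generalize ∫⁻ y in V, ‖v.toFun y - w.toFun y‖ₑ ^ p = D at *
  generalize ∫⁻ y in cube x b \ closedCube x a, ‖v.grad y‖ₑ ^ p = G at *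
  calc ν V + (∫⁻ y in V, ‖z.toFun y‖ₑ ^ p) + ∫⁻ y in V, ‖z.grad y‖ₑ ^ p
      ≤ 1 * ν V + (2 ^ p * (W + D)) + 3 ^ p * (W' + G + M ^ p * T * D) := by
        rw [one_mul]; exact add_le_add (add_le_add le_rfl h5) h6
    _ = 1 * ν V + 2 ^ p * W + 3 ^ p * W' + (2 ^ p * D + (3 ^ p * M ^ p) * (T * D)) + 3 ^ p * G := by
        ring
    _ ≤ S * ν V + S * W + S * W' + (S * D + S * (T * D)) + S * G := by gcongr
    _ = _ := by ring

end Homogenization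

/-! ### Comparison of Dirichlet infima and energies on concentric cubes -/

namespace Homogenization

variable {d m : ℕ} {Ω : Set (E d)} {p : ℝ} {L : E d → Mat m d → ℝ≥0} {ε : ℝ}

/-- Comparison of the Dirichlet infima of two functions on concentric cubes. -/
lemma GrowthBound.exists_dirichletInf_le (hp : 1 < p) (hΩo : IsOpen Ω) {β : ℝ≥0}
    {ν : Measure (E d)} (hG : GrowthBound Ω p L β ν) : ∃ C : ℝ≥0∞, C ≠ ⊤ ∧
    ∀ (ε : ℝ) (x : E d) (a ρ : ℝ) (v w : Sobolev Ω p m), 0 < ε → ε ≤ 1 → 0 < a → a < ρ →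
    cube x ρ ⊆ Ω → dirichletInf Ω p L ε w.toFun (cube x ρ) ≤
      dirichletInf Ω p L ε v.toFun (cube x a) +
      C * (ν (cube x ρ \ closedCube x a) +
        (∫⁻ y in cube x ρ \ closedCube x a, ‖w.toFun y‖ₑ ^ p) +
        (∫⁻ y in cube x ρ \ closedCube x a, ‖w.grad y‖ₑ ^ p) +
        (1 + ENNReal.ofReal (1 / (ρ - a)) ^ p) *
          (∫⁻ y in cube x ρ \ closedCube x a, ‖v.toFun y - w.toFun y‖ₑ ^ p) +
        ∫⁻ y in cube x ρ \ closedCube x a, ‖v.grad y‖ₑ ^ p) := by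
  obtain ⟨C, hC, h⟩ := hG.exists_transition hp hΩo
  refine ⟨C, hC, fun ε x a ρ v w h0 h1 ha haρ hΩ => ?_⟩
  conv_rhs => unfold dirichletInf
  simp only [ENNReal.iInf_add]
  refine le_iInf fun v' => le_iInf fun hv' => ?_
  -- Take `b = ρ` and any competitor `v'` for `v` on the inner cube. Outside that cube `v'`
  -- coincides with `v`, so the error terms do not depend on `v'`.
  refine (h ε x a ρ ρ v' w h0 h1 ha haρ le_rfl hΩ).trans (le_of_eq ?_)
  have hv : ∀ᵐ y ∂volume.restrict (cube x ρ \ closedCube x a), v'.toFun y = v.toFun y :=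
    ae_restrict_of_ae_restrict_of_subset (t := Ω \ cube x a)
      (fun y hy => ⟨hΩ hy.1, fun h => hy.2 (cube_subset_closedCube x a h)⟩) hv'
  have hg := v'.grad_ae_eq hp v ((isOpen_cube x ρ).sdiff (isClosed_closedCube x a))
    (sdiff_subset.trans hΩ) hv
  rw [lintegral_congr_ae (f := fun y => ‖v'.toFun y - w.toFun y‖ₑ ^ p) (g := fun y => ‖v.toFun y - w.toFun y‖ₑ ^ p)
    (hv.mono fun y hy => by simp only [hy]),
    lintegral_congr_ae (f := fun y => ‖v'.grad y‖ₑ ^ p) (g := fun y => ‖v.grad y‖ₑ ^ p)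
    (hg.mono fun y hy => by simp only [hy])]

lemma lintegral_grad_rpow_le_energy {α : ℝ} (hp : 1 < p) (hα : 0 < α)
    (hcoer : ∀ x ξ, α * ‖ξ‖ ^ p ≤ (L x ξ : ℝ)) (v : Sobolev Ω p m) (O : Set (E d)) :
    ∫⁻ y in O, ‖v.grad y‖ₑ ^ p ≤ ENNReal.ofReal α⁻¹ * energy L ε O v := by
  unfold energy
  rw [← lintegral_const_mul' _ _ ENNReal.ofReal_ne_top]
  refine lintegral_mono fun y => ?_
  rw [← ofReal_norm, ENNReal.ofReal_rpow_of_nonneg (norm_nonneg _) (by linarith),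
    ← ENNReal.ofReal_coe_nnreal, ← ENNReal.ofReal_mul (by positivity)]
  refine ENNReal.ofReal_le_ofReal ?_
  rw [le_inv_mul_iff₀ hα]
  exact hcoer _ _

/-- Comparison of a Dirichlet infimum with the energy of a nearby function: the transition takes
place in the best of `N` layers. -/
lemma GrowthBound.exists_dirichletInf_le_energy (hp : 1 < p) (hΩo : IsOpen Ω) {β : ℝ≥0}
    {ν : Measure (E d)} (hG : GrowthBound Ω p L β ν) {α : ℝ} (hα : 0 < α)
    (hcoer : ∀ x ξ, α * ‖ξ‖ ^ p ≤ (L x ξ : ℝ)) : ∃ C : ℝ≥0∞, C ≠ ⊤ ∧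
    ∀ (ε : ℝ) (x : E d) (a ρ : ℝ) (N : ℕ) (v w : Sobolev Ω p m), 0 < ε → ε ≤ 1 → 0 < a → a < ρ →
    0 < N → cube x ρ ⊆ Ω → dirichletInf Ω p L ε w.toFun (cube x ρ) ≤
      (1 + C / N) * energy L ε (cube x ρ) v +
      C * (ν (cube x ρ \ closedCube x a) +
        (∫⁻ y in cube x ρ \ closedCube x a, ‖w.toFun y‖ₑ ^ p) +
        (∫⁻ y in cube x ρ \ closedCube x a, ‖w.grad y‖ₑ ^ p) +
        (1 + ENNReal.ofReal (N / (ρ - a)) ^ p) *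
          (∫⁻ y in cube x ρ \ closedCube x a, ‖v.toFun y - w.toFun y‖ₑ ^ p)) := by
  obtain ⟨C, hC, h⟩ := hG.exists_transition hp hΩo
  refine ⟨C * ENNReal.ofReal α⁻¹ + C, ENNReal.add_ne_top.2
    ⟨ENNReal.mul_ne_top hC ENNReal.ofReal_ne_top, hC⟩,
    fun ε x a ρ N v w h0 h1 ha haρ hN hΩ => ?_⟩
  set A := ENNReal.ofReal α⁻¹
  have hNr : (0 : ℝ) < N := by exact_mod_cast hN
  -- The region between the sides `a` and `ρ` is cut into `N` layers of equal width `δ`; their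
  -- bounding sides are the numbers `r j`.
  set δ := (ρ - a) / N with hδdef
  have hδ : 0 < δ := div_pos (sub_pos.2 haρ) hNr
  let r : ℕ → ℝ := fun j => a + j * δ
  have hr0 : ∀ j, a ≤ r j := fun j => by
    have : 0 ≤ (j : ℝ) * δ := by positivity
    simp only [r]; linarith
  have hr1 : ∀ j, r (j + 1) - r j = δ := fun j => by simp only [r]; push_cast; ring
  have hrN : r N = ρ := by simp only [r, hδdef]; field_simp; ring
  have hrm : Monotone r := monotone_nat_of_le_succ fun j => by linarith [hr1 j]
  have hδ1 : 1 / δ = N / (ρ - a) := by rw [hδdef, one_div_div]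
  set R := cube x ρ \ closedCube x a with hR
  set X := ν R + (∫⁻ y in R, ‖w.toFun y‖ₑ ^ p) + (∫⁻ y in R, ‖w.grad y‖ₑ ^ p) +
        (1 + ENNReal.ofReal (N / (ρ - a)) ^ p) * (∫⁻ y in R, ‖v.toFun y - w.toFun y‖ₑ ^ p) with hX
  set F := energy L ε (cube x ρ) v with hF
  set mm := dirichletInf Ω p L ε w.toFun (cube x ρ) with hmm
  have step : ∀ j ∈ Finset.range N, mm ≤ F + C * X +
      C * ∫⁻ y in cube x (r (j + 1)) \ closedCube x (r j), ‖v.grad y‖ₑ ^ p := by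
    intro j hj
    have hjN : r (j + 1) ≤ ρ := hrN ▸ hrm (Finset.mem_range.1 hj)
    have hlt : r j < r (j + 1) := by linarith [hr1 j]
    have h2 := h ε x (r j) (r (j + 1)) ρ v w h0 h1 (ha.trans_le (hr0 j)) hlt hjN hΩ
    rw [hr1, hδ1] at h2
    have hs : cube x ρ \ closedCube x (r j) ⊆ R :=
      sdiff_subset_sdiff_right (closedCube_mono x (hr0 j))
    refine h2.trans ?_
    rw [mul_add C, ← add_assoc]
    refine add_le_add (add_le_add (energy_mono (cube_mono x (hlt.le.trans hjN)) v)
      (mul_le_mul_right ?_ _)) le_rfl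
    rw [hX]
    gcongr
  have hsum : ∑ j ∈ Finset.range N,
      ∫⁻ y in cube x (r (j + 1)) \ closedCube x (r j), ‖v.grad y‖ₑ ^ p ≤ A * F := by
    rw [← lintegral_biUnion_finset]
    · refine (lintegral_mono_set (t := cube x ρ) ?_).trans
        (lintegral_grad_rpow_le_energy hp hα hcoer v _)
      refine iUnion₂_subset fun j hj y hy => cube_mono x ?_ hy.1
      exact hrN ▸ hrm (Finset.mem_range.1 hj)
    · intro i _ j _ hij
      simp only [Function.onFun]
      rcases lt_or_gt_of_ne hij with h | h
      · exact Set.disjoint_left.2 fun y hy hy' => hy'.2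
          (closedCube_mono x (hrm h) (cube_subset_closedCube _ _ hy.1))
      · exact Set.disjoint_left.2 fun y hy hy' => hy.2
          (closedCube_mono x (hrm h) (cube_subset_closedCube _ _ hy'.1))
    · exact fun j _ => (measurableSet_cube _ _).diff (measurableSet_closedCube _ _)
  -- The layers are disjoint, so the integrals of `|∇v|^p` over them add up to at most `A * F` by
  -- coercivity. Averaging the `N` estimates plays the role of choosing the best layer.
  have htot : (N : ℝ≥0∞) * mm ≤ N * (F + C * X) + C * (A * F) := by
    have := Finset.sum_le_sum step
    simp only [Finset.sum_const, Finset.card_range, nsmul_eq_mul, Finset.sum_add_distrib,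
      ← Finset.mul_sum] at this
    refine this.trans ?_
    rw [mul_add]
    gcongr
  have hN0 : (N : ℝ≥0∞) ≠ 0 := by exact_mod_cast hN.ne'
  have hNt : (N : ℝ≥0∞) ≠ ⊤ := ENNReal.natCast_ne_top N
  have hm : mm ≤ (N : ℝ≥0∞)⁻¹ * (N * (F + C * X) + C * (A * F)) := by
    rw [← ENNReal.mul_le_iff_le_inv hN0 hNt]; exact htot
  refine hm.trans ?_
  rw [mul_add, ← mul_assoc, ENNReal.inv_mul_cancel hN0 hNt, one_mul, div_eq_mul_inv]
  calc F + C * X + (N : ℝ≥0∞)⁻¹ * (C * (A * F)) = (1 + (C * A) * (N : ℝ≥0∞)⁻¹) * F + C * X := by ring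
    _ ≤ _ := by
      gcongr
      · exact le_self_add
      · exact le_add_self

end Homogenization

/-! ### Mollification in L^p -/

namespace Homogenization

variable {d m : ℕ} {Ω : Set (E d)} {p : ℝ}

/-- Jensen's inequality, read off from the monotonicity of Lebesgue norms on a probability space. -/
lemma rpow_lintegral_le {α : Type*} [MeasurableSpace α] (P : Measure α) [IsProbabilityMeasure P]
    {F : α → ℝ≥0∞} (hF : Measurable F) (hp : 1 ≤ p) : (∫⁻ t, F t ∂P) ^ p ≤ ∫⁻ t, F t ^ p ∂P := by
  have h := eLpNorm'_le_eLpNorm'_of_exponent_le (f := F) zero_lt_one hp P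
    hF.stronglyMeasurable.aestronglyMeasurable
  simp only [eLpNorm', enorm_eq_self, ENNReal.rpow_one, div_one] at h
  have hp0 : 0 < p := by linarith
  calc (∫⁻ t, F t ∂P) ^ p ≤ ((∫⁻ t, F t ^ p ∂P) ^ (1 / p)) ^ p := ENNReal.rpow_le_rpow h hp0.le
    _ = _ := by rw [← ENNReal.rpow_mul, one_div_mul_cancel hp0.ne', ENNReal.rpow_one]

/-- Mollification of `f` with a bump function. -/
noncomputable def mollify (η : ContDiffBump (0 : E d)) (f : E d → ℝ) : E d → ℝ :=
  convolution f (η.normed volume) (ContinuousLinearMap.mul ℝ ℝ) volume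

lemma mollify_apply (η : ContDiffBump (0 : E d)) (f : E d → ℝ) (x : E d) :
    mollify η f x = ∫ t, f t * η.normed volume (x - t) := rfl

lemma mollify_congr (η : ContDiffBump (0 : E d)) {f g : E d → ℝ} (h : f =ᵐ[volume] g) :
    mollify η f = mollify η g := by
  ext x
  rw [mollify_apply, mollify_apply]
  exact integral_congr_ae (h.mono fun t ht => by simp only [ht])

lemma integrable_mollify (η : ContDiffBump (0 : E d)) {f : E d → ℝ}
    (hf : LocallyIntegrable f volume) (x : E d) :
    Integrable (fun t => f t * η.normed volume (x - t)) volume :=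
  (HasCompactSupport.convolutionExists_right (ContinuousLinearMap.mul ℝ ℝ)
    η.hasCompactSupport_normed hf η.continuous_normed x).integrable

lemma mollify_sub (η : ContDiffBump (0 : E d)) {f g : E d → ℝ} (hf : LocallyIntegrable f volume)
    (hg : LocallyIntegrable g volume) : mollify η (f - g) = mollify η f - mollify η g := by
  ext x
  rw [Pi.sub_apply, mollify_apply, mollify_apply, mollify_apply,
    ← integral_sub (integrable_mollify η hf x) (integrable_mollify η hg x)]
  simp [sub_mul]

lemma contDiff_mollify (η : ContDiffBump (0 : E d)) {f : E d → ℝ} (hf : LocallyIntegrable f volume) :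
    ContDiff ℝ ∞ (mollify η f) :=
  HasCompactSupport.contDiff_convolution_right (n := (⊤ : ℕ∞)) _ η.hasCompactSupport_normed hf
    η.contDiff_normed

/-- For fixed `x` the mollifier is a probability density in `t`. Jensen's inequality gives a
pointwise bound, and Tonelli's theorem integrates it in `x`. -/
lemma lintegral_mollify_rpow_le (hp : 1 ≤ p) (η : ContDiffBump (0 : E d)) {f : E d → ℝ}
    (hf : AEStronglyMeasurable f volume) :
    ∫⁻ x, ‖mollify η f x‖ₑ ^ p ≤ ∫⁻ x, ‖f x‖ₑ ^ p := by
  wlog hm : Measurable f generalizing f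
  · rw [mollify_congr η hf.ae_eq_mk, lintegral_congr_ae (f := fun x => ‖f x‖ₑ ^ p)
      (g := fun x => ‖hf.mk f x‖ₑ ^ p) (hf.ae_eq_mk.mono fun x hx => by simp only [← hx])]
    exact this hf.stronglyMeasurable_mk.aestronglyMeasurable hf.stronglyMeasurable_mk.measurable
  let w : E d → ℝ≥0∞ := fun x => ENNReal.ofReal (η.normed volume x)
  have hw : Measurable w := (η.continuous_normed.measurable).ennreal_ofReal
  have hw1 : ∫⁻ x, w x = 1 := by
    rw [← ofReal_integral_eq_lintegral_ofReal η.integrable_normed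
      (ae_of_all _ fun x => η.nonneg_normed x), η.integral_normed, ENNReal.ofReal_one]
  have hpt : ∀ x, ‖mollify η f x‖ₑ ^ p ≤ ∫⁻ t, ‖f t‖ₑ ^ p * w (x - t) := by
    intro x
    have hwx : Measurable fun t => w (x - t) := hw.comp (measurable_const.sub measurable_id)
    have hP : IsProbabilityMeasure (volume.withDensity fun t => w (x - t)) := ⟨by
      rw [withDensity_apply _ MeasurableSet.univ, Measure.restrict_univ,
        lintegral_sub_left_eq_self w x, hw1]⟩
    have h1 := rpow_lintegral_le (volume.withDensity fun t => w (x - t))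
      (F := fun t => ‖f t‖ₑ) hm.enorm hp
    rw [lintegral_withDensity_eq_lintegral_mul _ hwx hm.enorm,
      lintegral_withDensity_eq_lintegral_mul _ hwx (hm.enorm.pow_const p)] at h1
    refine (ENNReal.rpow_le_rpow ?_ (by linarith)).trans (h1.trans (le_of_eq ?_))
    · rw [mollify_apply]
      refine (enorm_integral_le_lintegral_enorm _).trans (lintegral_mono fun t => ?_)
      rw [enorm_mul, mul_comm, Real.enorm_eq_ofReal (η.nonneg_normed _)]
      rfl
    · exact lintegral_congr fun t => mul_comm _ _
  refine (lintegral_mono hpt).trans ?_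
  rw [lintegral_lintegral_swap]
  · refine le_of_eq (lintegral_congr fun t => ?_)
    have hwt : Measurable fun x => w (x - t) := hw.comp (measurable_id.sub_const t)
    rw [lintegral_const_mul _ hwt,
      lintegral_sub_right_eq_self w t, hw1, mul_one]
  · exact (((hm.enorm.pow_const p).comp measurable_snd).mul
      (hw.comp (measurable_fst.sub measurable_snd))).aemeasurable

lemma eLpNorm_eq_rpow {F : Type*} [NormedAddCommGroup F] (hp : 1 < p) {μ : Measure (E d)}
    (f : E d → F) : eLpNorm f (ENNReal.ofReal p) μ = (∫⁻ x, ‖f x‖ₑ ^ p ∂μ) ^ (1 / p) := by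
  rw [eLpNorm_eq_lintegral_rpow_enorm_toReal (by simp; linarith) ENNReal.ofReal_ne_top,
    ENNReal.toReal_ofReal (by linarith)]

lemma eLpNorm_mollify_le (hp : 1 < p) (η : ContDiffBump (0 : E d)) {f : E d → ℝ}
    (hf : AEStronglyMeasurable f volume) :
    eLpNorm (mollify η f) (ENNReal.ofReal p) volume ≤ eLpNorm f (ENNReal.ofReal p) volume := by
  rw [eLpNorm_eq_rpow hp, eLpNorm_eq_rpow hp]
  exact ENNReal.rpow_le_rpow (lintegral_mollify_rpow_le hp.le η hf)
    (one_div_nonneg.2 (by linarith))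

/-- Differentiate the kernel and use `t ↦ η(x - t)` as a test function for the weak derivative; the
two minus signs cancel. -/
lemma partialDeriv_mollify (η : ContDiffBump (0 : E d)) {f g : E d → ℝ} {j : Fin d}
    (h : IsWeakDeriv univ j f g) (hf : LocallyIntegrable f volume) (x : E d) :
    partialDeriv j (mollify η f) x = mollify η g x := by
  have h1 : ContDiff ℝ ∞ (η.normed (volume : Measure (E d))) := η.contDiff_normed
  have hd := HasCompactSupport.hasFDerivAt_convolution_right (ContinuousLinearMap.mul ℝ ℝ)
    (μ := (volume : Measure (E d))) η.hasCompactSupport_normed hf (h1.of_le (by simp)) x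
  unfold mollify partialDeriv
  rw [hd.fderiv, convolution_precompR_apply _ hf (η.hasCompactSupport_normed.fderiv ℝ)
    (h1.continuous_fderiv (by simp))]
  have hφ : ContDiff ℝ ∞ fun t => η.normed (volume : Measure (E d)) (x - t) := h1.comp (by fun_prop)
  have hφc : HasCompactSupport fun t => η.normed (volume : Measure (E d)) (x - t) :=
    η.hasCompactSupport_normed.comp_homeomorph (Homeomorph.subLeft x)
  have hφd : ∀ t, partialDeriv j (fun t => η.normed (volume : Measure (E d)) (x - t)) t =
      - fderiv ℝ (η.normed (volume : Measure (E d))) (x - t) (EuclideanSpace.single j 1) := by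
    intro t
    have e1 : HasFDerivAt (fun t : E d => x - t) (-ContinuousLinearMap.id ℝ (E d)) t :=
      (hasFDerivAt_id t).const_sub x
    have e2 := ((h1.differentiable (by simp) (x - t)).hasFDerivAt.comp t e1).fderiv
    rw [Function.comp_def] at e2
    rw [partialDeriv, e2]
    simp
  have h2 := h _ hφ hφc (subset_univ _)
  simp only [Measure.restrict_univ, hφd, neg_mul, integral_neg, neg_inj] at h2
  rw [convolution_mul, convolution_mul]
  simp only [mul_comm (f _), mul_comm (g _)]
  exact h2

lemma norm_mollify_sub_le (η : ContDiffBump (0 : E d)) {g : E d → ℝ} (hg : Continuous g) {κ : ℝ}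
    {x : E d} (h : ∀ y, dist y x < η.rOut → |g y - g x| ≤ κ) : |mollify η g x - g x| ≤ κ := by
  have h1 := η.dist_normed_convolution_le (μ := (volume : Measure (E d))) (g := g) (x₀ := x) (ε := κ)
    hg.aestronglyMeasurable fun y hy => h y hy
  have h2 : convolution (η.normed volume) g (ContinuousLinearMap.lsmul ℝ ℝ) volume x =
      mollify η g x := by
    rw [convolution_lsmul_swap, mollify_apply]
    simp [mul_comm]
  rwa [h2, Real.dist_eq] at h1

lemma mollify_eq_zero (η : ContDiffBump (0 : E d)) {f : E d → ℝ} {x : E d}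
    (h : ∀ᵐ t, dist t x < η.rOut → f t = 0) : mollify η f x = 0 := by
  rw [mollify_apply]
  refine integral_eq_zero_of_ae (h.mono fun t ht => ?_)
  by_cases hx : dist t x < η.rOut
  · simp [ht hx]
  · have : η.normed volume (x - t) = 0 := by
      rw [← Function.notMem_support, η.support_normed_eq, Metric.mem_ball, dist_zero_right]
      rwa [dist_comm, dist_eq_norm] at hx
    simp [this]

/-- Approximation of the identity: contractions of `L^p` which converge on continuous functions
with compact support. -/
lemma tendsto_eLpNorm_of_dense {q : ℝ≥0∞} (hq1 : 1 ≤ q) (hq : q ≠ ⊤)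
    (T : ℕ → (E d → ℝ) → E d → ℝ)
    (hT : ∀ n f, MemLp f q volume → MemLp (T n f) q volume)
    (hsub : ∀ n f g, MemLp f q volume → MemLp g q volume →
      eLpNorm (T n f - T n g) q volume ≤ eLpNorm (f - g) q volume)
    (hc : ∀ g, Continuous g → HasCompactSupport g →
      Tendsto (fun n => eLpNorm (T n g - g) q volume) atTop (𝓝 0))
    {f : E d → ℝ} (hf : MemLp f q volume) :
    Tendsto (fun n => eLpNorm (T n f - f) q volume) atTop (𝓝 0) := by
  rw [ENNReal.tendsto_nhds_zero]
  intro κ hκ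
  have hκ3 : κ / 3 ≠ 0 := by simp [hκ.ne']
  obtain ⟨g, hgs, hfg, hg, hgm⟩ := hf.exists_hasCompactSupport_eLpNorm_sub_le hq hκ3
  filter_upwards [(ENNReal.tendsto_nhds_zero.1 (hc g hg hgs)) (κ / 3) (pos_iff_ne_zero.2 hκ3)]
    with n hn
  have e : T n f - f = (T n f - T n g) + (T n g - g) + (g - f) := by abel
  rw [e]
  have m1 : AEStronglyMeasurable (T n f - T n g) volume := ((hT n f hf).sub (hT n g hgm)).1
  have m2 : AEStronglyMeasurable (T n g - g) volume := ((hT n g hgm).sub hgm).1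
  have m3 : AEStronglyMeasurable (g - f) volume := (hgm.sub hf).1
  have hgf : eLpNorm (g - f) q volume ≤ κ / 3 := by
    rw [← eLpNorm_neg, neg_sub]; exact hfg
  refine (eLpNorm_add_le (m1.add m2) m3 hq1).trans ?_
  refine (add_le_add ((eLpNorm_add_le m1 m2 hq1).trans
    (add_le_add ((hsub n f g hf hgm).trans hfg) hn)) hgf).trans (le_of_eq ?_)
  exact ENNReal.add_thirds κ

/-- Uniform convergence suffices because all functions vanish outside one compact set, which has
finite measure. -/
lemma tendsto_eLpNorm_zero_of_uniform {q : ℝ≥0∞} {F : ℕ → E d → ℝ} {K : Set (E d)}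
    (hK : IsCompact K) (hF : ∀ n x, x ∉ K → F n x = 0)
    (hu : ∀ κ > 0, ∀ᶠ n in atTop, ∀ x, |F n x| ≤ κ) :
    Tendsto (fun n => eLpNorm (F n) q volume) atTop (𝓝 0) := by
  set A : ℝ≥0∞ := volume.restrict K univ ^ q.toReal⁻¹
  have hA : A ≠ ⊤ := by
    refine ENNReal.rpow_ne_top_of_nonneg (by positivity) ?_
    rw [Measure.restrict_apply_univ]
    exact hK.measure_lt_top.ne
  rw [ENNReal.tendsto_nhds_zero]
  intro κ hκ
  obtain ⟨κ', hκ'0, hκ'⟩ : ∃ κ' : ℝ, 0 < κ' ∧ A * ENNReal.ofReal κ' ≤ κ := by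
    have h0 : Tendsto (fun t : ℝ => A * ENNReal.ofReal t) (𝓝[>] 0) (𝓝 0) := by
      have h1 : Tendsto (fun t : ℝ => ENNReal.ofReal t) (𝓝 0) (𝓝 (ENNReal.ofReal 0)) :=
        ENNReal.continuous_ofReal.tendsto 0
      rw [ENNReal.ofReal_zero] at h1
      have := ENNReal.Tendsto.const_mul (h1.mono_left (nhdsWithin_le_nhds (s := Ioi 0))) (Or.inr hA)
      rwa [mul_zero] at this
    obtain ⟨t, ht, ht0⟩ := ((ENNReal.tendsto_nhds_zero.1 h0 κ hκ).and self_mem_nhdsWithin).exists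
    exact ⟨t, ht0, ht⟩
  filter_upwards [hu κ' hκ'0] with n hn
  rw [← eLpNorm_restrict_eq_of_support_subset (s := K)
    (fun x hx => by_contra fun h => hx (hF n x h))]
  exact (eLpNorm_le_of_ae_bound (C := κ') (ae_of_all _ fun x => by simpa using hn x)).trans hκ'

end Homogenization

/-! ### Convergence of mollifications and dilations -/

namespace Homogenization

variable {d m : ℕ} {Ω : Set (E d)} {p : ℝ}

lemma eLpNorm_le_sum_coord {n : Type*} [Fintype n] {q : ℝ≥0∞} (hq : 1 ≤ q) {μ : Measure (E d)}
    {f : E d → EuclideanSpace ℝ n} (hf : AEStronglyMeasurable f μ) :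
    eLpNorm f q μ ≤ ∑ i, eLpNorm (fun x => f x i) q μ := by
  have hm : ∀ i, AEStronglyMeasurable (fun x => f x i) μ := fun i =>
    (EuclideanSpace.proj (𝕜 := ℝ) i).continuous.comp_aestronglyMeasurable hf
  refine le_trans ?_ (eLpNorm_sum_le (f := fun i x => ‖f x i‖) (s := Finset.univ)
    (fun i _ => (hm i).norm) hq |>.trans (le_of_eq (Finset.sum_congr rfl fun i _ => eLpNorm_norm _)))
  refine eLpNorm_mono_real fun x => ?_
  rw [Finset.sum_apply, EuclideanSpace.norm_eq]
  refine Real.sqrt_le_iff.2 ⟨Finset.sum_nonneg fun i _ => norm_nonneg _, ?_⟩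
  exact Finset.sum_sq_le_sq_sum_of_nonneg fun i _ => norm_nonneg _

/-- A sequence of bump functions concentrating at the origin. -/
noncomputable def bump (d n : ℕ) : ContDiffBump (0 : E d) :=
  ⟨1 / (2 * (n + 1)), 1 / (n + 1), by positivity, by
    apply one_div_lt_one_div_of_lt <;> [positivity; nlinarith [(Nat.cast_nonneg n : (0:ℝ) ≤ n)]]⟩

lemma tendsto_bump_rOut : Tendsto (fun n => (bump d n).rOut) atTop (𝓝 0) :=
  tendsto_one_div_add_atTop_nhds_zero_nat

lemma bump_rOut_le_one (n : ℕ) : (bump d n).rOut ≤ 1 := by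
  show 1 / ((n : ℝ) + 1) ≤ 1
  rw [div_le_one (by positivity)]
  linarith [(Nat.cast_nonneg n : (0:ℝ) ≤ n)]

lemma tendsto_eLpNorm_mollify (hp : 1 < p) {f : E d → ℝ} (hf : MemLp f (ENNReal.ofReal p) volume) :
    Tendsto (fun n => eLpNorm (mollify (bump d n) f - f) (ENNReal.ofReal p) volume) atTop (𝓝 0) := by
  refine tendsto_eLpNorm_of_dense (one_le_ofReal hp) ENNReal.ofReal_ne_top
    (fun n => mollify (bump d n)) (fun n f hf => ⟨?_, ?_⟩) (fun n f g hf hg => ?_)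
    (fun g hg hgc => ?_) hf
  · exact (contDiff_mollify _ (hf.locallyIntegrable (one_le_ofReal hp))).continuous.aestronglyMeasurable
  · exact (eLpNorm_mollify_le hp _ hf.1).trans_lt hf.2
  · rw [← mollify_sub _ (hf.locallyIntegrable (one_le_ofReal hp))
      (hg.locallyIntegrable (one_le_ofReal hp))]
    exact eLpNorm_mollify_le hp _ (hf.sub hg).1
  · refine tendsto_eLpNorm_zero_of_uniform (K := Metric.cthickening 1 (tsupport g))
      (IsCompact.cthickening hgc) (fun n x hx => ?_) (fun κ hκ => ?_)
    · have h0 : ∀ t, dist t x ≤ 1 → g t = 0 := fun t ht => by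
        refine image_eq_zero_of_notMem_tsupport fun h => hx ?_
        exact Metric.mem_cthickening_of_dist_le x t 1 _ h (by rwa [dist_comm])
      rw [Pi.sub_apply, mollify_eq_zero _ (ae_of_all _ fun t ht =>
        h0 t (ht.le.trans (bump_rOut_le_one n))), h0 x (by simp), sub_zero]
    · obtain ⟨δ, hδ, h⟩ := Metric.uniformContinuous_iff.1
        (hgc.uniformContinuous_of_continuous hg) κ hκ
      filter_upwards [tendsto_bump_rOut.eventually (gt_mem_nhds hδ)] with n hn x
      exact norm_mollify_sub_le _ hg fun y hy => (h (hy.trans hn)).le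

lemma lintegral_comp_affine_le {c : ℝ} (hc : 1 ≤ c) (b : E d) (f : E d → ℝ≥0∞) :
    ∫⁻ x, f (c • x + b) ≤ ∫⁻ x, f x := by
  rw [Sobolev.lintegral_comp_affine (by linarith)]
  refine mul_le_of_le_one_left zero_le (ENNReal.ofReal_le_one.2 ?_)
  rw [abs_inv, abs_of_nonneg (by positivity)]
  exact inv_le_one_of_one_le₀ (one_le_pow₀ hc)

lemma eLpNorm_comp_affine_le (hp : 1 < p) {c : ℝ} (hc : 1 ≤ c) (b : E d) (f : E d → ℝ) :
    eLpNorm (fun x => f (c • x + b)) (ENNReal.ofReal p) volume ≤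
      eLpNorm f (ENNReal.ofReal p) volume := by
  rw [eLpNorm_eq_rpow hp, eLpNorm_eq_rpow hp]
  exact ENNReal.rpow_le_rpow (lintegral_comp_affine_le hc b fun x => ‖f x‖ₑ ^ p)
    (one_div_nonneg.2 (by linarith))

/-- For `c ≥ 1` composition with the dilation about `x₀` is a contraction of L^p, so only continuous
functions with compact support matter. For these, uniform continuity applies, since the dilation
displaces `x` by `(c - 1) • (x - x₀)`. -/
lemma tendsto_eLpNorm_dilate (hp : 1 < p) (x₀ : E d) {c : ℕ → ℝ} (hc : ∀ n, 1 ≤ c n)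
    (hc1 : Tendsto c atTop (𝓝 1)) {f : E d → ℝ} (hf : MemLp f (ENNReal.ofReal p) volume) :
    Tendsto (fun n => eLpNorm ((fun x => f (c n • x + (1 - c n) • x₀)) - f) (ENNReal.ofReal p) volume)
      atTop (𝓝 0) := by
  have hc0 : ∀ n, c n ≠ 0 := fun n => by linarith [hc n]
  refine tendsto_eLpNorm_of_dense (one_le_ofReal hp) ENNReal.ofReal_ne_top
    (fun n f x => f (c n • x + (1 - c n) • x₀)) (fun n f hf => Sobolev.memLp_comp_affine (hc0 n) _ hf)
    (fun n f g hf hg => ?_) (fun g hg hgc => ?_) hf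
  · exact eLpNorm_comp_affine_le hp (hc n) _ (f - g)
  · obtain ⟨R, hR0, hR⟩ : ∃ R > 0, tsupport g ⊆ Metric.closedBall x₀ R := by
      obtain ⟨R, hR⟩ := hgc.isBounded.subset_closedBall x₀
      exact ⟨max R 1, by positivity, hR.trans (Metric.closedBall_subset_closedBall (le_max_left _ _))⟩
    have hz : ∀ y, R < dist y x₀ → g y = 0 := fun y hy =>
      image_eq_zero_of_notMem_tsupport fun h => absurd (hR h) (by simpa using hy)
    have he : ∀ n x, c n • x + (1 - c n) • x₀ - x₀ = c n • (x - x₀) := fun n x => by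
      rw [smul_sub, sub_smul, one_smul]; abel
    have hdist : ∀ n x, dist (c n • x + (1 - c n) • x₀) x₀ = c n * dist x x₀ := fun n x => by
      rw [dist_eq_norm, he, norm_smul, Real.norm_of_nonneg (by linarith [hc n]), dist_eq_norm]
    have hz2 : ∀ n x, R < dist x x₀ → g (c n • x + (1 - c n) • x₀) = 0 := fun n x hx => by
      refine hz _ ?_
      rw [hdist]
      nlinarith [hc n, dist_nonneg (x := x) (y := x₀)]
    refine tendsto_eLpNorm_zero_of_uniform (isCompact_closedBall x₀ R) (fun n x hx => ?_)
      (fun κ hκ => ?_)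
    · rw [Metric.mem_closedBall, not_le] at hx
      simp [hz x hx, hz2 n x hx]
    · obtain ⟨δ, hδ, h⟩ := Metric.uniformContinuous_iff.1
        (hgc.uniformContinuous_of_continuous hg) κ hκ
      have h2 : Tendsto (fun n => (c n - 1) * R) atTop (𝓝 0) := by
        simpa using (hc1.sub_const 1).mul_const R
      filter_upwards [h2.eventually (gt_mem_nhds hδ)] with n hn x
      by_cases hx : R < dist x x₀
      · simp [hz x hx, hz2 n x hx, hκ.le]
      · refine (h (a := c n • x + (1 - c n) • x₀) (b := x) ?_).le
        have e : c n • x + (1 - c n) • x₀ - x = (c n - 1) • (x - x₀) := by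
          rw [smul_sub, sub_smul, sub_smul, sub_smul, one_smul, one_smul]; abel
        rw [dist_eq_norm, e, norm_smul, Real.norm_of_nonneg (by linarith [hc n]), ← dist_eq_norm]
        exact (mul_le_mul_of_nonneg_left (not_lt.1 hx) (by linarith [hc n])).trans_lt hn

end Homogenization

/-! ### Smooth approximation of Sobolev functions supported in a cube -/

namespace Homogenization

variable {d m : ℕ} {Ω : Set (E d)} {p : ℝ}

lemma dist_apply_le (x y : E d) (i : Fin d) : |x i - y i| ≤ dist x y := by
  rw [dist_eq_norm]
  simpa using PiLp.norm_apply_le (x - y) i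

namespace Sobolev

lemma memLp_toFun' (u : Sobolev (univ : Set (E d)) p m) : MemLp u.toFun (ENNReal.ofReal p) volume := by
  simpa only [Measure.restrict_univ] using u.memLp_toFun

lemma memLp_grad' (u : Sobolev (univ : Set (E d)) p m) : MemLp u.grad (ENNReal.ofReal p) volume := by
  simpa only [Measure.restrict_univ] using u.memLp_grad

/-- Componentwise mollification of a vector-valued function. -/
noncomputable def mollifyVec (η : ContDiffBump (0 : E d)) (f : E d → E m) (x : E d) : E m :=
  WithLp.toLp 2 fun i => mollify η (fun y => f y i) x

lemma tendsto_of_coord {n : Type*} [Fintype n] {q : ℝ≥0∞} (hq : 1 ≤ q) {F : ℕ → E d → EuclideanSpace ℝ n}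
    (hF : ∀ k, AEStronglyMeasurable (F k) volume)
    (h : ∀ i, Tendsto (fun k => eLpNorm (fun x => F k x i) q volume) atTop (𝓝 0)) :
    Tendsto (fun k => eLpNorm (F k) q volume) atTop (𝓝 0) := by
  have h0 : Tendsto (fun k => ∑ i, eLpNorm (fun x => F k x i) q volume) atTop (𝓝 0) := by
    simpa using tendsto_finsetSum Finset.univ fun i _ => h i
  exact tendsto_of_tendsto_of_tendsto_of_le_of_le tendsto_const_nhds h0 (fun _ => zero_le)
    fun k => eLpNorm_le_sum_coord hq (hF k)

/-- Mollification enlarges the support, and the gap `r' < r` leaves room for this: with radius below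
`(r - r') / 4` the support stays in the closed cube of side `(r' + r) / 2`. -/
lemma exists_mollify (hp : 1 < p) (u : Sobolev (univ : Set (E d)) p m) {x₀ : E d} {r' r : ℝ}
    (hr : r' < r) (h0 : ∀ᵐ x, x ∉ cube x₀ r' → u.toFun x = 0) {κ : ℝ≥0∞} (hκ : 0 < κ) :
    ∃ ψ : E d → E m, ContDiff ℝ ∞ ψ ∧ HasCompactSupport ψ ∧ tsupport ψ ⊆ cube x₀ r ∧
      eLpNorm (fun x => u.toFun x - ψ x) (ENNReal.ofReal p) volume ≤ κ ∧
      eLpNorm (fun x => u.grad x - jacobian ψ x) (ENNReal.ofReal p) volume ≤ κ := by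
  have hq := one_le_ofReal hp
  have hli : ∀ i, LocallyIntegrable (fun y => u.toFun y i) volume := fun i =>
    (u.memLp_toFun'.eval_piLp i).locallyIntegrable hq
  have hsm : ∀ n, ContDiff ℝ ∞ (mollifyVec (bump d n) u.toFun) := fun n =>
    (contDiff_piLp 2).2 fun i => contDiff_mollify _ (hli i)
  have hjac : ∀ n x, jacobian (mollifyVec (bump d n) u.toFun) x =
      WithLp.toLp 2 fun ij => mollify (bump d n) (fun y => u.grad y ij) x := by
    intro n x
    ext ij
    have hw := u.isWeakDeriv ij.1 ij.2
    exact partialDeriv_mollify (bump d n) hw (hli ij.1) x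
  have t1 : Tendsto (fun n => eLpNorm (fun x => u.toFun x - mollifyVec (bump d n) u.toFun x)
      (ENNReal.ofReal p) volume) atTop (𝓝 0) := by
    refine tendsto_of_coord hq (fun k => u.memLp_toFun'.1.sub (hsm k).continuous.aestronglyMeasurable)
      fun i => ?_
    refine (tendsto_eLpNorm_mollify hp (u.memLp_toFun'.eval_piLp i)).congr fun n => ?_
    rw [← eLpNorm_neg]
    refine congrArg (fun f => eLpNorm f _ _) (funext fun x => ?_)
    simp [mollifyVec]
  have t2 : Tendsto (fun n => eLpNorm (fun x => u.grad x - jacobian (mollifyVec (bump d n) u.toFun) x)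
      (ENNReal.ofReal p) volume) atTop (𝓝 0) := by
    refine tendsto_of_coord hq (fun k => u.memLp_grad'.1.sub ?_) fun ij => ?_
    · refine Continuous.aestronglyMeasurable ?_
      unfold jacobian
      exact (PiLp.continuous_toLp 2 _).comp (continuous_pi fun ij =>
        continuous_partialDeriv ((contDiff_piLp 2).1 (hsm k) ij.1) ij.2)
    · refine (tendsto_eLpNorm_mollify hp (u.memLp_grad'.eval_piLp ij)).congr fun n => ?_
      rw [← eLpNorm_neg]
      refine congrArg (fun f => eLpNorm f _ _) (funext fun x => ?_)
      simp [hjac]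
  have t3 := (tendsto_bump_rOut (d := d)).eventually (gt_mem_nhds (half_pos (half_pos (sub_pos.2 hr))))
  obtain ⟨n, h1, h2, h3⟩ := ((ENNReal.tendsto_nhds_zero.1 t1 κ hκ).and
    ((ENNReal.tendsto_nhds_zero.1 t2 κ hκ).and t3)).exists
  have hsupp : ∀ x, x ∉ closedCube x₀ ((r' + r) / 2) → mollifyVec (bump d n) u.toFun x = 0 := by
    intro x hx
    ext i
    refine mollify_eq_zero _ (h0.mono fun t ht htx => ?_)
    rw [ht fun htc => hx fun k => ?_]
    · rfl
    · have e1 := htc k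
      have e2 := dist_apply_le t x k
      have e3 : |x k - x₀ k| ≤ |t k - x k| + |t k - x₀ k| := by
        have := abs_add_le (-(t k - x k)) (t k - x₀ k)
        rw [abs_neg] at this
        have e : x k - x₀ k = -(t k - x k) + (t k - x₀ k) := by ring
        rwa [e]
      linarith
  have hts : tsupport (mollifyVec (bump d n) u.toFun) ⊆ closedCube x₀ ((r' + r) / 2) :=
    closure_minimal (fun x hx => by_contra fun h => hx (hsupp x h)) (isClosed_closedCube _ _)
  exact ⟨_, hsm n, HasCompactSupport.intro (isCompact_closedCube _ _) hsupp,
    hts.trans (closedCube_subset_cube _ (by linarith)), h1, h2⟩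

/-- Composition with a dilation about `x₀` of factor `c = 1 + 1 / (n + 1)`, divided by `c`, shrinks
the support to a cube of side `r / c` and thus creates the gap needed for mollification. As `c → 1`
the function and its gradient converge in L^p. -/
lemma exists_dilate (hp : 1 < p) (u : Sobolev (univ : Set (E d)) p m) {x₀ : E d} {r : ℝ}
    (hr : 0 < r) (h0 : ∀ᵐ x, x ∉ cube x₀ r → u.toFun x = 0) {κ : ℝ≥0∞} (hκ : 0 < κ) :
    ∃ (v : Sobolev (univ : Set (E d)) p m) (r' : ℝ), r' < r ∧
      (∀ᵐ x, x ∉ cube x₀ r' → v.toFun x = 0) ∧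
      eLpNorm (fun x => u.toFun x - v.toFun x) (ENNReal.ofReal p) volume ≤ κ ∧
      eLpNorm (fun x => u.grad x - v.grad x) (ENNReal.ofReal p) volume ≤ κ := by
  have hq := one_le_ofReal hp
  let c : ℕ → ℝ := fun n => 1 + 1 / (n + 1)
  have hc1 : ∀ n, 1 < c n := fun n => by
    have : (0 : ℝ) < 1 / (n + 1) := by positivity
    simp only [c]; linarith
  have hct : Tendsto c atTop (𝓝 1) := by
    simpa [c] using (tendsto_one_div_add_atTop_nhds_zero_nat (𝕜 := ℝ)).const_add 1
  have hc0 : ∀ n, c n ≠ 0 := fun n => by linarith [hc1 n]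
  let v : ℕ → Sobolev (univ : Set (E d)) p m := fun n => u.rescale (hc0 n) ((1 - c n) • x₀)
  have t1 : Tendsto (fun n => eLpNorm (fun x => u.toFun x - (v n).toFun x) (ENNReal.ofReal p) volume)
      atTop (𝓝 0) := by
    refine tendsto_of_coord hq (fun k => u.memLp_toFun'.1.sub (v k).memLp_toFun'.1) fun i => ?_
    have hf := u.memLp_toFun'.eval_piLp i
    have s1 := tendsto_eLpNorm_dilate hp x₀ (fun n => (hc1 n).le) hct hf
    have s2 : Tendsto (fun n => ‖(c n)⁻¹ - 1‖ₑ * eLpNorm (fun x => u.toFun x i) (ENNReal.ofReal p)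
        volume) atTop (𝓝 0) := by
      have : Tendsto (fun n => ‖(c n)⁻¹ - 1‖ₑ) atTop (𝓝 0) := by
        have h : Tendsto (fun n => (c n)⁻¹ - 1) atTop (𝓝 0) := by
          simpa using (hct.inv₀ one_ne_zero).sub_const 1
        simpa using h.enorm
      simpa using ENNReal.Tendsto.mul_const this (Or.inr hf.2.ne)
    have s3 := s1.add s2
    rw [add_zero] at s3
    refine tendsto_of_tendsto_of_tendsto_of_le_of_le tendsto_const_nhds s3 (fun _ => zero_le)
      fun n => ?_
    have hfA : MemLp (fun x => u.toFun (c n • x + (1 - c n) • x₀) i) (ENNReal.ofReal p) volume :=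
      memLp_comp_affine (hc0 n) _ hf
    -- The error consists of the effect of the dilation and of the prefactor `c⁻¹`, which tends to
    -- 1.
    have e : (fun x => (u.toFun x - (v n).toFun x) i) =
        -((((fun x => u.toFun (c n • x + (1 - c n) • x₀) i)) - fun x => u.toFun x i) +
          ((c n)⁻¹ - 1) • fun x => u.toFun (c n • x + (1 - c n) • x₀) i) := by
      ext x
      simp only [v, rescale, PiLp.sub_apply, PiLp.smul_apply, smul_eq_mul, Pi.neg_apply, Pi.add_apply,
        Pi.sub_apply, Pi.smul_apply]
      ring
    simp only
    rw [e, eLpNorm_neg]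
    refine (eLpNorm_add_le (hfA.sub hf).1 (hfA.const_smul _).1 hq).trans (add_le_add le_rfl ?_)
    rw [eLpNorm_const_smul]
    exact mul_le_mul_right (eLpNorm_comp_affine_le hp (hc1 n).le _ fun x => u.toFun x i) _
  have t2 : Tendsto (fun n => eLpNorm (fun x => u.grad x - (v n).grad x) (ENNReal.ofReal p) volume)
      atTop (𝓝 0) := by
    refine tendsto_of_coord hq (fun k => u.memLp_grad'.1.sub (v k).memLp_grad'.1) fun ij => ?_
    refine (tendsto_eLpNorm_dilate hp x₀ (fun n => (hc1 n).le) hct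
      (u.memLp_grad'.eval_piLp ij)).congr fun n => ?_
    rw [← eLpNorm_neg]
    refine congrArg (fun f => eLpNorm f _ _) (funext fun x => ?_)
    simp [v, rescale]
  obtain ⟨n, h1, h2⟩ := ((ENNReal.tendsto_nhds_zero.1 t1 κ hκ).and
    (ENNReal.tendsto_nhds_zero.1 t2 κ hκ)).exists
  refine ⟨v n, r / c n, div_lt_self hr (hc1 n), ?_, h1, h2⟩
  have hqm : Measure.QuasiMeasurePreserving (fun x : E d => c n • x + (1 - c n) • x₀) volume volume :=
    ⟨by fun_prop, by
      rw [quasiMeasurePreserving_affine (hc0 n)]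
      exact Measure.smul_absolutelyContinuous⟩
  filter_upwards [hqm.ae h0] with x hx hxc
  have : u.toFun (c n • x + (1 - c n) • x₀) = 0 := by
    refine hx fun h => hxc fun i => ?_
    have h3 := h i
    have h4 : (c n • x + (1 - c n) • x₀) i - x₀ i = c n * (x i - x₀ i) := by
      simp only [PiLp.add_apply, PiLp.smul_apply, smul_eq_mul]; ring
    have hcp : 0 < c n := by linarith [hc1 n]
    rw [h4, abs_mul, abs_of_pos hcp] at h3
    rw [div_div, mul_comm (c n) 2, ← div_div, lt_div_iff₀ hcp, mul_comm]
    exact h3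
  simp [v, rescale, this]

/-- A Sobolev function on `ℝᵈ` which vanishes outside a cube is a limit in `W^{1,p}` of smooth
functions with compact support in the cube. -/
lemma exists_smooth_approx (hp : 1 < p) (u : Sobolev (univ : Set (E d)) p m) {x₀ : E d} {r : ℝ}
    (hr : 0 < r) (h0 : ∀ᵐ x, x ∉ cube x₀ r → u.toFun x = 0) {κ : ℝ≥0∞} (hκ : 0 < κ) :
    ∃ ψ : E d → E m, ContDiff ℝ ∞ ψ ∧ HasCompactSupport ψ ∧ tsupport ψ ⊆ cube x₀ r ∧
      eLpNorm (fun x => u.toFun x - ψ x) (ENNReal.ofReal p) volume ≤ κ ∧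
      eLpNorm (fun x => u.grad x - jacobian ψ x) (ENNReal.ofReal p) volume ≤ κ := by
  obtain ⟨v, r', hr', hv0, hv1, hv2⟩ := u.exists_dilate hp hr h0 (ENNReal.half_pos hκ.ne')
  obtain ⟨ψ, h1, h2, h3, h4, h5⟩ := v.exists_mollify hp hr' hv0 (ENNReal.half_pos hκ.ne')
  have hq := one_le_ofReal hp
  let ψs := Sobolev.ofContDiff h1 h2 univ p
  refine ⟨ψ, h1, h2, h3, ?_, ?_⟩
  · have := eLpNorm_add_le (u.memLp_toFun'.sub v.memLp_toFun').1
      (v.memLp_toFun'.sub ψs.memLp_toFun').1 hq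
    rw [sub_add_sub_cancel] at this
    exact this.trans ((add_le_add hv1 h4).trans (ENNReal.add_halves κ).le)
  · have := eLpNorm_add_le (u.memLp_grad'.sub v.memLp_grad').1
      (v.memLp_grad'.sub ψs.memLp_grad').1 hq
    rw [sub_add_sub_cancel] at this
    exact this.trans ((add_le_add hv2 h5).trans (ENNReal.add_halves κ).le)

end Sobolev

end Homogenization

/-! ### Poincaré inequalities for smooth functions -/

namespace Homogenization

variable {d m : ℕ} {Ω : Set (E d)} {p : ℝ}

lemma norm_mulVec_le (ξ : Mat m d) (y : E d) : ‖ξ.mulVec y‖ ≤ ‖ξ‖ * ‖y‖ := by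
  refine le_of_sq_le_sq ?_ (by positivity)
  rw [EuclideanSpace.norm_sq_eq, mul_pow, EuclideanSpace.norm_sq_eq, EuclideanSpace.norm_sq_eq,
    Fintype.sum_prod_type, Finset.sum_mul]
  refine Finset.sum_le_sum fun i _ => ?_
  simp only [Mat.mulVec, Real.norm_eq_abs, sq_abs]
  exact Finset.sum_mul_sq_le_sq_mul_sq _ _ _

lemma fderiv_apply_eq_mulVec {ψ : E d → E m} (hψ : ContDiff ℝ ∞ ψ) (x h : E d) :
    fderiv ℝ ψ x h = (jacobian ψ x).mulVec h := by
  ext i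
  have hd : DifferentiableAt ℝ ψ x := hψ.differentiable (by simp) x
  have e1 : ∀ h, fderiv ℝ (fun y => ψ y i) x h = fderiv ℝ ψ x h i := fun h => by
    have := ((EuclideanSpace.proj (𝕜 := ℝ) i : E m →L[ℝ] ℝ).hasFDerivAt.comp x hd.hasFDerivAt).fderiv
    have e : (fun y => ψ y i) = (EuclideanSpace.proj (𝕜 := ℝ) i : E m →L[ℝ] ℝ) ∘ ψ := rfl
    rw [e, this]
    rfl
  have e2 : h = ∑ j, h j • EuclideanSpace.single j (1 : ℝ) := by
    ext k
    simp [Finset.sum_apply, Pi.single_apply]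
  simp only [jacobian, Mat.mulVec, partialDeriv, e1]
  conv_lhs => rw [e2]
  rw [map_sum, WithLp.ofLp_sum, Finset.sum_apply]
  refine Finset.sum_congr rfl fun j _ => ?_
  rw [map_smul, PiLp.smul_apply, smul_eq_mul, mul_comm]

lemma continuous_jacobian {ψ : E d → E m} (hψ : ContDiff ℝ ∞ ψ) : Continuous (jacobian ψ) :=
  (PiLp.continuous_toLp 2 _).comp (continuous_pi fun ij =>
    continuous_partialDeriv ((contDiff_piLp 2).1 hψ ij.1) ij.2)

/-- The fundamental theorem of calculus on the segment from `y` to `y + h`, followed by Jensen's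
inequality on the unit interval. -/
lemma enorm_sub_rpow_le (hp : 1 ≤ p) {ψ : E d → E m} (hψ : ContDiff ℝ ∞ ψ) (y h : E d) :
    ‖ψ (y + h) - ψ y‖ₑ ^ p ≤ ‖h‖ₑ ^ p * ∫⁻ t in Ioc (0 : ℝ) 1, ‖jacobian ψ (y + t • h)‖ₑ ^ p := by
  have hp0 : 0 ≤ p := by linarith
  have hcont : Continuous fun t : ℝ => fderiv ℝ ψ (y + t • h) h :=
    ((hψ.continuous_fderiv (by simp)).comp (by fun_prop)).clm_apply continuous_const
  have hmeas : Measurable fun t : ℝ => ‖jacobian ψ (y + t • h)‖ₑ :=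
    ((continuous_jacobian hψ).comp (by fun_prop)).measurable.enorm
  have hd : ∀ t ∈ uIcc (0 : ℝ) 1, HasDerivAt (fun t : ℝ => ψ (y + t • h))
      (fderiv ℝ ψ (y + t • h) h) t := by
    intro t _
    have h1 : HasDerivAt (fun t : ℝ => y + t • h) h t := by
      simpa using ((hasDerivAt_id t).smul_const h).const_add y
    exact (hψ.differentiable (by simp) (y + t • h)).hasFDerivAt.comp_hasDerivAt t h1
  have hint := intervalIntegral.integral_eq_sub_of_hasDerivAt hd (hcont.intervalIntegrable 0 1)
  simp only [one_smul, zero_smul, add_zero] at hint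
  rw [← hint, intervalIntegral.integral_of_le zero_le_one]
  have : IsProbabilityMeasure (volume.restrict (Ioc (0 : ℝ) 1)) := ⟨by simp⟩
  have h2 : ‖∫ t in Ioc (0 : ℝ) 1, fderiv ℝ ψ (y + t • h) h‖ₑ ≤
      ‖h‖ₑ * ∫⁻ t in Ioc (0 : ℝ) 1, ‖jacobian ψ (y + t • h)‖ₑ := by
    refine (enorm_integral_le_lintegral_enorm _).trans ?_
    rw [← lintegral_const_mul _ hmeas]
    refine lintegral_mono fun t => ?_
    rw [fderiv_apply_eq_mulVec hψ, mul_comm, ← ofReal_norm, ← ofReal_norm, ← ofReal_norm,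
      ← ENNReal.ofReal_mul (norm_nonneg _)]
    exact ENNReal.ofReal_le_ofReal (norm_mulVec_le _ _)
  refine (ENNReal.rpow_le_rpow h2 hp0).trans ?_
  rw [ENNReal.mul_rpow_of_nonneg _ _ hp0]
  exact mul_le_mul_right (rpow_lintegral_le _ hmeas hp) _

/-- Poincaré's inequality for smooth functions with support in a cube. -/
lemma lintegral_rpow_le_of_tsupport_subset_cube (hp : 1 ≤ p) (i₀ : Fin d) {ψ : E d → E m}
    (hψ : ContDiff ℝ ∞ ψ) {x : E d} {r : ℝ} (hs : tsupport ψ ⊆ cube x r) (hr : 0 < r) :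
    ∫⁻ y, ‖ψ y‖ₑ ^ p ≤ ENNReal.ofReal r ^ p * ∫⁻ y, ‖jacobian ψ y‖ₑ ^ p := by
  -- A translation by the side length in one coordinate direction moves every point of the open cube
  -- out of it. There `ψ` vanishes, so `ψ y` is minus the increment along `h`.
  set h : E d := r • EuclideanSpace.single i₀ 1 with hh
  have hnorm : ‖h‖ₑ = ENNReal.ofReal r := by
    rw [← ofReal_norm, hh, norm_smul, Real.norm_of_nonneg hr.le]
    simp
  have hz : ∀ y, y ∉ cube x r → ψ y = 0 := fun y hy =>
    image_eq_zero_of_notMem_tsupport fun h => hy (hs h)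
  have hpt : ∀ y, ‖ψ y‖ₑ ^ p ≤
      ENNReal.ofReal r ^ p * ∫⁻ t in Ioc (0 : ℝ) 1, ‖jacobian ψ (y + t • h)‖ₑ ^ p := by
    intro y
    by_cases hy : y ∈ cube x r
    · have h1 := enorm_sub_rpow_le hp hψ y h
      rw [hz (y + h), zero_sub, enorm_neg, hnorm] at h1
      · exact h1
      · intro hc
        have h2 := abs_lt.1 (hy i₀)
        have h3 := abs_lt.1 (hc i₀)
        simp [hh] at h3
        linarith
    · rw [hz y hy, enorm_zero, ENNReal.zero_rpow_of_pos (by linarith)]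
      exact zero_le
  refine (lintegral_mono hpt).trans ?_
  have hm : Measurable fun q : E d × ℝ => ‖jacobian ψ (q.1 + q.2 • h)‖ₑ ^ p :=
    (((continuous_jacobian hψ).comp (by fun_prop)).measurable.enorm).pow_const p
  rw [lintegral_const_mul _ hm.lintegral_prod_right', lintegral_lintegral_swap hm.aemeasurable]
  refine mul_le_mul_right (le_of_eq ?_) _
  have : ∀ t : ℝ, ∫⁻ y, ‖jacobian ψ (y + t • h)‖ₑ ^ p = ∫⁻ y, ‖jacobian ψ y‖ₑ ^ p := fun t =>
    lintegral_add_right_eq_self (fun y => ‖jacobian ψ y‖ₑ ^ p) _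
  simp [this]

/-- The contraction towards `z` maps the convex cube into itself, and its Jacobian `t ^ d` is at
least `2 ^ (-d)`. -/
lemma lintegral_cube_segment_le {G : E d → ℝ≥0∞} {x z : E d} {r : ℝ} (hz : z ∈ cube x r)
    {t : ℝ} (ht : 1 / 2 ≤ t) (ht1 : t ≤ 1) :
    ∫⁻ y in cube x r, G (t • y + (1 - t) • z) ≤ 2 ^ d * ∫⁻ y in cube x r, G y := by
  have h1 : ∫⁻ y in cube x r, G (t • y + (1 - t) • z) ≤
      ∫⁻ y, (cube x r).indicator G (t • y + (1 - t) • z) := by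
    rw [← lintegral_indicator (measurableSet_cube x r)]
    refine lintegral_mono fun y => ?_
    by_cases hy : y ∈ cube x r
    · rw [indicator_of_mem hy, indicator_of_mem]
      exact convex_cube x r hy hz (by linarith) (by linarith) (by ring)
    · rw [indicator_of_notMem hy]; exact zero_le
  refine h1.trans ?_
  rw [Sobolev.lintegral_comp_affine (by linarith), lintegral_indicator (measurableSet_cube x r)]
  refine mul_le_mul_left ?_ _
  rw [abs_of_nonneg (by positivity)]
  have : (t ^ d)⁻¹ ≤ 2 ^ d := by
    rw [← inv_pow]
    refine pow_le_pow_left₀ (by positivity) ?_ d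
    rw [inv_le_comm₀ (by linarith) (by norm_num)]
    linarith
  refine (ENNReal.ofReal_le_ofReal this).trans (le_of_eq ?_)
  rw [ENNReal.ofReal_pow (by norm_num)]
  norm_num

/-- Poincaré's inequality on a cube for smooth functions. -/
lemma exists_lintegral_sub_const_le (hp : 1 ≤ p) {ψ : E d → E m} (hψ : ContDiff ℝ ∞ ψ) (x : E d)
    {r : ℝ} (hr : 0 < r) : ∃ c : E m, ∫⁻ y in cube x r, ‖ψ y - c‖ₑ ^ p ≤
      2 ^ d * ENNReal.ofReal (√d * (2 * r)) ^ p * ∫⁻ y in cube x r, ‖jacobian ψ y‖ₑ ^ p := by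
  have hp0 : 0 ≤ p := by linarith
  set Q := cube x r with hQ
  set D := ENNReal.ofReal (√d * (2 * r)) ^ p
  let G : E d → ℝ≥0∞ := fun y => ‖jacobian ψ y‖ₑ ^ p
  have hG : Measurable G := ((continuous_jacobian hψ).measurable.enorm).pow_const p
  have hpt : ∀ z ∈ Q, ∀ y ∈ Q, ‖ψ y - ψ z‖ₑ ^ p ≤
      D * ∫⁻ t in Ioc (0 : ℝ) 1, G (t • y + (1 - t) • z) := by
    intro z hz y hy
    have h1 := enorm_sub_rpow_le hp hψ z (y - z)
    rw [add_sub_cancel] at h1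
    refine h1.trans (mul_le_mul' (ENNReal.rpow_le_rpow ?_ hp0) (le_of_eq ?_))
    · rw [← ofReal_norm]
      refine ENNReal.ofReal_le_ofReal (norm_sub_le_of_mem_closedCube (by linarith) fun i => ?_)
      have h2 := abs_lt.1 (hy i)
      have h3 := abs_lt.1 (hz i)
      rw [abs_le]
      constructor <;> linarith
    · refine lintegral_congr fun t => ?_
      have : z + t • (y - z) = t • y + (1 - t) • z := by
        rw [smul_sub, sub_smul, one_smul]; abel
      rw [this]
  have htot : ∫⁻ z in Q, ∫⁻ y in Q, ∫⁻ t in Ioc (0 : ℝ) 1, G (t • y + (1 - t) • z) ≤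
      volume Q * (2 ^ d * ∫⁻ y in Q, G y) := by
    have e1 : ∀ z, ∫⁻ y in Q, ∫⁻ t in Ioc (0 : ℝ) 1, G (t • y + (1 - t) • z) =
        ∫⁻ t in Ioc (0 : ℝ) 1, ∫⁻ y in Q, G (t • y + (1 - t) • z) := fun z => by
      have hm1 : Measurable fun q : E d × ℝ => G (q.2 • q.1 + (1 - q.2) • z) :=
        hG.comp (by fun_prop)
      exact lintegral_lintegral_swap hm1.aemeasurable
    simp only [e1]
    have hm2 : Measurable fun q : E d × ℝ => ∫⁻ y in Q, G (q.2 • y + (1 - q.2) • q.1) := by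
      have : Measurable fun w : (E d × ℝ) × E d => G (w.1.2 • w.2 + (1 - w.1.2) • w.1.1) :=
        hG.comp (by fun_prop)
      exact this.lintegral_prod_right'
    rw [lintegral_lintegral_swap hm2.aemeasurable]
    have e2 : ∀ t ∈ Ioc (0 : ℝ) 1, ∫⁻ z in Q, ∫⁻ y in Q, G (t • y + (1 - t) • z) ≤
        volume Q * (2 ^ d * ∫⁻ y in Q, G y) := by
      intro t ht
      have e3 : ∫⁻ _z in Q, (2 ^ d * ∫⁻ y in Q, G y) = volume Q * (2 ^ d * ∫⁻ y in Q, G y) := by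
        rw [setLIntegral_const, mul_comm]
      -- For `t ≤ 1 / 2` the change of variables in `y` degenerates, and it is made in `z` instead,
      -- whose coefficient `1 - t` is then at least one half.
      rcases le_total (1 / 2) t with h | h
      · rw [← e3]
        exact setLIntegral_mono' (measurableSet_cube x r) fun z hz =>
          lintegral_cube_segment_le hz h ht.2
      · have hm1 : Measurable fun q : E d × E d => G (t • q.2 + (1 - t) • q.1) :=
          hG.comp (by fun_prop)
        rw [lintegral_lintegral_swap hm1.aemeasurable, ← e3]
        refine setLIntegral_mono' (measurableSet_cube x r) fun y hy => ?_
        have := lintegral_cube_segment_le (G := G) hy (t := 1 - t) (by linarith) (by linarith [ht.1])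
        simpa only [sub_sub_cancel, add_comm] using this
    refine (setLIntegral_mono' measurableSet_Ioc e2).trans ?_
    simp
  have hQ0 : volume Q ≠ 0 := by rw [hQ, volume_cube x hr]; exact ofReal_pow_ne_zero hr
  have hQt : volume Q ≠ ⊤ := by rw [hQ, volume_cube x hr]; exact ofReal_pow_ne_top
  have hmf : Measurable fun z => ∫⁻ y in Q, ‖ψ y - ψ z‖ₑ ^ p := by
    have : Measurable fun w : E d × E d => ‖ψ w.2 - ψ w.1‖ₑ ^ p :=
      (Continuous.measurable (by have := hψ.continuous; fun_prop) : Measurable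
        fun w : E d × E d => ψ w.2 - ψ w.1).enorm.pow_const p
    exact this.lintegral_prod_right'
  -- The constant is a value `ψ z` at a point where the inner integral does not exceed its average
  -- over the cube.
  obtain ⟨z, hz, hle⟩ := exists_le_setLAverage hQ0 hQt hmf.aemeasurable
  refine ⟨ψ z, hle.trans ?_⟩
  rw [setLAverage_eq]
  refine ENNReal.div_le_of_le_mul ?_
  have hDt : D ≠ ⊤ := ENNReal.rpow_ne_top_of_nonneg hp0 ENNReal.ofReal_ne_top
  calc ∫⁻ z in Q, ∫⁻ y in Q, ‖ψ y - ψ z‖ₑ ^ p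
      ≤ ∫⁻ z in Q, ∫⁻ y in Q, D * ∫⁻ t in Ioc (0 : ℝ) 1, G (t • y + (1 - t) • z) :=
        setLIntegral_mono' (measurableSet_cube x r) fun z hz =>
          setLIntegral_mono' (measurableSet_cube x r) fun y hy => hpt z hz y hy
    _ = D * ∫⁻ z in Q, ∫⁻ y in Q, ∫⁻ t in Ioc (0 : ℝ) 1, G (t • y + (1 - t) • z) := by
        simp only [lintegral_const_mul' _ _ hDt]
    _ ≤ D * (volume Q * (2 ^ d * ∫⁻ y in Q, G y)) := mul_le_mul_right htot _
    _ = _ := by ring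

end Homogenization

/-! ### Poincaré inequalities for Sobolev functions -/

namespace Homogenization

variable {d m : ℕ} {Ω : Set (E d)} {p : ℝ}

lemma setLIntegral_eq_of_ae_eq_zero {A : Set (E d)} (hA : MeasurableSet A) {F : E d → ℝ≥0∞}
    (h : ∀ᵐ y, y ∉ A → F y = 0) : ∫⁻ y in A, F y = ∫⁻ y, F y := by
  rw [← lintegral_indicator hA]
  refine lintegral_congr_ae (h.mono fun y hy => ?_)
  by_cases hyA : y ∈ A
  · simp [hyA]
  · simp [hyA, hy hyA]

lemma lintegral_rpow_le_of_sub {F : Type*} [NormedAddCommGroup F] (hp : 0 ≤ p) {μ : Measure (E d)}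
    {f g : E d → F} (hf : AEStronglyMeasurable f μ) (hg : AEStronglyMeasurable g μ) :
    ∫⁻ y, ‖f y‖ₑ ^ p ∂μ ≤ 2 ^ p * ((∫⁻ y, ‖f y - g y‖ₑ ^ p ∂μ) + ∫⁻ y, ‖g y‖ₑ ^ p ∂μ) := by
  have hm : AEMeasurable (fun y => ‖f y - g y‖ₑ ^ p) μ := (hf.sub hg).enorm.pow_const p
  rw [← lintegral_add_left' hm, ← lintegral_const_mul' _ _ (ENNReal.rpow_ne_top_of_nonneg hp (by simp))]
  refine lintegral_mono fun y => ?_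
  refine le_trans (ENNReal.rpow_le_rpow ?_ hp) (ennreal_add_rpow_le hp _ _)
  calc ‖f y‖ₑ = ‖(f y - g y) + g y‖ₑ := by rw [sub_add_cancel]
    _ ≤ _ := enorm_add_le _ _

namespace Sobolev

lemma exists_smooth_approx_lintegral (hp : 1 < p) (u : Sobolev (univ : Set (E d)) p m) {x₀ : E d}
    {r : ℝ} (hr : 0 < r) (h0 : ∀ᵐ x, x ∉ cube x₀ r → u.toFun x = 0) {κ : ℝ≥0∞} (hκ : κ ≠ 0) :
    ∃ ψ : E d → E m, ContDiff ℝ ∞ ψ ∧ HasCompactSupport ψ ∧ tsupport ψ ⊆ cube x₀ r ∧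
      ∫⁻ x, ‖u.toFun x - ψ x‖ₑ ^ p ≤ κ ∧ ∫⁻ x, ‖u.grad x - jacobian ψ x‖ₑ ^ p ≤ κ := by
  have hp0 : 0 < p := by linarith
  have hκ' : 0 < κ ^ (1 / p) := by
    rcases eq_or_ne κ ⊤ with rfl | h
    · rw [ENNReal.top_rpow_of_pos (by positivity)]; exact ENNReal.zero_lt_top
    · exact ENNReal.rpow_pos (pos_iff_ne_zero.2 hκ) h
  obtain ⟨ψ, h1, h2, h3, h4, h5⟩ := u.exists_smooth_approx hp hr h0 hκ'
  refine ⟨ψ, h1, h2, h3, ?_, ?_⟩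
  · rw [eLpNorm_eq_rpow hp] at h4
    exact (ENNReal.rpow_le_rpow_iff (by positivity)).1 h4
  · rw [eLpNorm_eq_rpow hp] at h5
    exact (ENNReal.rpow_le_rpow_iff (by positivity)).1 h5

/-- Extension by zero of a Sobolev function which vanishes outside a cube. -/
lemma exists_extend (hp : 1 < p) (hΩ : IsOpen Ω) (z : Sobolev Ω p m) {x : E d} {r : ℝ} (hr : 0 < r)
    (hcc : closedCube x r ⊆ Ω) (hz : ∀ᵐ y ∂volume.restrict (Ω \ cube x r), z.toFun y = 0) :
    ∃ U : Sobolev (univ : Set (E d)) p m, (∀ᵐ y, y ∉ cube x r → U.toFun y = 0) ∧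
      (∀ᵐ y, y ∉ cube x r → U.grad y = 0) ∧
      ∀ y ∈ cube x r, U.toFun y = z.toFun y ∧ U.grad y = z.grad y := by
  have h1 : ∀ᵐ y ∂volume.restrict (Ω \ closedCube x r), z.toFun y = 0 :=
    ae_restrict_of_ae_restrict_of_subset
      (sdiff_subset_sdiff_right (cube_subset_closedCube x r)) hz
  have ho : IsOpen (Ω \ closedCube x r) := hΩ.sdiff (isClosed_closedCube x r)
  have h2 := z.grad_ae_eq_zero hp ho sdiff_subset h1
  have hn : ∀ᵐ y, y ∉ closedCube x r \ cube x r := by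
    exact measure_eq_zero_iff_ae_notMem.1 (volume_closedCube_diff_cube x hr)
  refine ⟨z.extend hp hΩ (isCompact_closedCube x r) hcc h1, ?_, ?_, fun y hy => ?_⟩
  · rw [ae_restrict_iff' (hΩ.measurableSet.diff (measurableSet_cube x r))] at hz
    filter_upwards [hz] with y hy hyc
    by_cases hyΩ : y ∈ Ω
    · simp [extend, hyΩ, hy ⟨hyΩ, hyc⟩]
    · simp [extend, hyΩ]
  · rw [ae_restrict_iff' ho.measurableSet] at h2
    filter_upwards [h2, hn] with y hy hyn hyc
    by_cases hyΩ : y ∈ Ω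
    · simp [extend, hyΩ, hy ⟨hyΩ, fun h => hyn ⟨h, hyc⟩⟩]
    · simp [extend, hyΩ]
  · have hyΩ : y ∈ Ω := hcc (cube_subset_closedCube x r hy)
    simp [extend, hyΩ]

/-- Poincaré's inequality for Sobolev functions which vanish outside a cube. -/
lemma lintegral_rpow_le_of_zero (hd : 1 ≤ d) (hp : 1 < p) (hΩ : IsOpen Ω) (z : Sobolev Ω p m)
    {x : E d} {r : ℝ} (hr : 0 < r) (hcc : closedCube x r ⊆ Ω)
    (hz : ∀ᵐ y ∂volume.restrict (Ω \ cube x r), z.toFun y = 0) :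
    ∫⁻ y in cube x r, ‖z.toFun y‖ₑ ^ p ≤
      2 ^ p * 2 ^ p * ENNReal.ofReal r ^ p * ∫⁻ y in cube x r, ‖z.grad y‖ₑ ^ p := by
  have hp0 : 0 < p := by linarith
  obtain ⟨U, hU0, hU1, hUz⟩ := z.exists_extend hp hΩ hr hcc hz
  have e1 : ∫⁻ y in cube x r, ‖z.toFun y‖ₑ ^ p = ∫⁻ y, ‖U.toFun y‖ₑ ^ p := by
    rw [← setLIntegral_eq_of_ae_eq_zero (measurableSet_cube x r) (F := fun y => ‖U.toFun y‖ₑ ^ p)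
      (hU0.mono fun y hy h => by simp [hy h, hp0])]
    exact setLIntegral_congr_fun (measurableSet_cube x r) fun y hy => by simp only [(hUz y hy).1]
  have e2 : ∫⁻ y in cube x r, ‖z.grad y‖ₑ ^ p = ∫⁻ y, ‖U.grad y‖ₑ ^ p := by
    rw [← setLIntegral_eq_of_ae_eq_zero (measurableSet_cube x r) (F := fun y => ‖U.grad y‖ₑ ^ p)
      (hU1.mono fun y hy h => by simp [hy h, hp0])]
    exact setLIntegral_congr_fun (measurableSet_cube x r) fun y hy => by simp only [(hUz y hy).2]
  rw [e1, e2]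
  set R := ENNReal.ofReal r ^ p
  have hRt : R ≠ ⊤ := ENNReal.rpow_ne_top_of_nonneg hp0.le ENNReal.ofReal_ne_top
  have h2t : (2 : ℝ≥0∞) ^ p ≠ ⊤ := ENNReal.rpow_ne_top_of_nonneg hp0.le (by simp)
  -- Passing from `U` to a smooth `ψ` and back for the gradient costs a factor `2 ^ p` each time and
  -- an error proportional to `κ`, which is then sent to zero.
  have key : ∀ κ : ℝ≥0∞, κ ≠ 0 → ∫⁻ y, ‖U.toFun y‖ₑ ^ p ≤
      2 ^ p * 2 ^ p * R * (∫⁻ y, ‖U.grad y‖ₑ ^ p) + 2 ^ p * (1 + R * 2 ^ p) * κ := by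
    intro κ hκ
    obtain ⟨ψ, h1, h2, h3, h4, h5⟩ := U.exists_smooth_approx_lintegral hp hr hU0 hκ
    have f1 := lintegral_rpow_le_of_sub hp0.le U.memLp_toFun'.1
      (h1.continuous.aestronglyMeasurable (μ := volume))
    have f2 := lintegral_rpow_le_of_sub hp0.le
      ((continuous_jacobian h1).aestronglyMeasurable (μ := volume)) U.memLp_grad'.1
    have f3 := lintegral_rpow_le_of_tsupport_subset_cube hp.le ⟨0, hd⟩ h1 h3 hr
    have f4 : ∫⁻ y, ‖jacobian ψ y - U.grad y‖ₑ ^ p ≤ κ := by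
      refine le_trans (le_of_eq (lintegral_congr fun y => ?_)) h5
      rw [← enorm_neg, neg_sub]
    calc ∫⁻ y, ‖U.toFun y‖ₑ ^ p ≤ 2 ^ p * (κ + R * (2 ^ p * (κ + ∫⁻ y, ‖U.grad y‖ₑ ^ p))) := by
          refine f1.trans ?_
          gcongr
          refine f3.trans ?_
          gcongr
          refine f2.trans ?_
          gcongr
      _ = _ := by ring
  set A := 2 ^ p * (1 + R * 2 ^ p)
  have hAt : A ≠ ⊤ := ENNReal.mul_ne_top h2t (ENNReal.add_ne_top.2
    ⟨by simp, ENNReal.mul_ne_top hRt h2t⟩)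
  have hlim : Tendsto (fun κ : ℝ≥0∞ => 2 ^ p * 2 ^ p * R * (∫⁻ y, ‖U.grad y‖ₑ ^ p) + A * κ) (𝓝[≠] 0)
      (𝓝 (2 ^ p * 2 ^ p * R * (∫⁻ y, ‖U.grad y‖ₑ ^ p) + A * 0)) :=
    (tendsto_const_nhds.add (ENNReal.Tendsto.const_mul tendsto_id (Or.inr hAt))).mono_left
      nhdsWithin_le_nhds
  rw [mul_zero, add_zero] at hlim
  exact ge_of_tendsto hlim (eventually_mem_nhdsWithin.mono fun κ hκ => key κ hκ)

/-- Poincaré's inequality on a cube, up to an arbitrarily small error. -/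
lemma exists_poincare (d m : ℕ) (hp : 1 < p) : ∃ C : ℝ≥0∞, C ≠ ⊤ ∧ ∀ (Ω : Set (E d))
    (_ : IsOpen Ω) (z : Sobolev Ω p m) (x : E d) (r : ℝ) (κ : ℝ≥0∞), 0 < r → closedCube x r ⊆ Ω →
    κ ≠ 0 → κ ≠ ⊤ → ∃ c : E m, ∫⁻ y in cube x r, ‖z.toFun y - c‖ₑ ^ p ≤
      C * (ENNReal.ofReal r ^ p * (∫⁻ y in cube x r, ‖z.grad y‖ₑ ^ p) + κ) := by
  have hp0 : 0 < p := by linarith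
  have h2t : (2 : ℝ≥0∞) ^ p ≠ ⊤ := ENNReal.rpow_ne_top_of_nonneg hp0.le (by simp)
  set M : ℝ≥0∞ := 2 ^ d * ENNReal.ofReal (√d * 2) ^ p
  have hMt : M ≠ ⊤ := ENNReal.mul_ne_top (by simp)
    (ENNReal.rpow_ne_top_of_nonneg hp0.le ENNReal.ofReal_ne_top)
  refine ⟨2 ^ p * 2 ^ p * (1 + M), ENNReal.mul_ne_top (ENNReal.mul_ne_top h2t h2t)
    (ENNReal.add_ne_top.2 ⟨by simp, hMt⟩), ?_⟩
  intro Ω hΩ z x r κ hr hcc hκ0 hκt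
  -- The function is cut off near the closed cube and extended by zero. The result `U` agrees with
  -- `z` on the cube and admits smooth approximations on the whole space.
  obtain ⟨χ, hχ, hχc, hχs, W, hW, hKW, hχ1⟩ := exists_cutoff (isCompact_closedCube x r) hΩ hcc
  have hz0 : ∀ᵐ y ∂volume.restrict (Ω \ tsupport χ), (z.mul hp hχ hχc).toFun y = 0 := by
    refine ae_restrict_of_forall_mem (hΩ.measurableSet.diff (isClosed_tsupport χ).measurableSet)
      fun y hy => ?_
    simp [mul, image_eq_zero_of_notMem_tsupport hy.2]
  set U := (z.mul hp hχ hχc).extend hp hΩ hχc hχs hz0 with hU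
  have hUz : ∀ y ∈ cube x r, U.toFun y = z.toFun y ∧ U.grad y = z.grad y := by
    intro y hy
    have hyc := cube_subset_closedCube x r hy
    have hyΩ := hcc hyc
    have h1 := hχ1 y (hKW hyc)
    have h2 : ∀ j, partialDeriv j χ y = 0 := fun j => by
      have : χ =ᶠ[𝓝 y] fun _ => 1 := by
        filter_upwards [hW.mem_nhds (hKW hyc)] with t ht using hχ1 t ht
      rw [partialDeriv, this.fderiv_eq]
      simp
    refine ⟨by simp [hU, extend, mul, hyΩ, h1], ?_⟩
    ext ij
    simp [hU, extend, mul, hyΩ, h1, h2]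
  obtain ⟨R, hR0, hR⟩ : ∃ R > 0, tsupport χ ⊆ cube x R := by
    obtain ⟨R, hR⟩ := hχc.isBounded.subset_ball x
    refine ⟨2 * max R 1, by positivity, fun y hy i => ?_⟩
    have h1 := dist_apply_le y x i
    have h2 : dist y x < R := hR hy
    have h3 := le_max_left R 1
    linarith
  have hU0 : ∀ᵐ y, y ∉ cube x R → U.toFun y = 0 := ae_of_all _ fun y hy => by
    have : χ y = 0 := image_eq_zero_of_notMem_tsupport fun h => hy (hR h)
    by_cases hyΩ : y ∈ Ω <;> simp [hU, extend, mul, hyΩ, this]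
  set D := ENNReal.ofReal r ^ p
  have hDt : D ≠ ⊤ := ENNReal.rpow_ne_top_of_nonneg hp0.le ENNReal.ofReal_ne_top
  have hDM : 2 ^ d * ENNReal.ofReal (√d * (2 * r)) ^ p = M * D := by
    rw [← mul_assoc, ENNReal.ofReal_mul (by positivity), ENNReal.mul_rpow_of_nonneg _ _ hp0.le,
      mul_assoc]
  have h1D : 1 + D ≠ 0 := by simp
  have h1Dt : 1 + D ≠ ⊤ := ENNReal.add_ne_top.2 ⟨by simp, hDt⟩
  -- The tolerance is divided by `1 + D` because the error enters once through the functions and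
  -- once, weighted by `D`, through the gradients.
  obtain ⟨ψ, h1, h2, h3, h4, h5⟩ := U.exists_smooth_approx_lintegral hp hR0 hU0
    (κ := κ / (1 + D)) (ENNReal.div_ne_zero.2 ⟨hκ0, h1Dt⟩)
  obtain ⟨c, hc⟩ := exists_lintegral_sub_const_le hp.le h1 x hr
  refine ⟨c, ?_⟩
  set κ' := κ / (1 + D)
  have hκ' : (1 + D) * κ' = κ := ENNReal.mul_div_cancel h1D h1Dt
  set Q := cube x r
  set G := ∫⁻ y in Q, ‖z.grad y‖ₑ ^ p
  have e1 : ∫⁻ y in Q, ‖z.toFun y - c‖ₑ ^ p = ∫⁻ y in Q, ‖U.toFun y - c‖ₑ ^ p :=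
    setLIntegral_congr_fun (measurableSet_cube x r) fun y hy => by simp only [(hUz y hy).1]
  have e2 : ∫⁻ y in Q, ‖U.grad y‖ₑ ^ p = G :=
    setLIntegral_congr_fun (measurableSet_cube x r) fun y hy => by simp only [(hUz y hy).2]
  have f1 := lintegral_rpow_le_of_sub hp0.le (μ := volume.restrict Q)
    (f := fun y => U.toFun y - c) (g := fun y => ψ y - c)
    (U.memLp_toFun'.1.restrict.sub aestronglyMeasurable_const)
    (h1.continuous.aestronglyMeasurable.sub aestronglyMeasurable_const)
  simp only [sub_sub_sub_cancel_right] at f1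
  have f2 := lintegral_rpow_le_of_sub hp0.le (μ := volume.restrict Q)
    (continuous_jacobian h1).aestronglyMeasurable U.memLp_grad'.1.restrict
  have f3 : ∫⁻ y in Q, ‖jacobian ψ y - U.grad y‖ₑ ^ p ≤ κ' := by
    refine (setLIntegral_le_lintegral _ _).trans (le_trans (le_of_eq (lintegral_congr fun y => ?_)) h5)
    rw [← enorm_neg, neg_sub]
  have f4 : ∫⁻ y in Q, ‖U.toFun y - ψ y‖ₑ ^ p ≤ κ' := (setLIntegral_le_lintegral _ _).trans h4
  rw [hDM] at hc
  have h21 : (1 : ℝ≥0∞) ≤ 2 ^ p := ENNReal.one_le_rpow (by norm_num) hp0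
  calc ∫⁻ y in Q, ‖z.toFun y - c‖ₑ ^ p
      ≤ 2 ^ p * (κ' + M * D * (2 ^ p * (κ' + G))) := by
        rw [e1]
        refine f1.trans ?_
        gcongr
        refine hc.trans ?_
        gcongr
        refine f2.trans ?_
        rw [e2]
        gcongr
    _ ≤ 2 ^ p * (2 ^ p * κ' + M * D * (2 ^ p * (κ' + G))) := by
        gcongr
        exact le_mul_of_one_le_left zero_le h21
    _ = 2 ^ p * 2 ^ p * (M * (D * G) + (1 * κ' + M * (D * κ'))) := by ring
    _ ≤ 2 ^ p * 2 ^ p * ((1 + M) * (D * G) + ((1 + M) * κ' + (1 + M) * (D * κ'))) := by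
        gcongr
        · exact le_add_self
        · exact le_self_add
        · exact le_add_self
    _ = 2 ^ p * 2 ^ p * (1 + M) * (D * G + (1 + D) * κ') := by ring
    _ = _ := by rw [hκ']

end Sobolev

end Homogenization

/-! ### Zero boundary values and rescaling to cell problems -/

namespace Homogenization

variable {d m : ℕ} {Ω : Set (E d)} {p : ℝ} {L : E d → Mat m d → ℝ≥0} {ε : ℝ}

namespace Sobolev

/-- Extension by zero of a Sobolev function with zero boundary values. -/
lemma IsZeroBoundary.exists_extension (hp : 1 < p) {O : Set (E d)} (hO : MeasurableSet O)
    {φ : Sobolev O p m} (h : φ.IsZeroBoundary) : ∃ Φ : Sobolev (univ : Set (E d)) p m,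
      (∀ y ∈ O, Φ.toFun y = φ.toFun y ∧ Φ.grad y = φ.grad y) ∧ ∀ y, y ∉ O → Φ.toFun y = 0 := by
  obtain ⟨ψ, hψ, h1, h2⟩ := h
  have hq := one_le_ofReal hp
  have hz : ∀ n y, y ∉ O → ψ n y = 0 := fun n y hy =>
    image_eq_zero_of_notMem_tsupport fun h => hy ((hψ n).2.2 h)
  have hzd : ∀ n y, y ∉ O → jacobian (ψ n) y = 0 := fun n y hy => by
    ext ij
    have hs : tsupport (fun y => ψ n y ij.1) ⊆ tsupport (ψ n) :=
      tsupport_comp_subset (g := fun v : E m => v ij.1) rfl (ψ n)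
    have h0 := image_eq_zero_of_notMem_tsupport (f := partialDeriv ij.2 fun y => ψ n y ij.1) (x := y)
      fun h => hy ((hψ n).2.2 (hs (tsupport_partialDeriv_subset _ ij.2 h)))
    exact h0
  have mf : MemLp (O.indicator φ.toFun) (ENNReal.ofReal p) volume :=
    (memLp_indicator_iff_restrict hO).2 φ.memLp_toFun
  have mg : MemLp (O.indicator φ.grad) (ENNReal.ofReal p) volume :=
    (memLp_indicator_iff_restrict hO).2 φ.memLp_grad
  have key : ∀ {n : Type} [Fintype n] (f : E d → EuclideanSpace ℝ n) (F : ℕ → E d → EuclideanSpace ℝ n)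
      (i : n), (∀ k y, y ∉ O → F k y = 0) →
      Tendsto (fun k => eLpNorm (fun x => f x - F k x) (ENNReal.ofReal p) (volume.restrict O)) atTop (𝓝 0) →
      Tendsto (fun k => eLpNorm ((fun x => O.indicator f x i) - fun x => F k x i) (ENNReal.ofReal p)
        volume) atTop (𝓝 0) := by
    intro n _ f F i hF hf
    refine tendsto_of_tendsto_of_tendsto_of_le_of_le tendsto_const_nhds hf (fun _ => zero_le)
      fun k => ?_
    show eLpNorm ((fun x => O.indicator f x i) - fun x => F k x i) (ENNReal.ofReal p) volume ≤ _
    rw [← eLpNorm_restrict_eq_of_support_subset (s := O)]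
    · refine eLpNorm_mono_ae ((ae_restrict_mem hO).mono fun x hx => ?_)
      rw [Pi.sub_apply, indicator_of_mem hx, ← PiLp.sub_apply]
      exact PiLp.norm_apply_le (f x - F k x) i
    · intro x hx
      by_contra hxO
      exact hx (by simp [hxO, hF k x hxO])
  refine ⟨⟨O.indicator φ.toFun, O.indicator φ.grad, by simpa using mf, by simpa using mg,
    isWeakGradient_iff.2 fun i j => ?_⟩, fun y hy => ⟨indicator_of_mem hy _, indicator_of_mem hy _⟩,
    fun y hy => indicator_of_notMem hy _⟩
  have hc : ∀ n, ContDiff ℝ ∞ fun y => ψ n y i := fun n => (contDiff_piLp 2).1 (hψ n).1 i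
  -- The approximating functions are already smooth on the whole space and vanish outside `O`, so
  -- they converge to the extension by zero, and weak derivatives are closed under this convergence.
  refine IsWeakDeriv.of_tendsto hq (F := fun n y => ψ n y i) (G := fun n y => jacobian (ψ n) y (i, j))
    (fun n => IsWeakDeriv.of_contDiff (hc n) univ j)
    (fun n => (Sobolev.ofContDiff (hψ n).1 (hψ n).2.1 (univ : Set (E d)) p).memLp_coord i)
    (fun n => (Sobolev.ofContDiff (hψ n).1 (hψ n).2.1 (univ : Set (E d)) p).memLp_grad_coord (i, j))
    (by simpa using mf.eval_piLp i) (by simpa using mg.eval_piLp (i, j)) ?_ ?_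
  · simpa only [Measure.restrict_univ] using key φ.toFun ψ i hz h1
  · simpa only [Measure.restrict_univ] using key φ.grad (fun n => jacobian (ψ n)) (i, j) hzd h2

/-- The converse of `IsZeroBoundary.exists_extension` for cubes: functions on the whole space that
vanish outside the cube are exactly what is needed to rescale competitors. -/
lemma isZeroBoundary_restrict (hp : 1 < p) (u : Sobolev (univ : Set (E d)) p m) {x : E d} {r : ℝ}
    (hr : 0 < r) (h0 : ∀ᵐ y, y ∉ cube x r → u.toFun y = 0) :
    (u.restrict (subset_univ (cube x r))).IsZeroBoundary := by
  have hκ : ∀ n : ℕ, (0 : ℝ≥0∞) < (n + 1 : ℝ≥0∞)⁻¹ := fun n => by simp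
  choose ψ h1 h2 h3 h4 h5 using fun n : ℕ => u.exists_smooth_approx hp hr h0 (hκ n)
  have ht : Tendsto (fun n : ℕ => (n + 1 : ℝ≥0∞)⁻¹) atTop (𝓝 0) := by
    have := ENNReal.tendsto_inv_nat_nhds_zero.comp (tendsto_add_atTop_nat 1)
    simpa [Function.comp_def] using this
  exact ⟨ψ, fun n => ⟨h1 n, h2 n, h3 n⟩,
    tendsto_of_tendsto_of_tendsto_of_le_of_le tendsto_const_nhds ht (fun _ => zero_le) fun n =>
      (eLpNorm_mono_measure _ Measure.restrict_le_self).trans (h4 n),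
    tendsto_of_tendsto_of_tendsto_of_le_of_le tendsto_const_nhds ht (fun _ => zero_le) fun n =>
      (eLpNorm_mono_measure _ Measure.restrict_le_self).trans (h5 n)⟩

end Sobolev

lemma setLIntegral_comp_inv_smul (hε : 0 < ε) {A : Set (E d)} (hA : MeasurableSet A)
    (F : E d → ℝ≥0∞) :
    ∫⁻ y in A, F (ε⁻¹ • y) = ENNReal.ofReal ε ^ d * ∫⁻ y in ε⁻¹ • A, F y := by
  have hA' : MeasurableSet (ε⁻¹ • A) := hA.const_smul₀ _
  rw [← lintegral_indicator hA, ← lintegral_indicator hA']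
  have h := Sobolev.lintegral_comp_affine (inv_ne_zero hε.ne') (0 : E d) ((ε⁻¹ • A).indicator F)
  have e : ENNReal.ofReal |((ε⁻¹) ^ d)⁻¹| = ENNReal.ofReal ε ^ d := by
    rw [inv_pow, inv_inv, abs_of_pos (by positivity), ENNReal.ofReal_pow hε.le]
  rw [e] at h
  rw [← h]
  refine lintegral_congr fun y => ?_
  have hiff : ε⁻¹ • y ∈ ε⁻¹ • A ↔ y ∈ A := smul_mem_smul_set_iff₀ (inv_ne_zero hε.ne') _ _
  simp only [add_zero]
  by_cases hy : y ∈ A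
  · rw [indicator_of_mem hy, indicator_of_mem (hiff.2 hy)]
  · rw [indicator_of_notMem hy, indicator_of_notMem (fun h => hy (hiff.1 h))]

/-- The local Dirichlet infimum of an affine function is a rescaled cell problem. -/
lemma dirichletInf_affine_eq (hp : 1 < p) (hΩ : IsOpen Ω) (hΩb : Bornology.IsBounded Ω)
    (hε : 0 < ε) {x : E d} {ρ : ℝ} (hρ : 0 < ρ) (hcc : closedCube x ρ ⊆ Ω) (v : E m) (ξ : Mat m d) :
    dirichletInf Ω p L ε (fun y => v + ξ.mulVec (y - x)) (cube x ρ) =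
      ENNReal.ofReal ε ^ d * cellInf p L ξ (ε⁻¹ • cube x ρ) := by
  have hi : 0 < ε⁻¹ := inv_pos.2 hε
  have hQΩ : cube x ρ ⊆ Ω := (cube_subset_closedCube x ρ).trans hcc
  have hsc := smul_cube x ρ hi
  have hmem : ∀ y, ε⁻¹ • y ∈ ε⁻¹ • cube x ρ ↔ y ∈ cube x ρ := fun y =>
    smul_mem_smul_set_iff₀ hi.ne' _ _
  let A : Sobolev Ω p m := Sobolev.affine hΩ hΩb p v ξ x
  apply le_antisymm
  · have hne : ENNReal.ofReal ε ^ d ≠ 0 := ofReal_pow_ne_zero hε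
    unfold cellInf
    simp only [ENNReal.mul_iInf_of_ne hne ofReal_pow_ne_top]
    refine le_iInf fun φ => le_iInf fun hφ => ?_
    obtain ⟨Φ, h1, h2⟩ := hφ.exists_extension hp ((measurableSet_cube x ρ).const_smul₀ _)
    -- This is `y ↦ ε Φ(y / ε)`, with gradient `∇Φ(y / ε)`. Adding it to the affine function gives a
    -- competitor on the cube.
    let z : Sobolev Ω p m := (Φ.rescale hi.ne' 0).restrict (subset_univ Ω)
    refine (dirichletInf_le (A.add hp z) ?_).trans (le_of_eq ?_)
    · refine ae_restrict_of_forall_mem (hΩ.measurableSet.diff (measurableSet_cube x ρ)) fun y hy => ?_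
      have : Φ.toFun (ε⁻¹ • y) = 0 := h2 _ fun h => hy.2 ((hmem y).1 h)
      simp [Sobolev.add, A, Sobolev.affine, z, Sobolev.restrict, Sobolev.rescale, this]
    · rw [← setLIntegral_comp_inv_smul hε (measurableSet_cube x ρ)
        fun y => (L y (ξ + φ.grad y) : ℝ≥0∞)]
      refine setLIntegral_congr_fun (measurableSet_cube x ρ) fun y hy => ?_
      have := (h1 _ ((hmem y).2 hy)).2
      simp [Sobolev.add, A, Sobolev.affine, z, Sobolev.restrict, Sobolev.rescale, this]
  · unfold dirichletInf
    refine le_iInf fun w => le_iInf fun hw => ?_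
    -- Conversely, the difference between a competitor and the affine function extends by zero; this
    -- uses that the closed cube lies in `Ω`. Its rescaling `y ↦ ε⁻¹ U(ε y)` is admissible in the
    -- cell problem.
    obtain ⟨U, hU0, hU1, hUz⟩ := (w.sub hp A).exists_extend hp hΩ hρ hcc
      (hw.mono fun y hy => by simp [Sobolev.sub, hy, A, Sobolev.affine])
    have hU'0 : ∀ᵐ y, y ∉ cube (ε⁻¹ • x) (ε⁻¹ * ρ) → (U.rescale hε.ne' 0).toFun y = 0 := by
      have hqm : Measure.QuasiMeasurePreserving (fun y : E d => ε • y + 0) volume volume :=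
        ⟨by fun_prop, by
          rw [Sobolev.quasiMeasurePreserving_affine hε.ne']
          exact Measure.smul_absolutelyContinuous⟩
      filter_upwards [hqm.ae hU0] with y hy hyc
      rw [← hsc] at hyc
      have : U.toFun (ε • y + 0) = 0 := by
        refine hy fun h => hyc ?_
        rw [add_zero] at h
        rw [mem_smul_set_iff_inv_smul_mem₀ hi.ne', inv_inv]
        exact h
      simp only [Sobolev.rescale, this, smul_zero]
    have hzb := (U.rescale hε.ne' 0).isZeroBoundary_restrict hp (by positivity) hU'0
    have hle : cellInf p L ξ (ε⁻¹ • cube x ρ) ≤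
        ∫⁻ y in ε⁻¹ • cube x ρ, (L y (ξ + (U.rescale hε.ne' 0).grad y) : ℝ≥0∞) := by
      rw [hsc]
      exact iInf₂_le ((U.rescale hε.ne' 0).restrict (subset_univ _)) hzb
    refine (mul_le_mul_right hle _).trans (le_of_eq ?_)
    rw [← setLIntegral_comp_inv_smul hε (measurableSet_cube x ρ)]
    refine setLIntegral_congr_fun (measurableSet_cube x ρ) fun y hy => ?_
    have e1 : ε • ε⁻¹ • y = y := smul_inv_smul₀ hε.ne' y
    have e2 := (hUz y hy).2
    simp [Sobolev.rescale, e1, e2, Sobolev.sub, A, Sobolev.affine]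

end Homogenization

/-! ### Densities of Dirichlet infima and the homogenized integrand -/

namespace Homogenization

variable {d m : ℕ} {Ω : Set (E d)} {p : ℝ} {L : E d → Mat m d → ℝ≥0} {ε : ℝ}

lemma limsup_le_limsup_add {ι : Type*} {l : Filter ι} [l.NeBot] {f g h : ι → ℝ≥0∞} {e : ℝ≥0∞}
    (hfg : ∀ᶠ i in l, f i ≤ g i + h i) (hh : limsup h l ≤ e) : limsup f l ≤ limsup g l + e := by
  refine ENNReal.le_of_forall_pos_le_add fun δ hδ hlt => ?_
  have he : e < e + δ := ENNReal.lt_add_right (fun h => by simp [h] at hlt) (by simpa using hδ.ne')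
  have h1 : ∀ᶠ i in l, f i ≤ g i + (e + δ) := by
    filter_upwards [hfg, eventually_lt_of_limsup_lt (hh.trans_lt he)] with i h1 h2
    exact h1.trans (by gcongr)
  have h2 := (show Monotone fun a : ℝ≥0∞ => a + (e + δ) from fun a b h => by
    dsimp only; gcongr).map_limsup_of_continuousAt (F := l) g (by fun_prop)
  calc limsup f l ≤ limsup (fun i => g i + (e + δ)) l := limsup_le_limsup h1
    _ = limsup g l + (e + δ) := h2.symm
    _ = _ := by ring

lemma liminf_le_liminf_add {ι : Type*} {l : Filter ι} [l.NeBot] {f g h : ι → ℝ≥0∞} {e : ℝ≥0∞}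
    (hfg : ∀ᶠ i in l, f i ≤ g i + h i) (hh : limsup h l ≤ e) : liminf f l ≤ liminf g l + e := by
  refine ENNReal.le_of_forall_pos_le_add fun δ hδ hlt => ?_
  have he : e < e + δ := ENNReal.lt_add_right (fun h => by simp [h] at hlt) (by simpa using hδ.ne')
  have h1 : ∀ᶠ i in l, f i ≤ g i + (e + δ) := by
    filter_upwards [hfg, eventually_lt_of_limsup_lt (hh.trans_lt he)] with i h1 h2
    exact h1.trans (by gcongr)
  have h2 := (show Monotone fun a : ℝ≥0∞ => a + (e + δ) from fun a b h => by
    dsimp only; gcongr).map_liminf_of_continuousAt (F := l) g (by fun_prop)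
  calc liminf f l ≤ liminf (fun i => g i + (e + δ)) l := liminf_le_liminf h1
    _ = liminf g l + (e + δ) := h2.symm
    _ = _ := by ring

lemma map_mul_left_nhdsGT_zero {s : ℝ} (hs : 0 < s) :
    map (fun r => s * r) (𝓝[>] (0 : ℝ)) = 𝓝[>] 0 := by
  have h := (Homeomorph.mulLeft₀ s hs.ne').isEmbedding.map_nhdsWithin_eq (Ioi 0) 0
  have e : (Homeomorph.mulLeft₀ s hs.ne') '' Ioi 0 = Ioi 0 := by
    simpa using image_mul_left_Ioi hs (0 : ℝ)
  rw [e] at h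
  simpa using h

/-- The upper limit of the Dirichlet infima `m_ε(u;O)` as `ε → 0`. -/
noncomputable def upperInf (Ω : Set (E d)) (p : ℝ) (L : E d → Mat m d → ℝ≥0) (u : E d → E m)
    (O : Set (E d)) : ℝ≥0∞ :=
  limsup (fun ε : ℝ => dirichletInf Ω p L ε u O) (𝓝[>] 0)

/-- The lower limit of the Dirichlet infima `m_ε(u;O)` as `ε → 0`. -/
noncomputable def lowerInf (Ω : Set (E d)) (p : ℝ) (L : E d → Mat m d → ℝ≥0) (u : E d → E m)
    (O : Set (E d)) : ℝ≥0∞ :=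
  liminf (fun ε : ℝ => dirichletInf Ω p L ε u O) (𝓝[>] 0)

/-- The upper density on cubes of `O ↦ limsup_{ε→0} m_ε(u;O)`. -/
noncomputable def upperDensity (Ω : Set (E d)) (p : ℝ) (L : E d → Mat m d → ℝ≥0) (u : E d → E m)
    (x : E d) : ℝ≥0∞ :=
  limsup (fun r : ℝ => upperInf Ω p L u (cube x r) / ENNReal.ofReal r ^ d) (𝓝[>] 0)

/-- The lower density on cubes of `O ↦ liminf_{ε→0} m_ε(u;O)`. -/
noncomputable def lowerDensity (Ω : Set (E d)) (p : ℝ) (L : E d → Mat m d → ℝ≥0) (u : E d → E m)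
    (x : E d) : ℝ≥0∞ :=
  liminf (fun r : ℝ => lowerInf Ω p L u (cube x r) / ENNReal.ofReal r ^ d) (𝓝[>] 0)

lemma lowerInf_le_upperInf (u : E d → E m) (O : Set (E d)) :
    lowerInf Ω p L u O ≤ upperInf Ω p L u O :=
  liminf_le_limsup

lemma lowerDensity_le_upperDensity (u : E d → E m) (x : E d) :
    lowerDensity Ω p L u x ≤ upperDensity Ω p L u x :=
  (liminf_le_liminf (Eventually.of_forall fun r => by
    gcongr; exact lowerInf_le_upperInf u _)).trans liminf_le_limsup

lemma map_inv_nhdsGT_eq : map (fun t : ℝ => t⁻¹) (𝓝[>] (0 : ℝ)) = atTop :=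
  inv_nhdsGT_zero (𝕜 := ℝ)

/-- The Jacobian `ε ^ d` of the rescaling cancels against the volume of the dilated cube. -/
lemma cellInf_div_volume_eq (hp : 1 < p) (hΩ : IsOpen Ω) (hΩb : Bornology.IsBounded Ω)
    (hε : 0 < ε) {x : E d} {ρ : ℝ} (hρ : 0 < ρ) (hcc : closedCube x ρ ⊆ Ω) (v : E m) (ξ : Mat m d) :
    cellInf p L ξ (ε⁻¹ • cube x ρ) / volume (ε⁻¹ • cube x ρ) =
      dirichletInf Ω p L ε (fun y => v + ξ.mulVec (y - x)) (cube x ρ) / ENNReal.ofReal ρ ^ d := by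
  have hi : 0 < ε⁻¹ := inv_pos.2 hε
  have hv : volume (ε⁻¹ • cube x ρ) = (ENNReal.ofReal ε ^ d)⁻¹ * ENNReal.ofReal ρ ^ d := by
    rw [smul_cube x ρ hi, volume_cube _ (by positivity), ENNReal.ofReal_mul hi.le, mul_pow,
      ENNReal.ofReal_inv_of_pos hε, ENNReal.inv_pow]
  rw [dirichletInf_affine_eq hp hΩ hΩb hε hρ hcc, hv, div_eq_mul_inv, div_eq_mul_inv,
    ENNReal.mul_inv (Or.inr ofReal_pow_ne_top) (Or.inr (ofReal_pow_ne_zero hρ)), inv_inv]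
  ring

lemma limsup_cellInf_eq (hp : 1 < p) (hΩ : IsOpen Ω) (hΩb : Bornology.IsBounded Ω)
    {x : E d} {ρ : ℝ} (hρ : 0 < ρ) (hcc : closedCube x ρ ⊆ Ω) (v : E m) (ξ : Mat m d) :
    limsup (fun t : ℝ => cellInf p L ξ (t • cube x ρ) / volume (t • cube x ρ)) atTop =
      upperInf Ω p L (fun y => v + ξ.mulVec (y - x)) (cube x ρ) / ENNReal.ofReal ρ ^ d := by
  rw [← map_inv_nhdsGT_eq, limsup, map_map, ← limsup, upperInf, ENNReal.div_eq_inv_mul,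
    ← ENNReal.limsup_const_mul_of_ne_top (ENNReal.inv_ne_top.2 (ofReal_pow_ne_zero hρ))]
  refine limsup_congr (eventually_mem_nhdsWithin.mono fun ε hε => ?_)
  rw [← ENNReal.div_eq_inv_mul]
  exact cellInf_div_volume_eq hp hΩ hΩb hε hρ hcc v ξ

lemma liminf_cellInf_eq (hp : 1 < p) (hΩ : IsOpen Ω) (hΩb : Bornology.IsBounded Ω)
    {x : E d} {ρ : ℝ} (hρ : 0 < ρ) (hcc : closedCube x ρ ⊆ Ω) (v : E m) (ξ : Mat m d) :
    liminf (fun t : ℝ => cellInf p L ξ (t • cube x ρ) / volume (t • cube x ρ)) atTop =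
      lowerInf Ω p L (fun y => v + ξ.mulVec (y - x)) (cube x ρ) / ENNReal.ofReal ρ ^ d := by
  rw [← map_inv_nhdsGT_eq, liminf, map_map, ← liminf, lowerInf, ENNReal.div_eq_inv_mul,
    ← ENNReal.liminf_const_mul_of_ne_top (ENNReal.inv_ne_top.2 (ofReal_pow_ne_zero hρ))]
  refine liminf_congr (eventually_mem_nhdsWithin.mono fun ε hε => ?_)
  rw [← ENNReal.div_eq_inv_mul]
  exact cellInf_div_volume_eq hp hΩ hΩb hε hρ hcc v ξ

/-- The cell problem only sees the gradient. The additive constant may therefore vary with the cube,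
as it does when Poincaré's inequality supplies it. -/
lemma upperInf_affine_eq (hp : 1 < p) (hΩ : IsOpen Ω) (hΩb : Bornology.IsBounded Ω)
    {x : E d} {ρ : ℝ} (hρ : 0 < ρ) (hcc : closedCube x ρ ⊆ Ω) (v v' : E m) (ξ : Mat m d) :
    upperInf Ω p L (fun y => v + ξ.mulVec (y - x)) (cube x ρ) =
      upperInf Ω p L (fun y => v' + ξ.mulVec (y - x)) (cube x ρ) :=
  limsup_congr (eventually_mem_nhdsWithin.mono fun ε hε => by
    rw [dirichletInf_affine_eq hp hΩ hΩb hε hρ hcc, dirichletInf_affine_eq hp hΩ hΩb hε hρ hcc])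

lemma lowerInf_affine_eq (hp : 1 < p) (hΩ : IsOpen Ω) (hΩb : Bornology.IsBounded Ω)
    {x : E d} {ρ : ℝ} (hρ : 0 < ρ) (hcc : closedCube x ρ ⊆ Ω) (v v' : E m) (ξ : Mat m d) :
    lowerInf Ω p L (fun y => v + ξ.mulVec (y - x)) (cube x ρ) =
      lowerInf Ω p L (fun y => v' + ξ.mulVec (y - x)) (cube x ρ) :=
  liminf_congr (eventually_mem_nhdsWithin.mono fun ε hε => by
    rw [dirichletInf_affine_eq hp hΩ hΩb hε hρ hcc, dirichletInf_affine_eq hp hΩ hΩb hε hρ hcc])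

lemma Lhom_eq_upperDensity (hp : 1 < p) (hΩ : IsOpen Ω) (hΩb : Bornology.IsBounded Ω)
    {x : E d} (hx : x ∈ Ω) (v : E m) (ξ : Mat m d) :
    Lhom p L x ξ = upperDensity Ω p L (fun y => v + ξ.mulVec (y - x)) x :=
  limsup_congr (by
    filter_upwards [eventually_closedCube_subset hΩ hx, eventually_mem_nhdsWithin] with ρ h hρ
    exact limsup_cellInf_eq hp hΩ hΩb hρ h v ξ)

lemma LhomInf_eq_lowerDensity (hp : 1 < p) (hΩ : IsOpen Ω) (hΩb : Bornology.IsBounded Ω)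
    {x : E d} (hx : x ∈ Ω) (v : E m) (ξ : Mat m d) :
    LhomInf p L x ξ = lowerDensity Ω p L (fun y => v + ξ.mulVec (y - x)) x :=
  liminf_congr (by
    filter_upwards [eventually_closedCube_subset hΩ hx, eventually_mem_nhdsWithin] with ρ h hρ
    exact liminf_cellInf_eq hp hΩ hΩb hρ h v ξ)

/-- By definition `L0` is the upper density of an affine function based at `x`. -/
lemma Lhom_eq_L0 (hp : 1 < p) (hΩ : IsOpen Ω) (hΩb : Bornology.IsBounded Ω)
    {x : E d} (hx : x ∈ Ω) (v : E m) (ξ : Mat m d) : Lhom p L x ξ = L0 Ω p L x v ξ :=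
  Lhom_eq_upperDensity hp hΩ hΩb hx v ξ

end Homogenization

/-! ### Differentiation along cubes and the growth measure -/

namespace Homogenization

variable {d m : ℕ} {Ω : Set (E d)} {p : ℝ} {L : E d → Mat m d → ℝ≥0} {ε : ℝ}

/-- Differentiation of finite measures along cubes. -/
theorem ae_tendsto_measure_closedCube (μ : Measure (E d)) [IsFiniteMeasure μ] :
    ∀ᵐ x, Tendsto (fun r : ℝ => μ (closedCube x r) / ENNReal.ofReal r ^ d) (𝓝[>] 0)
      (𝓝 (μ.rnDeriv volume x)) := by
  have hmp := PiLp.volume_preserving_ofLp (Fin d)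
  have hme : MeasurableEmbedding (WithLp.ofLp : E d → Fin d → ℝ) :=
    (MeasurableEquiv.toLp 2 (Fin d → ℝ)).symm.measurableEmbedding
  -- Cubes are the balls of the sup norm, so Besicovitch's theorem is applied to the image measure
  -- on `Fin d → ℝ`; side `r` corresponds to radius `r / 2`.
  have h1 := Besicovitch.ae_tendsto_rnDeriv (μ.map (WithLp.ofLp : E d → Fin d → ℝ)) volume
  have h2 := hme.rnDeriv_map μ volume
  rw [hmp.map_eq] at h2
  filter_upwards [hmp.quasiMeasurePreserving.ae h1, h2] with x hx hx2
  rw [← hx2]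
  have ht : Tendsto (fun r : ℝ => 2⁻¹ * r) (𝓝[>] 0) (𝓝[>] 0) :=
    (map_mul_left_nhdsGT_zero (by norm_num)).le
  refine (hx.comp ht).congr' ?_
  filter_upwards [eventually_mem_nhdsWithin] with r hr
  have hr : 0 < r := hr
  have e : (2⁻¹ : ℝ) * r = r / 2 := by ring
  simp only [Function.comp_apply]
  rw [e, hme.map_apply, ← closedCube_eq_preimage_closedBall x hr.le,
    ← hmp.measure_preimage measurableSet_closedBall.nullMeasurableSet,
    ← closedCube_eq_preimage_closedBall x hr.le, volume_closedCube x hr.le]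

lemma ae_tendsto_lintegral_closedCube (hΩ : MeasurableSet Ω) {g : E d → ℝ≥0∞}
    (hg : AEMeasurable g (volume.restrict Ω)) (hfin : ∫⁻ x in Ω, g x ≠ ⊤) :
    ∀ᵐ x ∂(volume.restrict Ω), Tendsto (fun r : ℝ => (∫⁻ y in closedCube x r ∩ Ω, g y) /
      ENNReal.ofReal r ^ d) (𝓝[>] 0) (𝓝 (g x)) := by
  have hi : AEMeasurable (Ω.indicator g) := (aemeasurable_indicator_iff hΩ).2 hg
  have hfi : ∫⁻ x, Ω.indicator g x ≠ ⊤ := by rwa [lintegral_indicator hΩ]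
  have := isFiniteMeasure_withDensity hfi
  have h1 := ae_tendsto_measure_closedCube (volume.withDensity (Ω.indicator g))
  have h2 := Measure.rnDeriv_withDensity₀ volume hi
  filter_upwards [ae_restrict_of_ae h1, ae_restrict_of_ae h2, ae_restrict_mem hΩ] with x h1 h2 hx
  rw [h2, indicator_of_mem hx] at h1
  refine h1.congr fun r => ?_
  rw [withDensity_apply _ (measurableSet_closedCube x r), lintegral_indicator hΩ,
    Measure.restrict_restrict hΩ, inter_comm]

/-- Both concentric cubes have density `D`, and the inner one has relative volume `s ^ d`.
Finiteness of `D` allows the subtraction; the limit becomes small as `s → 1`. -/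
lemma tendsto_measure_closedCube_diff {μ : Measure (E d)} [IsFiniteMeasure μ] {x : E d} {D : ℝ≥0∞}
    (hD : D ≠ ⊤) (h : Tendsto (fun r : ℝ => μ (closedCube x r) / ENNReal.ofReal r ^ d) (𝓝[>] 0) (𝓝 D))
    {s : ℝ} (hs : 0 < s) (hs1 : s < 1) :
    Tendsto (fun r : ℝ => μ (closedCube x r \ closedCube x (s * r)) / ENNReal.ofReal r ^ d)
      (𝓝[>] 0) (𝓝 (D - ENNReal.ofReal s ^ d * D)) := by
  have ht : Tendsto (fun r : ℝ => s * r) (𝓝[>] 0) (𝓝[>] 0) := (map_mul_left_nhdsGT_zero hs).le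
  have h2 := ENNReal.Tendsto.const_mul (a := ENNReal.ofReal s ^ d) (h.comp ht)
    (Or.inr ofReal_pow_ne_top)
  refine (ENNReal.Tendsto.sub h h2 (Or.inl hD)).congr' ?_
  filter_upwards [eventually_mem_nhdsWithin] with r hr
  have hr : 0 < r := hr
  simp only [Function.comp_apply]
  rw [measure_sdiff (closedCube_mono x (by nlinarith)) (measurableSet_closedCube _ _).nullMeasurableSet
    (measure_ne_top _ _), ENNReal.ofReal_mul hs.le, mul_pow, div_eq_mul_inv, div_eq_mul_inv,
    div_eq_mul_inv, ENNReal.sub_mul fun _ _ => ENNReal.inv_ne_top.2 (ofReal_pow_ne_zero hr),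
    ENNReal.mul_inv (Or.inr ofReal_pow_ne_top) (Or.inr (ofReal_pow_ne_zero hr))]
  congr 1
  calc _ = (ENNReal.ofReal s ^ d * (ENNReal.ofReal s ^ d)⁻¹) *
        (μ (closedCube x (s * r)) * (ENNReal.ofReal r ^ d)⁻¹) := by ring
    _ = _ := by rw [ENNReal.mul_inv_cancel (ofReal_pow_ne_zero hs) ofReal_pow_ne_top, one_mul]

lemma volume_closedCube_diff_closedCube (x : E d) {r s : ℝ} (hr : 0 < r) (hs : 0 < s) (hs1 : s < 1) :
    volume (closedCube x r \ closedCube x (s * r)) / ENNReal.ofReal r ^ d =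
      1 - ENNReal.ofReal s ^ d := by
  rw [measure_sdiff (closedCube_mono x (by nlinarith)) (measurableSet_closedCube _ _).nullMeasurableSet
    (by rw [volume_closedCube _ (by positivity)]; exact ofReal_pow_ne_top),
    volume_closedCube _ hr.le, volume_closedCube _ (by positivity), ENNReal.ofReal_mul hs.le, mul_pow,
    div_eq_mul_inv, ENNReal.sub_mul fun _ _ => ENNReal.inv_ne_top.2 (ofReal_pow_ne_zero hr), mul_assoc,
    ENNReal.mul_inv_cancel (ofReal_pow_ne_zero hr) ofReal_pow_ne_top, mul_one]

/-- The measure controlling `m_ε(u;·)` in the growth condition. -/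
noncomputable def Sobolev.growthMeasure (ν : Measure (E d)) (u : Sobolev Ω p m) : Measure (E d) :=
  ν.restrict Ω + (volume.restrict Ω).withDensity fun x => ‖u.toFun x‖ₑ ^ p + ‖u.grad x‖ₑ ^ p

namespace Sobolev

variable {ν : Measure (E d)}

lemma isFiniteMeasure_growthMeasure [IsFiniteMeasure ν] (hp : 1 < p) (u : Sobolev Ω p m) :
    IsFiniteMeasure (u.growthMeasure ν) := by
  have h : ∫⁻ x in Ω, ‖u.toFun x‖ₑ ^ p + ‖u.grad x‖ₑ ^ p ≠ ⊤ := by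
    rw [lintegral_add_left' (aemeasurable_enorm_rpow u.memLp_toFun le_rfl)]
    exact (ENNReal.add_lt_top.2 ⟨lintegral_rpow_lt_top hp u.memLp_toFun,
      lintegral_rpow_lt_top hp u.memLp_grad⟩).ne
  have := isFiniteMeasure_withDensity h
  unfold growthMeasure
  infer_instance

lemma growthMeasure_apply (u : Sobolev Ω p m) {V : Set (E d)} (hV : MeasurableSet V) (hVΩ : V ⊆ Ω) :
    u.growthMeasure ν V =
      ν V + ((∫⁻ x in V, ‖u.toFun x‖ₑ ^ p) + ∫⁻ x in V, ‖u.grad x‖ₑ ^ p) := by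
  rw [growthMeasure, Measure.add_apply, Measure.restrict_apply hV, inter_eq_left.2 hVΩ,
    withDensity_apply _ hV, Measure.restrict_restrict hV, inter_eq_left.2 hVΩ,
    lintegral_add_left' (aemeasurable_enorm_rpow u.memLp_toFun hVΩ)]

lemma growthMeasure_absolutelyContinuous (hν : ν ≪ volume) (u : Sobolev Ω p m) :
    u.growthMeasure ν ≪ volume :=
  (Measure.absolutelyContinuous_of_le Measure.restrict_le_self |>.trans hν).add_left
    ((withDensity_absolutelyContinuous _ _).trans
      (Measure.absolutelyContinuous_of_le Measure.restrict_le_self))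

lemma _root_.Homogenization.GrowthBound.dirichletInf_le {β : ℝ≥0} (h : GrowthBound Ω p L β ν)
    (u : Sobolev Ω p m) {V : Set (E d)} (hV : IsOpen V) (hVΩ : V ⊆ Ω) (h0 : 0 < ε) (h1 : ε ≤ 1) :
    dirichletInf Ω p L ε u.toFun V ≤ β * u.growthMeasure ν V := by
  rw [u.growthMeasure_apply hV.measurableSet hVΩ, ← add_assoc]
  exact h V u ε hV hVΩ h0 h1

end Sobolev

end Homogenization

/-! ### Comparison with affine functions -/

namespace Homogenization

variable {d m : ℕ} {Ω : Set (E d)} {p : ℝ} {L : E d → Mat m d → ℝ≥0} {ε : ℝ}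

/-- The error in the comparison of `u` with an affine function of gradient `ξ` on a cube. -/
noncomputable def Sobolev.affineError (ν : Measure (E d)) (u : Sobolev Ω p m) (ξ : Mat m d) (x : E d)
    (s r : ℝ) : ℝ≥0∞ :=
  u.growthMeasure ν (closedCube x r \ closedCube x (s * r)) +
    ‖ξ‖ₑ ^ p * volume (closedCube x r \ closedCube x (s * r)) +
    (1 + ENNReal.ofReal (1 / (1 - s)) ^ p) *
      ((∫⁻ y in closedCube x r ∩ Ω, ‖u.grad y - ξ‖ₑ ^ p) + ENNReal.ofReal r ^ (d + 1))

/-- The transition term has the size of `(r - s r)^(-p) ∫ |u - A|^p`. Poincaré's inequality on the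
cube of side `r` gains the factor `r^p`, so the result is governed by the integral of `|∇u - ξ|^p`
with a constant depending only on `s`. The constant `c` depends on the cube but not on `ε`. -/
lemma GrowthBound.exists_dirichletInf_affine_le (hp : 1 < p) (hΩ : IsOpen Ω)
    (hΩb : Bornology.IsBounded Ω) {β : ℝ≥0} {ν : Measure (E d)} (hG : GrowthBound Ω p L β ν) :
    ∃ C : ℝ≥0∞, C ≠ ⊤ ∧ ∀ (u : Sobolev Ω p m) (ξ : Mat m d) (x : E d) (s r : ℝ),
      0 < s → s < 1 → 0 < r → r ≤ 1 → closedCube x r ⊆ Ω → ∃ c : E m, ∀ ε : ℝ, 0 < ε → ε ≤ 1 →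
      dirichletInf Ω p L ε u.toFun (cube x r) ≤
        dirichletInf Ω p L ε (fun y => c + ξ.mulVec (y - x)) (cube x (s * r)) +
          C * u.affineError ν ξ x s r ∧
      dirichletInf Ω p L ε (fun y => c + ξ.mulVec (y - x)) (cube x r) ≤
        dirichletInf Ω p L ε u.toFun (cube x (s * r)) + C * u.affineError ν ξ x s r := by
  have hp0 : 0 < p := by linarith
  obtain ⟨C₁, hC₁, h₁⟩ := hG.exists_dirichletInf_le hp hΩ
  obtain ⟨C₂, hC₂, h₂⟩ := Sobolev.exists_poincare d m hp
  have h2t : (2 : ℝ≥0∞) ^ p ≠ ⊤ := ENNReal.rpow_ne_top_of_nonneg hp0.le (by simp)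
  refine ⟨C₁ * ((1 + 2 ^ p) * (1 + C₂)), ENNReal.mul_ne_top hC₁ (ENNReal.mul_ne_top (by finiteness)
    (by finiteness)), fun u ξ x s r hs hs1 hr hr1 hcc => ?_⟩
  have hs1' : 0 < 1 - s := by linarith
  have hr0 : ENNReal.ofReal r ≠ 0 := by simpa using hr
  -- The admitted error `r ^ p * r ^ (d + 1)` leaves a contribution `r ^ (d + 1)` after division by
  -- `r ^ p`, which is negligible compared with the volume of the cube.
  obtain ⟨c, hc⟩ := h₂ Ω hΩ (u.sub hp (Sobolev.affine hΩ hΩb p 0 ξ x)) x r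
    (ENNReal.ofReal r ^ p * ENNReal.ofReal r ^ (d + 1)) hr hcc
    (mul_ne_zero (by simp [hr0, hp0]) (pow_ne_zero _ hr0))
    (ENNReal.mul_ne_top (ENNReal.rpow_ne_top_of_nonneg hp0.le (by simp)) (by finiteness))
  refine ⟨c, fun ε h0 h1 => ?_⟩
  have hsr : s * r < r := by nlinarith
  have hsr0 : 0 < s * r := by positivity
  have hQ : cube x r ⊆ Ω := (cube_subset_closedCube x r).trans hcc
  set A : Sobolev Ω p m := Sobolev.affine hΩ hΩb p c ξ x with hA
  have hAf : A.toFun = fun y => c + ξ.mulVec (y - x) := rfl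
  have hAg : ∀ y, A.grad y = ξ := fun _ => rfl
  set R := cube x r \ closedCube x (s * r) with hR
  set R' := closedCube x r \ closedCube x (s * r) with hR'
  have hRR : R ⊆ R' := sdiff_subset_sdiff_left (cube_subset_closedCube x r)
  have hRm : MeasurableSet R := (measurableSet_cube _ _).diff (measurableSet_closedCube _ _)
  have hRQ : R ⊆ cube x r := sdiff_subset
  have hRΩ : R ⊆ Ω := hRQ.trans hQ
  set Ks : ℝ≥0∞ := 1 + ENNReal.ofReal (1 / (1 - s)) ^ p with hKs
  set K : ℝ≥0∞ := 1 + ENNReal.ofReal (1 / (r - s * r)) ^ p with hK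
  set G : ℝ≥0∞ := (∫⁻ y in closedCube x r ∩ Ω, ‖u.grad y - ξ‖ₑ ^ p) + ENNReal.ofReal r ^ (d + 1)
    with hGd
  set T : ℝ≥0∞ := ∫⁻ y in R, ‖A.toFun y - u.toFun y‖ₑ ^ p with hT
  have hKr : K * ENNReal.ofReal r ^ p ≤ Ks := by
    have e : 1 / (r - s * r) * r = 1 / (1 - s) := by field_simp
    rw [hK, add_mul, ← ENNReal.mul_rpow_of_nonneg _ _ hp0.le, ← ENNReal.ofReal_mul (by
      have : 0 < r - s * r := by linarith
      positivity), e, one_mul]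
    exact add_le_add (ENNReal.rpow_le_one (by simpa using hr1) hp0.le) le_rfl
  have hTle : K * T ≤ C₂ * (Ks * G) := by
    have e1 : T ≤ C₂ * (ENNReal.ofReal r ^ p * G) := by
      calc T ≤ ∫⁻ y in cube x r, ‖A.toFun y - u.toFun y‖ₑ ^ p := lintegral_mono_set hRQ
        _ = ∫⁻ y in cube x r, ‖(u.sub hp (Sobolev.affine hΩ hΩb p 0 ξ x)).toFun y - c‖ₑ ^ p := by
            refine lintegral_congr fun y => ?_
            rw [← enorm_neg]
            congr 2
            simp only [hAf, Sobolev.sub, Sobolev.affine]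
            module
        _ ≤ _ := hc
        _ ≤ _ := by
            rw [hGd, mul_add (ENNReal.ofReal r ^ p)]
            exact mul_le_mul_right (add_le_add (mul_le_mul_right (lintegral_mono_set
              (subset_inter (cube_subset_closedCube x r) hQ)) _) le_rfl) _
    calc K * T ≤ K * (C₂ * (ENNReal.ofReal r ^ p * G)) := by gcongr
      _ = C₂ * ((K * ENNReal.ofReal r ^ p) * G) := by ring
      _ ≤ _ := by gcongr
  have hμ := u.growthMeasure_apply (ν := ν) hRm hRΩ
  have hμR : u.growthMeasure ν R ≤ u.growthMeasure ν R' := measure_mono hRR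
  have hvR : volume R ≤ volume R' := measure_mono hRR
  have hconst : ∫⁻ y in R, ‖A.grad y‖ₑ ^ p = ‖ξ‖ₑ ^ p * volume R := by simp [hAg]
  have hErr : u.growthMeasure ν R + K * T + ‖ξ‖ₑ ^ p * volume R ≤
      (1 + C₂) * u.affineError ν ξ x s r := by
    have e : u.affineError ν ξ x s r = u.growthMeasure ν R' + ‖ξ‖ₑ ^ p * volume R' + Ks * G := rfl
    calc _ ≤ u.growthMeasure ν R' + C₂ * (Ks * G) + ‖ξ‖ₑ ^ p * volume R' := by gcongr
      _ ≤ 1 * (u.growthMeasure ν R' + ‖ξ‖ₑ ^ p * volume R' + Ks * G) +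
          C₂ * (u.growthMeasure ν R' + ‖ξ‖ₑ ^ p * volume R' + Ks * G) := by
          rw [one_mul]
          calc _ = (u.growthMeasure ν R' + ‖ξ‖ₑ ^ p * volume R') + C₂ * (Ks * G) := by ring
            _ ≤ _ := add_le_add le_self_add (mul_le_mul_right le_add_self _)
      _ = _ := by rw [e]; ring
  constructor
  · have hb := h₁ ε x (s * r) r A u h0 h1 hsr0 hsr hQ
    rw [← hR, ← hK, ← hT, hconst, hAf] at hb
    refine hb.trans ?_
    rw [mul_assoc C₁]
    gcongr
    calc _ = u.growthMeasure ν R + K * T + ‖ξ‖ₑ ^ p * volume R := by rw [hμ]; ring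
      _ ≤ (1 + C₂) * u.affineError ν ξ x s r := hErr
      _ ≤ _ := by
        rw [mul_assoc]
        exact le_mul_of_one_le_left zero_le le_self_add
  -- Here the growth bound involves `|A|^p`. Since `c` is not controlled, it is estimated through
  -- `|u|^p` and `|A - u|^p`.
  · have hb := h₁ ε x (s * r) r u A h0 h1 hsr0 hsr hQ
    rw [← hR, ← hK] at hb
    have hTsym : ∫⁻ y in R, ‖u.toFun y - A.toFun y‖ₑ ^ p = T :=
      lintegral_congr fun y => by rw [← enorm_neg, neg_sub]
    have hms : ∀ v : Sobolev Ω p m, AEStronglyMeasurable v.toFun (volume.restrict R) := fun v =>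
      v.memLp_toFun.1.mono_measure (Measure.restrict_mono hRΩ le_rfl)
    have hAle := lintegral_rpow_le_of_sub hp0.le (hms A) (hms u)
    rw [← hT] at hAle
    have hTK : T ≤ K * T := le_mul_of_one_le_left zero_le le_self_add
    rw [hTsym, hconst] at hb
    refine hb.trans ?_
    rw [mul_assoc C₁]
    gcongr
    calc _ ≤ ν R + 2 ^ p * (K * T + ∫⁻ y in R, ‖u.toFun y‖ₑ ^ p) + ‖ξ‖ₑ ^ p * volume R + K * T +
          ∫⁻ y in R, ‖u.grad y‖ₑ ^ p := by
            gcongr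
            exact hAle.trans (by gcongr)
      _ ≤ (1 + 2 ^ p) * (u.growthMeasure ν R + K * T + ‖ξ‖ₑ ^ p * volume R) := by
          rw [hμ]
          calc _ = (ν R + K * T + ‖ξ‖ₑ ^ p * volume R + ∫⁻ y in R, ‖u.grad y‖ₑ ^ p) +
                2 ^ p * (K * T + ∫⁻ y in R, ‖u.toFun y‖ₑ ^ p) := by ring
            _ ≤ (ν R + ((∫⁻ y in R, ‖u.toFun y‖ₑ ^ p) + ∫⁻ y in R, ‖u.grad y‖ₑ ^ p) + K * T +
                ‖ξ‖ₑ ^ p * volume R) + 2 ^ p *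
                (ν R + ((∫⁻ y in R, ‖u.toFun y‖ₑ ^ p) + ∫⁻ y in R, ‖u.grad y‖ₑ ^ p) + K * T +
                ‖ξ‖ₑ ^ p * volume R) := by
                gcongr ?_ + 2 ^ p * ?_
                · calc _ ≤ (ν R + K * T + ‖ξ‖ₑ ^ p * volume R + ∫⁻ y in R, ‖u.grad y‖ₑ ^ p) +
                      ∫⁻ y in R, ‖u.toFun y‖ₑ ^ p := le_self_add
                    _ = _ := by ring
                · calc _ ≤ (K * T + ∫⁻ y in R, ‖u.toFun y‖ₑ ^ p) +
                      (ν R + (∫⁻ y in R, ‖u.grad y‖ₑ ^ p) + ‖ξ‖ₑ ^ p * volume R) := le_self_add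
                    _ = _ := by ring
            _ = _ := by ring
      _ ≤ (1 + 2 ^ p) * ((1 + C₂) * u.affineError ν ξ x s r) := by gcongr
      _ = _ := by ring

end Homogenization

/-! ### Identification of the densities of a Sobolev function -/

namespace Homogenization

variable {d m : ℕ} {Ω : Set (E d)} {p : ℝ} {L : E d → Mat m d → ℝ≥0} {ε : ℝ}

/-- The substitution `r ↦ s r` preserves the filter of positive numbers tending to zero, and
replacing `r ^ n` by the smaller `(s r) ^ n` in the denominator only increases the quotient. -/
lemma limsup_div_pow_le_of_scale {f g h : ℝ → ℝ≥0∞} {s : ℝ} {e : ℝ≥0∞} (n : ℕ) (hs : 0 < s)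
    (hs1 : s < 1) (hfg : ∀ᶠ r in 𝓝[>] 0, f r ≤ g (s * r) + h r)
    (hh : limsup (fun r => h r / ENNReal.ofReal r ^ n) (𝓝[>] 0) ≤ e) :
    limsup (fun r => f r / ENNReal.ofReal r ^ n) (𝓝[>] 0) ≤
      limsup (fun r => g r / ENNReal.ofReal r ^ n) (𝓝[>] 0) + e ∧
    liminf (fun r => f r / ENNReal.ofReal r ^ n) (𝓝[>] 0) ≤
      liminf (fun r => g r / ENNReal.ofReal r ^ n) (𝓝[>] 0) + e := by
  have h1 : ∀ᶠ r in 𝓝[>] (0 : ℝ), f r / ENNReal.ofReal r ^ n ≤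
      g (s * r) / ENNReal.ofReal (s * r) ^ n + h r / ENNReal.ofReal r ^ n := by
    filter_upwards [hfg, eventually_mem_nhdsWithin] with r hr hr0
    have hr0 : 0 < r := hr0
    refine (ENNReal.div_le_div_right hr _).trans ?_
    rw [ENNReal.add_div]
    have : s * r ≤ r := by nlinarith
    gcongr
  have h2 := limsup_le_limsup_add h1 hh
  have h3 := liminf_le_liminf_add h1 hh
  have e1 : limsup (fun r => g (s * r) / ENNReal.ofReal (s * r) ^ n) (𝓝[>] (0 : ℝ)) =
      limsup (fun r => g r / ENNReal.ofReal r ^ n) (map (fun r => s * r) (𝓝[>] 0)) := rfl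
  have e2 : liminf (fun r => g (s * r) / ENNReal.ofReal (s * r) ^ n) (𝓝[>] (0 : ℝ)) =
      liminf (fun r => g r / ENNReal.ofReal r ^ n) (map (fun r => s * r) (𝓝[>] 0)) := rfl
  rw [map_mul_left_nhdsGT_zero hs] at e1 e2
  exact ⟨e1 ▸ h2, e2 ▸ h3⟩

lemma eventually_le_one_nhdsGT : ∀ᶠ ε in 𝓝[>] (0 : ℝ), 0 < ε ∧ ε ≤ 1 := by
  filter_upwards [Ioc_mem_nhdsGT (zero_lt_one' ℝ)] with ε hε using hε

lemma upperInf_le_add {u v : E d → E m} {O O' : Set (E d)} {e : ℝ≥0∞}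
    (h : ∀ ε : ℝ, 0 < ε → ε ≤ 1 → dirichletInf Ω p L ε u O ≤ dirichletInf Ω p L ε v O' + e) :
    upperInf Ω p L u O ≤ upperInf Ω p L v O' + e :=
  limsup_le_limsup_add (h := fun _ => e) (eventually_le_one_nhdsGT.mono fun ε hε => h ε hε.1 hε.2)
    (limsup_const e).le

lemma lowerInf_le_add {u v : E d → E m} {O O' : Set (E d)} {e : ℝ≥0∞}
    (h : ∀ ε : ℝ, 0 < ε → ε ≤ 1 → dirichletInf Ω p L ε u O ≤ dirichletInf Ω p L ε v O' + e) :
    lowerInf Ω p L u O ≤ lowerInf Ω p L v O' + e :=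
  liminf_le_liminf_add (h := fun _ => e) (eventually_le_one_nhdsGT.mono fun ε hε => h ε hε.1 hε.2)
    (limsup_const e).le

lemma limsup_affineError_le {ν : Measure (E d)} [IsFiniteMeasure ν] (hp : 1 < p) {u : Sobolev Ω p m}
    {ξ : Mat m d} {x : E d} {D T : ℝ≥0∞} (hD : D ≠ ⊤)
    (h : Tendsto (fun r : ℝ => u.growthMeasure ν (closedCube x r) / ENNReal.ofReal r ^ d) (𝓝[>] 0)
      (𝓝 D))
    (hT : limsup (fun r : ℝ => (∫⁻ y in closedCube x r ∩ Ω, ‖u.grad y - ξ‖ₑ ^ p) /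
      ENNReal.ofReal r ^ d) (𝓝[>] 0) ≤ T) {s : ℝ} (hs : 0 < s) (hs1 : s < 1) :
    limsup (fun r : ℝ => u.affineError ν ξ x s r / ENNReal.ofReal r ^ d) (𝓝[>] 0) ≤
      (D - ENNReal.ofReal s ^ d * D) + ‖ξ‖ₑ ^ p * (1 - ENNReal.ofReal s ^ d) +
        (1 + ENNReal.ofReal (1 / (1 - s)) ^ p) * T := by
  have hp0 : 0 < p := by linarith
  have := u.isFiniteMeasure_growthMeasure (ν := ν) hp
  set K : ℝ≥0∞ := 1 + ENNReal.ofReal (1 / (1 - s)) ^ p with hK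
  have hKt : K ≠ ⊤ := ENNReal.add_ne_top.2 ⟨by simp, ENNReal.rpow_ne_top_of_nonneg hp0.le (by simp)⟩
  have h1 := tendsto_measure_closedCube_diff hD h hs hs1
  have h2 : Tendsto (fun r : ℝ => K * ENNReal.ofReal r) (𝓝[>] 0) (𝓝 0) := by
    have : Tendsto (fun r : ℝ => K * ENNReal.ofReal r) (𝓝 0) (𝓝 (K * ENNReal.ofReal 0)) :=
      ENNReal.Tendsto.const_mul (ENNReal.continuous_ofReal.tendsto 0) (Or.inr hKt)
    simpa using this.mono_left nhdsWithin_le_nhds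
  have h3 := (h1.add (tendsto_const_nhds (x := ‖ξ‖ₑ ^ p * (1 - ENNReal.ofReal s ^ d)))).add h2
  rw [add_zero] at h3
  rw [← h3.limsup_eq]
  refine limsup_le_limsup_add (h := fun r => K * ((∫⁻ y in closedCube x r ∩ Ω, ‖u.grad y - ξ‖ₑ ^ p) /
      ENNReal.ofReal r ^ d)) ?_ ?_
  · filter_upwards [eventually_mem_nhdsWithin] with r hr
    have hr : 0 < r := hr
    have e := volume_closedCube_diff_closedCube x hr hs hs1
    have e2 : ENNReal.ofReal r ^ (d + 1) / ENNReal.ofReal r ^ d = ENNReal.ofReal r := by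
      rw [pow_succ, mul_comm, mul_div_assoc, ENNReal.div_self (ofReal_pow_ne_zero hr) ofReal_pow_ne_top,
        mul_one]
    rw [Sobolev.affineError, ENNReal.add_div, ENNReal.add_div, mul_div_assoc, mul_div_assoc,
      ENNReal.add_div, e, e2, mul_add, ← hK]
    exact le_of_eq (by ring)
  · rw [ENNReal.limsup_const_mul_of_ne_top hKt]
    gcongr

/-- The affine comparison is divided by `r ^ d` with `s` fixed. The matrix `ξ` need not be `∇u(x)`:
the bound `T` records its distance from the gradient, so that a dense sequence of matrices can be
inserted. -/
lemma exists_density_le_add (hp : 1 < p) (hΩ : IsOpen Ω) (hΩb : Bornology.IsBounded Ω) {β : ℝ≥0}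
    {ν : Measure (E d)} [IsFiniteMeasure ν] (hG : GrowthBound Ω p L β ν) :
    ∃ C : ℝ≥0∞, C ≠ ⊤ ∧ ∀ (u : Sobolev Ω p m) (ξ : Mat m d) (x : E d) (D T : ℝ≥0∞) (s : ℝ), x ∈ Ω →
      D ≠ ⊤ → Tendsto (fun r : ℝ => u.growthMeasure ν (closedCube x r) / ENNReal.ofReal r ^ d) (𝓝[>] 0)
        (𝓝 D) →
      limsup (fun r : ℝ => (∫⁻ y in closedCube x r ∩ Ω, ‖u.grad y - ξ‖ₑ ^ p) /
        ENNReal.ofReal r ^ d) (𝓝[>] 0) ≤ T → 0 < s → s < 1 →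
      ∃ e : ℝ≥0∞, e = C * ((D - ENNReal.ofReal s ^ d * D) + ‖ξ‖ₑ ^ p * (1 - ENNReal.ofReal s ^ d) +
        (1 + ENNReal.ofReal (1 / (1 - s)) ^ p) * T) ∧
      upperDensity Ω p L u.toFun x ≤ Lhom p L x ξ + e ∧
      Lhom p L x ξ ≤ upperDensity Ω p L u.toFun x + e ∧
      LhomInf p L x ξ ≤ lowerDensity Ω p L u.toFun x + e := by
  obtain ⟨C, hC, h⟩ := hG.exists_dirichletInf_affine_le hp hΩ hΩb
  refine ⟨C, hC, fun u ξ x D T s hx hD hDl hT hs hs1 => ⟨_, rfl, ?_⟩⟩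
  have herr : limsup (fun r : ℝ => C * u.affineError ν ξ x s r / ENNReal.ofReal r ^ d) (𝓝[>] 0) ≤
      C * ((D - ENNReal.ofReal s ^ d * D) + ‖ξ‖ₑ ^ p * (1 - ENNReal.ofReal s ^ d) +
        (1 + ENNReal.ofReal (1 / (1 - s)) ^ p) * T) := by
    simp only [mul_div_assoc]
    rw [ENNReal.limsup_const_mul_of_ne_top hC]
    gcongr
    exact limsup_affineError_le hp hD hDl hT hs hs1
  rw [Lhom_eq_upperDensity hp hΩ hΩb hx 0, LhomInf_eq_lowerDensity hp hΩ hΩb hx 0]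
  have hev : ∀ᶠ r in 𝓝[>] (0 : ℝ), 0 < r ∧ r ≤ 1 ∧ closedCube x r ⊆ Ω := by
    filter_upwards [eventually_closedCube_subset hΩ hx, eventually_le_one_nhdsGT] with r h1 h2
      using ⟨h2.1, h2.2, h1⟩
  refine ⟨(limsup_div_pow_le_of_scale (f := fun r => upperInf Ω p L u.toFun (cube x r))
    (g := fun r => upperInf Ω p L (fun y => 0 + ξ.mulVec (y - x)) (cube x r)) d hs hs1 ?_ herr).1,
    (limsup_div_pow_le_of_scale (g := fun r => upperInf Ω p L u.toFun (cube x r))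
    (f := fun r => upperInf Ω p L (fun y => 0 + ξ.mulVec (y - x)) (cube x r)) d hs hs1 ?_ herr).1,
    (limsup_div_pow_le_of_scale (g := fun r => lowerInf Ω p L u.toFun (cube x r))
    (f := fun r => lowerInf Ω p L (fun y => 0 + ξ.mulVec (y - x)) (cube x r)) d hs hs1 ?_ herr).2⟩
  · filter_upwards [hev] with r ⟨hr, hr1, hcc⟩
    obtain ⟨c, hc⟩ := h u ξ x s r hs hs1 hr hr1 hcc
    rw [upperInf_affine_eq hp hΩ hΩb (mul_pos hs hr)
      ((closedCube_mono x (by nlinarith)).trans hcc) 0 c]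
    exact upperInf_le_add fun ε h0 h1 => (hc ε h0 h1).1
  · filter_upwards [hev] with r ⟨hr, hr1, hcc⟩
    obtain ⟨c, hc⟩ := h u ξ x s r hs hs1 hr hr1 hcc
    rw [upperInf_affine_eq hp hΩ hΩb hr hcc 0 c]
    exact upperInf_le_add fun ε h0 h1 => (hc ε h0 h1).2
  · filter_upwards [hev] with r ⟨hr, hr1, hcc⟩
    obtain ⟨c, hc⟩ := h u ξ x s r hs hs1 hr hr1 hcc
    rw [lowerInf_affine_eq hp hΩ hΩb hr hcc 0 c]
    exact lowerInf_le_add fun ε h0 h1 => (hc ε h0 h1).2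

lemma upperDensity_le_of_tendsto {β : ℝ≥0} {ν : Measure (E d)} (hG : GrowthBound Ω p L β ν)
    (hΩ : IsOpen Ω) {u : Sobolev Ω p m} {x : E d} (hx : x ∈ Ω) {D : ℝ≥0∞}
    (h : Tendsto (fun r : ℝ => u.growthMeasure ν (closedCube x r) / ENNReal.ofReal r ^ d) (𝓝[>] 0)
      (𝓝 D)) : upperDensity Ω p L u.toFun x ≤ β * D := by
  have h1 := ENNReal.Tendsto.const_mul (a := (β : ℝ≥0∞)) h (Or.inr ENNReal.coe_ne_top)
  rw [← h1.limsup_eq]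
  refine limsup_le_limsup ?_
  filter_upwards [eventually_closedCube_subset hΩ hx] with r hr
  rw [← mul_div_assoc]
  gcongr
  have hQ := (cube_subset_closedCube x r).trans hr
  refine limsup_le_of_le (by isBoundedDefault) (eventually_le_one_nhdsGT.mono fun ε hε => ?_)
  exact (hG.dirichletInf_le u (isOpen_cube x r) hQ hε.1 hε.2).trans
    (by gcongr; exact cube_subset_closedCube x r)

lemma tendsto_scale_error {D c : ℝ≥0∞} (hD : D ≠ ⊤) (hc : c ≠ ⊤) (n : ℕ) :
    Tendsto (fun s : ℝ => (D - ENNReal.ofReal s ^ n * D) + c * (1 - ENNReal.ofReal s ^ n)) (𝓝[<] 1)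
      (𝓝 0) := by
  have h1 : Tendsto (fun s : ℝ => ENNReal.ofReal s ^ n) (𝓝[<] 1) (𝓝 1) := by
    have : Tendsto (fun s : ℝ => ENNReal.ofReal s ^ n) (𝓝 1) (𝓝 (ENNReal.ofReal 1 ^ n)) :=
      ((ENNReal.continuous_pow n).comp ENNReal.continuous_ofReal).tendsto 1
    simpa using this.mono_left nhdsWithin_le_nhds
  have h2 := ENNReal.Tendsto.sub (tendsto_const_nhds (x := D))
    (ENNReal.Tendsto.mul_const h1 (Or.inr hD)) (Or.inl hD)
  have h3 := ENNReal.Tendsto.const_mul (ENNReal.Tendsto.sub (tendsto_const_nhds (x := 1)) h1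
    (Or.inl ENNReal.one_ne_top)) (Or.inr hc)
  simpa using h2.add h3

lemma continuous_enorm_rpow {F : Type*} [NormedAddCommGroup F] (p : ℝ) :
    Continuous fun x : F => ‖x‖ₑ ^ p :=
  ENNReal.continuous_rpow_const.comp continuous_enorm

/-- At almost every point the densities of the local Dirichlet problems of `u` are given by the
homogenized integrand at `∇u`. -/
theorem ae_density_eq (hp : 1 < p) (hΩ : IsOpen Ω) (hΩb : Bornology.IsBounded Ω) {β : ℝ≥0}
    {ν : Measure (E d)} [IsFiniteMeasure ν] (hG : GrowthBound Ω p L β ν) (hH : IsHIntegrand Ω p L)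
    (u : Sobolev Ω p m) : ∀ᵐ x ∂(volume.restrict Ω),
      upperDensity Ω p L u.toFun x = Lhom p L x (u.grad x) ∧
      lowerDensity Ω p L u.toFun x = upperDensity Ω p L u.toFun x ∧
      upperDensity Ω p L u.toFun x ≠ ⊤ := by
  have hp0 : 0 < p := by linarith
  obtain ⟨C, hC, hcmp⟩ := exists_density_le_add hp hΩ hΩb hG
  have := u.isFiniteMeasure_growthMeasure (ν := ν) hp
  have : IsFiniteMeasure (volume.restrict Ω) := ⟨by simpa using hΩb.measure_lt_top⟩
  -- The null sets in (H) and in the differentiation theorem depend on the matrix, whereas `∇u` may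
  -- take uncountably many values. Only countably many matrices are therefore used.
  set q := TopologicalSpace.denseSeq (Mat m d) with hq
  have hqd : DenseRange q := TopologicalSpace.denseRange_denseSeq _
  have hqm : ∀ n, MemLp (fun y => u.grad y - q n) (ENNReal.ofReal p) (volume.restrict Ω) := fun n =>
    u.memLp_grad.sub (memLp_const _)
  have h1 := ae_restrict_of_ae (s := Ω) (ae_tendsto_measure_closedCube (u.growthMeasure ν))
  have h2 := ae_restrict_of_ae (s := Ω) ((u.growthMeasure ν).rnDeriv_lt_top volume)
  have h3 := ae_all_iff.2 fun n => ae_tendsto_lintegral_closedCube hΩ.measurableSet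
    (aemeasurable_enorm_rpow (p := p) (hqm n) le_rfl) (lintegral_rpow_lt_top hp (hqm n)).ne
  have h4 := ae_all_iff.2 fun n => hH (q n)
  filter_upwards [h1, h2, h3, h4, ae_restrict_mem hΩ.measurableSet] with x hD hDt hlim hHx hx
  set D := (u.growthMeasure ν).rnDeriv volume x
  set ξ := u.grad x with hξ
  have hξt : ‖ξ‖ₑ ^ p ≠ ⊤ := ENNReal.rpow_ne_top_of_nonneg hp0.le enorm_ne_top
  have hT : limsup (fun r : ℝ => (∫⁻ y in closedCube x r ∩ Ω, ‖u.grad y - ξ‖ₑ ^ p) /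
      ENNReal.ofReal r ^ d) (𝓝[>] 0) ≤ 0 := by
    -- The Lebesgue point property of `∇u` in the `p`-th power: the triangle inequality with `q n`
    -- gives the bound on a dense set, continuity extends it to all `η`, and `η = ξ` makes it zero.
    have hall : ∀ η : Mat m d, limsup (fun r : ℝ => (∫⁻ y in closedCube x r ∩ Ω, ‖u.grad y - ξ‖ₑ ^ p) /
        ENNReal.ofReal r ^ d) (𝓝[>] 0) ≤ 2 ^ p * (‖ξ - η‖ₑ ^ p + ‖η - ξ‖ₑ ^ p) := by
      refine fun η => hqd.induction_on (p := fun η => limsup (fun r : ℝ =>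
        (∫⁻ y in closedCube x r ∩ Ω, ‖u.grad y - ξ‖ₑ ^ p) /
        ENNReal.ofReal r ^ d) (𝓝[>] 0) ≤ 2 ^ p * (‖ξ - η‖ₑ ^ p + ‖η - ξ‖ₑ ^ p)) η ?_ fun n => ?_
      · refine isClosed_le continuous_const (ENNReal.continuous_const_mul
          (ENNReal.rpow_ne_top_of_nonneg hp0.le (by simp)) |>.comp ?_)
        exact ((continuous_enorm_rpow p).comp (by fun_prop)).add
          ((continuous_enorm_rpow p).comp (by fun_prop))
      · have h5 := ENNReal.Tendsto.const_mul (a := (2 : ℝ≥0∞) ^ p) ((hlim n).add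
          (tendsto_const_nhds (x := ‖q n - ξ‖ₑ ^ p)))
          (Or.inr (ENNReal.rpow_ne_top_of_nonneg hp0.le (by simp)))
        rw [← h5.limsup_eq]
        refine limsup_le_limsup (eventually_mem_nhdsWithin.mono fun r hr => ?_)
        have hr : 0 < r := hr
        have h6 : AEStronglyMeasurable u.grad (volume.restrict (closedCube x r ∩ Ω)) :=
          u.memLp_grad.1.mono_measure (Measure.restrict_mono inter_subset_right le_rfl)
        have h7 := lintegral_rpow_le_of_sub hp0.le (h6.sub (aestronglyMeasurable_const (b := ξ)))
          (aestronglyMeasurable_const (b := q n - ξ))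
        simp only [Pi.sub_apply, sub_sub_sub_cancel_right] at h7
        calc _ ≤ (2 ^ p * ((∫⁻ y in closedCube x r ∩ Ω, ‖u.grad y - q n‖ₑ ^ p) +
              ∫⁻ y in closedCube x r ∩ Ω, ‖q n - ξ‖ₑ ^ p)) / ENNReal.ofReal r ^ d := ENNReal.div_le_div_right h7 _
          _ ≤ _ := by
            rw [mul_div_assoc, ENNReal.add_div]
            refine mul_le_mul_right (add_le_add le_rfl ?_) _
            rw [lintegral_const, mul_div_assoc, Measure.restrict_apply_univ]
            refine mul_le_of_le_one_right zero_le (ENNReal.div_le_of_le_mul ?_)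
            rw [one_mul, ← volume_closedCube x hr.le]
            exact measure_mono inter_subset_left
    have := hall ξ
    simpa [hp0] using this
  have hs : ∀ᶠ s in 𝓝[<] (1 : ℝ), 0 < s ∧ s < 1 := by
    filter_upwards [Ioo_mem_nhdsLT (zero_lt_one' ℝ)] with s hs using hs
  have hlim0 : ∀ K : ℝ≥0∞, K ≠ ⊤ → ∀ a : ℝ≥0∞, Tendsto (fun s : ℝ => a + K *
      ((D - ENNReal.ofReal s ^ d * D) + ‖ξ‖ₑ ^ p * (1 - ENNReal.ofReal s ^ d))) (𝓝[<] 1) (𝓝 a) := by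
    intro K hK a
    simpa using (tendsto_const_nhds (x := a)).add
      (ENNReal.Tendsto.const_mul (tendsto_scale_error hDt.ne hξt d) (Or.inr hK))
  refine ⟨le_antisymm ?_ ?_, le_antisymm (lowerDensity_le_upperDensity _ _) ?_, ?_⟩
  · refine ge_of_tendsto (hlim0 C hC (Lhom p L x ξ)) (hs.mono fun s hs => ?_)
    obtain ⟨e, rfl, h, -⟩ := hcmp u ξ x D 0 s hx hDt.ne hD hT hs.1 hs.2
    simpa using h
  · refine ge_of_tendsto (hlim0 C hC (upperDensity Ω p L u.toFun x)) (hs.mono fun s hs => ?_)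
    obtain ⟨e, rfl, -, h, -⟩ := hcmp u ξ x D 0 s hx hDt.ne hD hT hs.1 hs.2
    simpa using h
  · refine ge_of_tendsto (hlim0 (2 * C) (by finiteness) (lowerDensity Ω p L u.toFun x))
      (hs.mono fun s hs => ?_)
    -- At `η = q n` one passes from the upper density to `Lhom`, by (H) to `LhomInf`, and on to the
    -- lower density, with the error twice. Both densities of `u` are fixed numbers, so only the
    -- error must be continuous in `η`. Then `η = ξ`, and afterwards `s → 1`.
    have hall : ∀ η : Mat m d, upperDensity Ω p L u.toFun x ≤ lowerDensity Ω p L u.toFun x +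
        2 * C * ((D - ENNReal.ofReal s ^ d * D) + ‖η‖ₑ ^ p * (1 - ENNReal.ofReal s ^ d) +
        (1 + ENNReal.ofReal (1 / (1 - s)) ^ p) * ‖ξ - η‖ₑ ^ p) := by
      refine fun η => hqd.induction_on (p := fun η => upperDensity Ω p L u.toFun x ≤
        lowerDensity Ω p L u.toFun x +
        2 * C * ((D - ENNReal.ofReal s ^ d * D) + ‖η‖ₑ ^ p * (1 - ENNReal.ofReal s ^ d) +
        (1 + ENNReal.ofReal (1 / (1 - s)) ^ p) * ‖ξ - η‖ₑ ^ p)) η ?_ fun n => ?_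
      · refine isClosed_le continuous_const (continuous_const.add
          ((ENNReal.continuous_const_mul (by finiteness)).comp ((continuous_const.add
          ((ENNReal.continuous_mul_const ?_).comp (continuous_enorm_rpow p))).add
          ((ENNReal.continuous_const_mul ?_).comp ((continuous_enorm_rpow p).comp (by fun_prop))))))
        · exact ENNReal.sub_ne_top ENNReal.one_ne_top
        · exact ENNReal.add_ne_top.2 ⟨by simp, ENNReal.rpow_ne_top_of_nonneg hp0.le (by simp)⟩
      · obtain ⟨e, he, h5, -, h6⟩ := hcmp u (q n) x D _ s hx hDt.ne hD (hlim n).limsup_eq.le hs.1 hs.2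
        rw [mul_assoc 2 C, ← he, two_mul, ← add_assoc]
        exact h5.trans (by rw [hHx n]; gcongr)
    simpa [hp0] using hall ξ
  · exact ((upperDensity_le_of_tendsto hG hΩ hx hD).trans_lt
      (ENNReal.mul_lt_top ENNReal.coe_lt_top hDt)).ne

end Homogenization

/-! ### Measurability of the density -/

namespace Homogenization

variable {d m : ℕ} {Ω : Set (E d)} {p : ℝ} {L : E d → Mat m d → ℝ≥0} {ε : ℝ}

lemma GrowthBound.upperInf_le {β : ℝ≥0} {ν : Measure (E d)} (hG : GrowthBound Ω p L β ν)
    (u : Sobolev Ω p m) {V : Set (E d)} (hV : IsOpen V) (hVΩ : V ⊆ Ω) :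
    upperInf Ω p L u.toFun V ≤ β * u.growthMeasure ν V :=
  limsup_le_of_le (by isBoundedDefault) (eventually_le_one_nhdsGT.mono fun _ hε =>
    hG.dirichletInf_le u hV hVΩ hε.1 hε.2)

lemma closedCube_subset_cube_of_mem {x y : E d} {r r' : ℝ} (hy : y ∈ cube x (r - r')) :
    closedCube y r' ⊆ cube x r := fun z hz i => by
  have h1 := hz i
  have h2 := hy i
  have h3 : z i - x i = (z i - y i) + (y i - x i) := by ring
  rw [h3]
  exact (abs_add_le _ _).trans_lt (by linarith)

/-- The defect in the growth condition is an increasing function of cubes. -/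
lemma GrowthBound.defect_mono {β : ℝ≥0} {ν : Measure (E d)} [IsFiniteMeasure ν]
    (hG : GrowthBound Ω p L β ν) (hp : 1 < p) (u : Sobolev Ω p m) {x y : E d} {r r' : ℝ}
    (hr' : 0 < r') (hcc : closedCube y r' ⊆ cube x r) (hΩx : cube x r ⊆ Ω) :
    β * u.growthMeasure ν (cube y r') - upperInf Ω p L u.toFun (cube y r') ≤
      β * u.growthMeasure ν (cube x r) - upperInf Ω p L u.toFun (cube x r) := by
  have := u.isFiniteMeasure_growthMeasure (ν := ν) hp
  have hsub := cube_subset_closedCube y r'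
  have hV : IsOpen (cube x r \ closedCube y r') := (isOpen_cube x r).sdiff (isClosed_closedCube y r')
  -- By gluing and the growth bound, enlarging the cube raises the upper infimum by at most `β μ` of
  -- the added region, and `β μ` itself gains at least that amount.
  have h1 : upperInf Ω p L u.toFun (cube x r) ≤ upperInf Ω p L u.toFun (cube y r') +
      β * u.growthMeasure ν (cube x r \ closedCube y r') := upperInf_le_add fun ε h0 h1 =>
    (dirichletInf_le_add hp u (isOpen_cube x r) (isOpen_cube y r') (isClosed_closedCube y r') hsub hcc
      (volume_closedCube_diff_cube y hr') hΩx).trans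
      (by gcongr; exact hG.dirichletInf_le u hV (sdiff_subset.trans hΩx) h0 h1)
  have h2 := hG.upperInf_le u (isOpen_cube x r) hΩx
  have h3 : β * u.growthMeasure ν (cube y r') + β * u.growthMeasure ν (cube x r \ closedCube y r') ≤
      β * u.growthMeasure ν (cube x r) := by
    rw [← mul_add, ← measure_union (disjoint_sdiff_right.mono_left hsub) hV.measurableSet]
    gcongr
    exact union_subset (hsub.trans hcc) sdiff_subset
  have hfin : β * u.growthMeasure ν (cube x r \ closedCube y r') ≠ ⊤ :=
    ENNReal.mul_ne_top ENNReal.coe_ne_top (measure_ne_top _ _)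
  rw [tsub_le_iff_right]
  refine (ENNReal.add_le_add_iff_right hfin).1 (h3.trans ?_)
  rw [add_assoc]
  calc _ = β * u.growthMeasure ν (cube x r) - upperInf Ω p L u.toFun (cube x r) +
        upperInf Ω p L u.toFun (cube x r) := (tsub_add_cancel_of_le h2).symm
    _ ≤ _ := by gcongr

/-- The infimum over small cubes of the density of an increasing function of cubes is upper
semicontinuous, hence measurable. -/
lemma measurable_iInf_cube {κ : E d → ℝ → ℝ≥0∞} {δ : ℝ}
    (hκ : ∀ x y r r', 0 < r' → closedCube y r' ⊆ cube x r → cube x r ⊆ Ω → κ y r' ≤ κ x r) :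
    Measurable fun x => ⨅ (r : ℝ) (_ : 0 < r ∧ r < δ ∧ cube x r ⊆ Ω), κ x r / ENNReal.ofReal r ^ d := by
  refine measurable_of_Iio fun a => IsOpen.measurableSet ?_
  rw [isOpen_iff_mem_nhds]
  intro x hx
  simp only [mem_preimage, mem_Iio, iInf_lt_iff] at hx
  obtain ⟨r, ⟨hr, hrδ, hrΩ⟩, hlt⟩ := hx
  -- A slightly smaller side `r'` preserves the strict inequality, and the cube of side `r'` around
  -- any centre close to `x` still lies in the cube of side `r` around `x`.
  have hlim : Tendsto (fun r' : ℝ => κ x r / ENNReal.ofReal r' ^ d) (𝓝[<] r)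
      (𝓝 (κ x r / ENNReal.ofReal r ^ d)) := by
    refine ENNReal.Tendsto.div tendsto_const_nhds (Or.inr (ofReal_pow_ne_zero hr))
      (((ENNReal.continuous_pow d).comp ENNReal.continuous_ofReal).tendsto r |>.mono_left
        nhdsWithin_le_nhds) (Or.inl ?_)
    exact ofReal_pow_ne_top
  have hIoo : ∀ᶠ r' in 𝓝[<] r, r' ∈ Ioo 0 r := Ioo_mem_nhdsLT hr
  obtain ⟨r', hlt', hr'0, hr'⟩ := ((hlim.eventually (gt_mem_nhds hlt)).and hIoo).exists
  filter_upwards [(isOpen_cube x (r - r')).mem_nhds (mem_cube_self x (sub_pos.2 hr'))] with y hy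
  have hcc := closedCube_subset_cube_of_mem hy
  simp only [mem_preimage, mem_Iio, iInf_lt_iff]
  refine ⟨r', ⟨hr'0, hr'.trans hrδ, ((cube_subset_closedCube y r').trans hcc).trans hrΩ⟩, ?_⟩
  exact (ENNReal.div_le_div_right (hκ x y r r' hr'0 hcc hrΩ) _).trans_lt hlt'

lemma iSup_iInf_cube_eq_liminf (hΩ : IsOpen Ω) {f : ℝ → ℝ≥0∞} {x : E d} (hx : x ∈ Ω) :
    ⨆ n : ℕ, ⨅ (r : ℝ) (_ : 0 < r ∧ r < 1 / (n + 1 : ℝ) ∧ cube x r ⊆ Ω), f r = liminf f (𝓝[>] 0) := by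
  apply le_antisymm
  · refine iSup_le fun n => le_liminf_of_le (by isBoundedDefault) ?_
    filter_upwards [eventually_closedCube_subset hΩ hx, Ioo_mem_nhdsGT (Nat.one_div_pos_of_nat (n := n))]
      with r h1 h2
    exact iInf₂_le r ⟨h2.1, h2.2, (cube_subset_closedCube x r).trans h1⟩
  · refine le_of_forall_lt fun a ha => ?_
    obtain ⟨b, hab, hb⟩ := exists_between ha
    obtain ⟨δ, hδ, h⟩ := mem_nhdsGT_iff_exists_Ioo_subset.1 (eventually_lt_of_lt_liminf hb)
    obtain ⟨n, hn⟩ := exists_nat_one_div_lt (show (0 : ℝ) < δ from hδ)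
    refine hab.trans_le (le_iSup_of_le n (le_iInf₂ fun r hr => ?_))
    exact (h ⟨hr.1, hr.2.1.trans hn⟩).le

/-- The upper density is measurable, up to a null set. -/
theorem aemeasurable_upperDensity (hp : 1 < p) (hΩ : IsOpen Ω) {β : ℝ≥0}
    {ν : Measure (E d)} [IsFiniteMeasure ν] (hν : ν ≪ volume) (hG : GrowthBound Ω p L β ν)
    (u : Sobolev Ω p m) (hu : ∀ᵐ x ∂(volume.restrict Ω),
      lowerDensity Ω p L u.toFun x = upperDensity Ω p L u.toFun x) :
    AEMeasurable (upperDensity Ω p L u.toFun) (volume.restrict Ω) := by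
  have := u.isFiniteMeasure_growthMeasure (ν := ν) hp
  set μ := u.growthMeasure ν with hμ
  set G : E d → ℝ≥0∞ := fun x => ⨆ n : ℕ, ⨅ (r : ℝ) (_ : 0 < r ∧ r < 1 / (n + 1 : ℝ) ∧ cube x r ⊆ Ω),
    (β * μ (cube x r) - upperInf Ω p L u.toFun (cube x r)) / ENNReal.ofReal r ^ d with hGdef
  have hGm : Measurable G := Measurable.iSup fun n => measurable_iInf_cube (Ω := Ω)
    (κ := fun x r => β * μ (cube x r) - upperInf Ω p L u.toFun (cube x r))
    fun x y r r' h1 h2 h3 => hG.defect_mono hp u h1 h2 h3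
  have h1 := ae_restrict_of_ae (s := Ω) (ae_tendsto_measure_closedCube μ)
  have h2 := ae_restrict_of_ae (s := Ω) (μ.rnDeriv_lt_top volume)
  -- Where the two densities agree, the quotients converge, so `G` is the density of `β μ` minus
  -- that of `u`. Subtracting `G` recovers the latter, because it is at most the finite density of
  -- `β μ`.
  refine ⟨fun x => β * μ.rnDeriv volume x - G x,
    (((μ.measurable_rnDeriv volume).const_mul _).sub hGm), ?_⟩
  filter_upwards [h1, h2, hu, ae_restrict_mem hΩ.measurableSet] with x hD hDt hx hxΩ
  have hle := upperDensity_le_of_tendsto hG hΩ hxΩ hD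
  have hβD : β * μ.rnDeriv volume x ≠ ⊤ := ENNReal.mul_ne_top ENNReal.coe_ne_top hDt.ne
  have hf : Tendsto (fun r : ℝ => upperInf Ω p L u.toFun (cube x r) / ENNReal.ofReal r ^ d) (𝓝[>] 0)
      (𝓝 (upperDensity Ω p L u.toFun x)) := by
    refine tendsto_of_le_liminf_of_limsup_le (hx ▸ liminf_le_liminf ?_) le_rfl
    exact Eventually.of_forall fun r => ENNReal.div_le_div_right (lowerInf_le_upperInf _ _) _
  have hκ := ENNReal.Tendsto.sub (ENNReal.Tendsto.const_mul (a := (β : ℝ≥0∞)) hD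
    (Or.inr ENNReal.coe_ne_top)) hf (Or.inl hβD)
  have hGx : G x = β * μ.rnDeriv volume x - upperDensity Ω p L u.toFun x := by
    rw [hGdef]
    simp only
    rw [iSup_iInf_cube_eq_liminf hΩ hxΩ, ← hκ.liminf_eq]
    refine liminf_congr (eventually_mem_nhdsWithin.mono fun r hr => ?_)
    have hr : 0 < r := hr
    have e : μ (cube x r) = μ (closedCube x r) := by
      refine le_antisymm (measure_mono (cube_subset_closedCube x r)) ?_
      rw [← measure_sdiff_null (s := closedCube x r)
        (u.growthMeasure_absolutelyContinuous hν (volume_closedCube_diff_cube x hr))]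
      exact measure_mono fun y hy => by_contra fun h => hy.2 ⟨hy.1, h⟩
    rw [e, div_eq_mul_inv, ENNReal.sub_mul fun _ _ => ENNReal.inv_ne_top.2 (ofReal_pow_ne_zero hr),
      div_eq_mul_inv, div_eq_mul_inv, mul_assoc]
  rw [hGx, ENNReal.sub_sub_cancel hβD hle]

end Homogenization

/-! ### Vitali coverings and the lower bound on a single cube -/

namespace Homogenization

variable {d m : ℕ} {Ω : Set (E d)} {p : ℝ} {L : E d → Mat m d → ℝ≥0} {ε : ℝ}

/-- A Vitali covering theorem for cubes. -/
theorem exists_disjoint_closedCube_covering {O : Set (E d)} (hO : IsOpen O) {P : E d → ℝ → Prop}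
    (hP : ∀ᵐ x ∂(volume.restrict O), ∀ᶠ r in 𝓝[>] 0, P x r) {η : ℝ} (hη : 0 < η) :
    ∃ (t : Set (E d)) (r : E d → ℝ), t.Countable ∧
      (∀ x ∈ t, 0 < r x ∧ r x < η ∧ closedCube x (r x) ⊆ O ∧ P x (r x)) ∧
      t.PairwiseDisjoint (fun x => closedCube x (r x)) ∧
      volume (O \ ⋃ x ∈ t, cube x (r x)) = 0 := by
  have hmp := PiLp.volume_preserving_ofLp (Fin d)
  have hme : MeasurableEmbedding (WithLp.ofLp : E d → Fin d → ℝ) :=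
    (MeasurableEquiv.toLp 2 (Fin d → ℝ)).symm.measurableEmbedding
  have hsurj : ∀ y : Fin d → ℝ, WithLp.ofLp (WithLp.toLp 2 y : E d) = y := fun _ => rfl
  set S : Set (E d) := {x | x ∈ O ∧ ∀ᶠ r in 𝓝[>] 0, P x r} with hS
  have hSO : volume (O \ S) = 0 := by
    rw [ae_restrict_iff' hO.measurableSet] at hP
    refine measure_mono_null (fun x hx => ?_) hP
    exact fun h => hx.2 ⟨hx.1, h hx.1⟩
  -- Besicovitch's covering theorem is applied to balls of the sup norm, so an admissible radius `ρ`
  -- stands for a cube of side `2 * ρ`.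
  let R : (Fin d → ℝ) → Set ℝ := fun y => {ρ | 0 < 2 * ρ ∧ 2 * ρ < η ∧
    closedCube (WithLp.toLp 2 y : E d) (2 * ρ) ⊆ O ∧ P (WithLp.toLp 2 y) (2 * ρ)}
  have hR : ∀ y ∈ (WithLp.ofLp '' S : Set (Fin d → ℝ)), ∀ δ > 0, (R y ∩ Ioo 0 δ).Nonempty := by
    rintro _ ⟨x, ⟨hxO, hx⟩, rfl⟩ δ hδ
    have hev : ∀ᶠ r in 𝓝[>] (0 : ℝ), 0 < r ∧ r < η ∧ closedCube x r ⊆ O ∧ P x r := by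
      filter_upwards [hx, eventually_closedCube_subset hO hxO, Ioo_mem_nhdsGT hη] with r h1 h2 h3
        using ⟨h3.1, h3.2, h2, h1⟩
    have ht : Tendsto (fun r : ℝ => 2 * r) (𝓝[>] 0) (𝓝[>] 0) :=
      (map_mul_left_nhdsGT_zero two_pos).le
    have hIoo : ∀ᶠ r in 𝓝[>] (0 : ℝ), r ∈ Ioo 0 δ := Ioo_mem_nhdsGT hδ
    obtain ⟨ρ, h1, h2⟩ := ((ht.eventually hev).and hIoo).exists
    exact ⟨ρ, h1, h2⟩
  obtain ⟨t', r', ht'c, ht'S, hr', hcov, hdis⟩ := Besicovitch.exists_disjoint_closedBall_covering_ae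
    (volume : Measure (Fin d → ℝ)) R _ hR (fun _ => 1) fun _ _ => one_pos
  set t : Set (E d) := WithLp.ofLp ⁻¹' t' with ht
  set r : E d → ℝ := fun x => 2 * r' (WithLp.ofLp x) with hr
  have hprop : ∀ x ∈ t, 0 < r x ∧ r x < η ∧ closedCube x (r x) ⊆ O ∧ P x (r x) := fun x hx =>
    (hr' _ hx).1
  have hball : ∀ x ∈ t, closedCube x (r x) =
      WithLp.ofLp ⁻¹' Metric.closedBall (WithLp.ofLp x) (r' (WithLp.ofLp x)) := fun x hx => by
    rw [closedCube_eq_preimage_closedBall x (hprop x hx).1.le, hr]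
    simp
  have htc : t.Countable := ht'c.preimage (WithLp.ofLp_injective 2)
  refine ⟨t, r, htc, hprop, fun x hx y hy hxy => ?_, ?_⟩
  · simp only [Function.onFun]
    rw [hball x hx, hball y hy]
    exact (hdis hx hy fun h => hxy (WithLp.ofLp_injective 2 h)).preimage _
  · have h1 : volume (S \ ⋃ x ∈ t, closedCube x (r x)) = 0 := by
      have h2 : volume (WithLp.ofLp ⁻¹' ((WithLp.ofLp '' S : Set (Fin d → ℝ)) \
          ⋃ x ∈ t', Metric.closedBall x (r' x)) : Set (E d)) = 0 := by
        rw [← hme.map_apply, hmp.map_eq, hcov]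
      refine measure_mono_null (fun x hx => ?_) h2
      refine mem_preimage.2 ⟨mem_image_of_mem _ hx.1, fun h => hx.2 ?_⟩
      obtain ⟨y, hy, hxy⟩ := mem_iUnion₂.1 h
      refine mem_iUnion₂.2 ⟨WithLp.toLp 2 y, hy, ?_⟩
      rw [hball _ hy]
      exact hxy
    have h3 : volume (⋃ x ∈ t, closedCube x (r x) \ cube x (r x)) = 0 :=
      (measure_biUnion_null_iff htc).2 fun x hx => volume_closedCube_diff_cube x (hprop x hx).1
    refine measure_mono_null (fun x hx => ?_) (measure_union_null (measure_union_null hSO h1) h3)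
    by_cases hxS : x ∈ S
    · by_cases hxc : x ∈ ⋃ x ∈ t, closedCube x (r x)
      · obtain ⟨y, hy, hxy⟩ := mem_iUnion₂.1 hxc
        exact Or.inr (mem_iUnion₂.2 ⟨y, hy, hxy, fun h => hx.2 (mem_iUnion₂.2 ⟨y, hy, h⟩)⟩)
      · exact Or.inl (Or.inr ⟨hxS, hxc⟩)
    · exact Or.inl (Or.inl ⟨hx.1, hxS⟩)

lemma ConvergesLp.tendsto_lintegral (hp : 1 < p) {v : ℝ → Sobolev Ω p m} {u : Sobolev Ω p m}
    (h : ConvergesLp v u) :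
    Tendsto (fun ε => ∫⁻ x in Ω, ‖(v ε).toFun x - u.toFun x‖ₑ ^ p) (𝓝[>] 0) (𝓝 0) := by
  have hp0 : 0 < p := by linarith
  have h1 := ((ENNReal.continuous_rpow_const (y := p)).tendsto 0).comp h
  rw [ENNReal.zero_rpow_of_pos hp0] at h1
  refine h1.congr fun ε => ?_
  rw [Function.comp_apply, eLpNorm_eq_rpow hp, ← ENNReal.rpow_mul, one_div,
    inv_mul_cancel₀ hp0.ne', ENNReal.rpow_one]

/-- The outer cube is open, so the removed closed cubes exhaust it and the remaining sets decrease
to the empty set. -/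
lemma tendsto_measure_cube_diff_closedCube {μ : Measure (E d)} [IsFiniteMeasure μ] (x : E d) {r : ℝ}
    (hr : 0 < r) :
    Tendsto (fun n : ℕ => μ (cube x r \ closedCube x (r - r / (n + 2)))) atTop (𝓝 0) := by
  have hanti : Antitone fun n : ℕ => cube x r \ closedCube x (r - r / (n + 2)) := fun a b hab =>
    sdiff_subset_sdiff_right (closedCube_mono x (by gcongr))
  have h := tendsto_measure_iInter_atTop (μ := μ) (fun n : ℕ => ((measurableSet_cube x r).diff
    (measurableSet_closedCube x (r - r / (n + 2)))).nullMeasurableSet) hanti ⟨0, measure_ne_top _ _⟩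
  have he : ⋂ n : ℕ, cube x r \ closedCube x (r - r / (n + 2)) = ∅ := by
    refine eq_empty_of_forall_notMem fun y hy => ?_
    rw [mem_iInter] at hy
    have hyc := (hy 0).1
    have hlim : Tendsto (fun n : ℕ => (r - r / (n + 2)) / 2) atTop (𝓝 (r / 2)) := by
      have h1 : Tendsto (fun n : ℕ => r / ((n : ℝ) + 2)) atTop (𝓝 0) :=
        tendsto_const_nhds.div_atTop (tendsto_atTop_add_const_right _ _ tendsto_natCast_atTop_atTop)
      simpa using (tendsto_const_nhds.sub h1).div_const 2
    have hev : ∀ᶠ n : ℕ in atTop, ∀ i, |y i - x i| ≤ (r - r / (n + 2)) / 2 :=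
      eventually_all.2 fun i => (hlim.eventually (lt_mem_nhds (hyc i))).mono fun n hn => hn.le
    obtain ⟨n, hn⟩ := hev.exists
    exact (hy n).2 hn
  rw [he, measure_empty] at h
  exact h

/-- Along families converging in `L^p`, the energies on a cube are asymptotically at least the local
Dirichlet infima of the limit. -/
lemma lowerInf_le_liminf_energy (hp : 1 < p) (hΩ : IsOpen Ω) {β : ℝ≥0} {ν : Measure (E d)}
    [IsFiniteMeasure ν] (hG : GrowthBound Ω p L β ν) {α : ℝ} (hα : 0 < α)
    (hcoer : ∀ x ξ, α * ‖ξ‖ ^ p ≤ (L x ξ : ℝ)) {v : ℝ → Sobolev Ω p m} {u : Sobolev Ω p m}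
    (hv : ConvergesLp v u) {x : E d} {r : ℝ} (hr : 0 < r) (hQ : cube x r ⊆ Ω) :
    lowerInf Ω p L u.toFun (cube x r) ≤ liminf (fun ε => energy L ε (cube x r) (v ε)) (𝓝[>] 0) := by
  have hp0 : 0 < p := by linarith
  have := u.isFiniteMeasure_growthMeasure (ν := ν) hp
  obtain ⟨C, hC, h⟩ := hG.exists_dirichletInf_le_energy hp hΩ hα hcoer
  set ℓ := liminf (fun ε => energy L ε (cube x r) (v ε)) (𝓝[>] 0) with hℓ
  rcases eq_or_ne ℓ ⊤ with htop | htop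
  · rw [htop]; exact le_top
  -- Three successive limits: first `ε → 0` with `N` and `a` fixed, so that the large constant `K`
  -- multiplies a quantity tending to zero; then `a → r`, which removes the growth measure of the
  -- boundary region; finally `N → ∞`.
  have h1 : ∀ N : ℕ, 0 < N → ∀ a, 0 < a → a < r → lowerInf Ω p L u.toFun (cube x r) ≤
      (1 + C / N) * ℓ + C * u.growthMeasure ν (cube x r \ closedCube x a) := by
    intro N hN a ha har
    have hNt : 1 + C / N ≠ ⊤ := ENNReal.add_ne_top.2 ⟨by simp,
      ENNReal.div_ne_top hC (by exact_mod_cast hN.ne')⟩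
    set K : ℝ≥0∞ := 1 + ENNReal.ofReal (N / (r - a)) ^ p with hK
    have hKt : K ≠ ⊤ := ENNReal.add_ne_top.2 ⟨by simp, ENNReal.rpow_ne_top_of_nonneg hp0.le (by simp)⟩
    have hRm : MeasurableSet (cube x r \ closedCube x a) :=
      (measurableSet_cube x r).diff (measurableSet_closedCube x a)
    have hRΩ : cube x r \ closedCube x a ⊆ Ω := sdiff_subset.trans hQ
    have hlim : Tendsto (fun ε => C * (u.growthMeasure ν (cube x r \ closedCube x a) +
        K * ∫⁻ x in Ω, ‖(v ε).toFun x - u.toFun x‖ₑ ^ p)) (𝓝[>] 0)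
        (𝓝 (C * u.growthMeasure ν (cube x r \ closedCube x a))) := by
      have := ENNReal.Tendsto.const_mul (a := C) (tendsto_const_nhds
        (x := u.growthMeasure ν (cube x r \ closedCube x a)) |>.add
        (ENNReal.Tendsto.const_mul (hv.tendsto_lintegral hp) (Or.inr hKt))) (Or.inr hC)
      simpa using this
    rw [hℓ, ← ENNReal.liminf_const_mul_of_ne_top hNt]
    refine liminf_le_liminf_add ?_ hlim.limsup_eq.le
    filter_upwards [eventually_le_one_nhdsGT] with ε hε
    refine (h ε x a r N (v ε) u hε.1 hε.2 ha har hN hQ).trans ?_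
    rw [u.growthMeasure_apply hRm hRΩ, ← add_assoc]
    gcongr
  have h2 : ∀ N : ℕ, 0 < N → lowerInf Ω p L u.toFun (cube x r) ≤ (1 + C / N) * ℓ := by
    intro N hN
    have hlim := (tendsto_const_nhds (x := (1 + C / N) * ℓ)).add (ENNReal.Tendsto.const_mul
      (tendsto_measure_cube_diff_closedCube (μ := u.growthMeasure ν) x hr) (Or.inr hC))
    rw [mul_zero, add_zero] at hlim
    refine ge_of_tendsto hlim (Eventually.of_forall fun n => h1 N hN _ ?_ ?_)
    · have : r / (n + 2) < r := div_lt_self hr (by have := n.cast_nonneg (α := ℝ); linarith)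
      linarith
    · have : 0 < r / (n + 2) := by positivity
      linarith
  have hlim : Tendsto (fun N : ℕ => (1 + C / N) * ℓ) atTop (𝓝 ((1 + 0) * ℓ)) := by
    refine ENNReal.Tendsto.mul_const (tendsto_const_nhds.add ?_) (Or.inr htop)
    simpa [div_eq_mul_inv] using
      ENNReal.Tendsto.const_mul ENNReal.tendsto_inv_nat_nhds_zero (Or.inr hC)
  rw [add_zero, one_mul] at hlim
  exact ge_of_tendsto hlim ((eventually_gt_atTop 0).mono h2)

end Homogenization

/-! ### Summation over cubes and the lower bound -/

namespace Homogenization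

variable {d m : ℕ} {Ω : Set (E d)} {p : ℝ} {L : E d → Mat m d → ℝ≥0} {ε : ℝ}

/-- Fatou's lemma for the counting measure. -/
lemma tsum_liminf_le {ι κ : Type*} {l : Filter ι} [l.IsCountablyGenerated] (f : ι → κ → ℝ≥0∞) :
    ∑' k, liminf (fun i => f i k) l ≤ liminf (fun i => ∑' k, f i k) l := by
  let _ : MeasurableSpace κ := ⊤
  simpa only [lintegral_count' measurable_from_top] using
    lintegral_liminf_le (μ := Measure.count) (u := l) (f := f) fun _ => measurable_from_top

lemma tsum_sub_eq {κ : Type*} {f g : κ → ℝ≥0∞} (hg : ∑' k, g k ≠ ⊤) (h : ∀ k, g k ≤ f k) :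
    ∑' k, (f k - g k) = ∑' k, f k - ∑' k, g k := by
  refine ENNReal.eq_sub_of_add_eq hg ?_
  rw [← ENNReal.tsum_add]
  exact tsum_congr fun k => tsub_add_cancel_of_le (h k)

/-- The reverse Fatou lemma: apply `tsum_liminf_le` to the differences `g - f`, the summability of
`g` allowing every subtraction. -/
lemma limsup_tsum_le {ι κ : Type*} {l : Filter ι} [l.IsCountablyGenerated] [l.NeBot]
    {f : ι → κ → ℝ≥0∞} {g : κ → ℝ≥0∞} (hfg : ∀ᶠ i in l, ∀ k, f i k ≤ g k) (hg : ∑' k, g k ≠ ⊤) :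
    limsup (fun i => ∑' k, f i k) l ≤ ∑' k, limsup (fun i => f i k) l := by
  have hgk : ∀ k, g k ≠ ⊤ := fun k => ENNReal.ne_top_of_tsum_ne_top hg k
  have hls : ∀ k, limsup (fun i => f i k) l ≤ g k := fun k =>
    limsup_le_of_le (by isBoundedDefault) (hfg.mono fun i h => h k)
  have hmap : ∀ (c : ℝ≥0∞), c ≠ ⊤ → ∀ u : ι → ℝ≥0∞,
      c - limsup u l = liminf (fun i => c - u i) l := fun c hc u =>
    (show Antitone fun a : ℝ≥0∞ => c - a from fun a b h => tsub_le_tsub_left h c).map_limsup_of_continuousAt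
      u (ENNReal.continuous_sub_left hc).continuousAt
  have hsl : ∑' k, limsup (fun i => f i k) l ≤ ∑' k, g k := ENNReal.tsum_le_tsum hls
  have h1 : (∑' k, g k) - ∑' k, limsup (fun i => f i k) l ≤
      (∑' k, g k) - limsup (fun i => ∑' k, f i k) l := by
    rw [← tsum_sub_eq (ne_top_of_le_ne_top hg hsl) hls, hmap _ hg]
    simp only [fun k => hmap (g k) (hgk k)]
    refine (tsum_liminf_le _).trans (liminf_le_liminf (hfg.mono fun i hi => ?_))
    have hfi : ∑' k, f i k ≤ ∑' k, g k := ENNReal.tsum_le_tsum hi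
    rw [tsum_sub_eq (ne_top_of_le_ne_top hg hfi) hi]
  have h2 : limsup (fun i => ∑' k, f i k) l ≤ ∑' k, g k :=
    limsup_le_of_le (by isBoundedDefault) (hfg.mono fun i h => ENNReal.tsum_le_tsum h)
  rw [← ENNReal.sub_sub_cancel hg h2, ← ENNReal.sub_sub_cancel hg hsl]
  exact tsub_le_tsub_left h1 _

lemma eventually_le_add_mul_of_tendsto {a b : ℝ → ℝ≥0∞} {n : ℕ} {c δ : ℝ≥0∞} (hc : c ≠ ⊤) (hδ : δ ≠ 0)
    (ha : Tendsto (fun r => a r / ENNReal.ofReal r ^ n) (𝓝[>] 0) (𝓝 c))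
    (hb : Tendsto (fun r => b r / ENNReal.ofReal r ^ n) (𝓝[>] 0) (𝓝 c)) :
    ∀ᶠ r in 𝓝[>] 0, a r ≤ b r + δ * ENNReal.ofReal r ^ n := by
  have h1 := ha.eventually_lt (hb.add (tendsto_const_nhds (x := δ))) (ENNReal.lt_add_right hc hδ)
  filter_upwards [h1, eventually_mem_nhdsWithin] with r h hr
  have hr : 0 < r := hr
  have h0 : ENNReal.ofReal r ^ n ≠ 0 := ofReal_pow_ne_zero hr
  have ht : ENNReal.ofReal r ^ n ≠ ⊤ := ofReal_pow_ne_top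
  have h2 := (ENNReal.div_le_iff h0 ht).1 h.le
  rwa [add_mul, ENNReal.div_mul_cancel h0 ht] at h2

section Densities

variable {u : Sobolev Ω p m}

/-- The growth bound dominates the upper density by `β` times the density of a finite measure. -/
lemma lintegral_upperDensity_ne_top (hp : 1 < p) (hΩ : IsOpen Ω) {β : ℝ≥0}
    {ν : Measure (E d)} [IsFiniteMeasure ν] (hG : GrowthBound Ω p L β ν) (u : Sobolev Ω p m) :
    ∫⁻ x in Ω, upperDensity Ω p L u.toFun x ≠ ⊤ := by
  have := u.isFiniteMeasure_growthMeasure (ν := ν) hp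
  set μ := u.growthMeasure ν
  have h1 := ae_restrict_of_ae (s := Ω) (ae_tendsto_measure_closedCube μ)
  have h2 : ∫⁻ x in Ω, upperDensity Ω p L u.toFun x ≤ ∫⁻ x in Ω, β * μ.rnDeriv volume x := by
    refine lintegral_mono_ae ?_
    filter_upwards [h1, ae_restrict_mem hΩ.measurableSet] with x hD hx
    exact upperDensity_le_of_tendsto hG hΩ hx hD
  refine ne_top_of_le_ne_top ?_ h2
  rw [lintegral_const_mul _ (μ.measurable_rnDeriv volume)]
  refine ENNReal.mul_ne_top ENNReal.coe_ne_top (ne_top_of_le_ne_top (measure_ne_top μ univ) ?_)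
  exact (setLIntegral_le_lintegral _ _).trans Measure.lintegral_rnDeriv_le

/-- At almost every point the integral of the upper density and the lower and upper infima have the
same finite density on cubes, so they differ by at most `δ` times the volume once the cube is small.
These are the cubes selected in the Vitali coverings. -/
lemma ae_eventually_close (hΩ : IsOpen Ω)
    (hm : AEMeasurable (upperDensity Ω p L u.toFun) (volume.restrict Ω))
    (hfin : ∫⁻ x in Ω, upperDensity Ω p L u.toFun x ≠ ⊤)
    (hu : ∀ᵐ x ∂(volume.restrict Ω), lowerDensity Ω p L u.toFun x = upperDensity Ω p L u.toFun x ∧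
      upperDensity Ω p L u.toFun x ≠ ⊤) {δ : ℝ≥0∞} (hδ : δ ≠ 0) :
    ∀ᵐ x ∂(volume.restrict Ω), ∀ᶠ r in 𝓝[>] (0 : ℝ),
      ∫⁻ y in cube x r, upperDensity Ω p L u.toFun y ≤
        lowerInf Ω p L u.toFun (cube x r) + δ * volume (cube x r) ∧
      upperInf Ω p L u.toFun (cube x r) ≤
        (∫⁻ y in cube x r, upperDensity Ω p L u.toFun y) + δ * volume (cube x r) := by
  filter_upwards [ae_tendsto_lintegral_closedCube hΩ.measurableSet hm hfin, hu,
    ae_restrict_mem hΩ.measurableSet] with x h1 ⟨h2, h3⟩ hx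
  have hlu : ∀ r : ℝ, lowerInf Ω p L u.toFun (cube x r) / ENNReal.ofReal r ^ d ≤
      upperInf Ω p L u.toFun (cube x r) / ENNReal.ofReal r ^ d := fun r =>
    ENNReal.div_le_div_right (lowerInf_le_upperInf _ _) _
  have hup : Tendsto (fun r : ℝ => upperInf Ω p L u.toFun (cube x r) / ENNReal.ofReal r ^ d) (𝓝[>] 0)
      (𝓝 (upperDensity Ω p L u.toFun x)) :=
    tendsto_of_le_liminf_of_limsup_le (h2 ▸ liminf_le_liminf (Eventually.of_forall hlu)) le_rfl
  have hlo : Tendsto (fun r : ℝ => lowerInf Ω p L u.toFun (cube x r) / ENNReal.ofReal r ^ d) (𝓝[>] 0)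
      (𝓝 (upperDensity Ω p L u.toFun x)) :=
    tendsto_of_le_liminf_of_limsup_le h2.ge (limsup_le_limsup (Eventually.of_forall hlu))
  filter_upwards [eventually_le_add_mul_of_tendsto h3 hδ h1 hlo,
    eventually_le_add_mul_of_tendsto h3 hδ hup h1, eventually_closedCube_subset hΩ hx,
    eventually_mem_nhdsWithin] with r h4 h5 hcc hr
  have hr : 0 < r := hr
  have e : ∫⁻ y in cube x r, upperDensity Ω p L u.toFun y =
      ∫⁻ y in closedCube x r, upperDensity Ω p L u.toFun y := by
    refine setLIntegral_congr ?_
    have := ae_le_set.2 (volume_closedCube_diff_cube x hr)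
    exact (LE.le.eventuallyLE (cube_subset_closedCube x r)).antisymm this
  rw [inter_eq_left.2 hcc] at h4 h5
  rw [e, volume_cube x hr]
  exact ⟨h4, h5⟩

/-- The lower bound for the `Γ`-limit. -/
theorem lintegral_upperDensity_le_liminf (hp : 1 < p) (hΩ : IsOpen Ω) (hΩb : Bornology.IsBounded Ω)
    {β : ℝ≥0} {ν : Measure (E d)} [IsFiniteMeasure ν] (hG : GrowthBound Ω p L β ν) {α : ℝ} (hα : 0 < α)
    (hcoer : ∀ x ξ, α * ‖ξ‖ ^ p ≤ (L x ξ : ℝ))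
    (hm : AEMeasurable (upperDensity Ω p L u.toFun) (volume.restrict Ω))
    (hu : ∀ᵐ x ∂(volume.restrict Ω), lowerDensity Ω p L u.toFun x = upperDensity Ω p L u.toFun x ∧
      upperDensity Ω p L u.toFun x ≠ ⊤) {O : Set (E d)} (hO : IsOpen O) (hOΩ : O ⊆ Ω)
    {v : ℝ → Sobolev Ω p m} (hv : ConvergesLp v u) :
    ∫⁻ x in O, upperDensity Ω p L u.toFun x ≤ liminf (fun ε => energy L ε O (v ε)) (𝓝[>] 0) := by
  have hfin := lintegral_upperDensity_ne_top hp hΩ hG u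
  have hvol : volume Ω ≠ ⊤ := hΩb.measure_lt_top.ne
  have key : ∀ δ : ℝ≥0∞, δ ≠ 0 → ∫⁻ x in O, upperDensity Ω p L u.toFun x ≤
      liminf (fun ε => energy L ε O (v ε)) (𝓝[>] 0) + δ * volume Ω := by
    intro δ hδ
    obtain ⟨t, r, htc, ht, hdis, hcov⟩ := exists_disjoint_closedCube_covering hO
      (ae_restrict_of_ae_restrict_of_subset hOΩ (ae_eventually_close hΩ hm hfin hu hδ)) one_pos
    have hQO : ∀ x ∈ t, cube x (r x) ⊆ O := fun x hx =>
      (cube_subset_closedCube x _).trans (ht x hx).2.2.1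
    have hUO : ⋃ x ∈ t, cube x (r x) ⊆ O := iUnion₂_subset hQO
    have hdis' : t.PairwiseDisjoint fun x => cube x (r x) :=
      hdis.mono fun x => cube_subset_closedCube x _
    have hsum : ∀ f : E d → ℝ≥0∞, ∫⁻ x in ⋃ x ∈ t, cube x (r x), f x =
        ∑' x : t, ∫⁻ y in cube (x : E d) (r x), f y := fun f =>
      lintegral_biUnion htc (fun x _ => measurableSet_cube x _) hdis' f
    have hvs : ∑' x : t, volume (cube (x : E d) (r x)) ≤ volume Ω := by
      rw [← measure_biUnion htc hdis' fun x _ => measurableSet_cube x _]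
      exact measure_mono (hUO.trans hOΩ)
    calc ∫⁻ x in O, upperDensity Ω p L u.toFun x
        ≤ ∫⁻ x in ⋃ x ∈ t, cube x (r x), upperDensity Ω p L u.toFun x :=
          lintegral_mono' (Measure.restrict_mono_ae (ae_le_set.2 hcov)) le_rfl
      _ = ∑' x : t, ∫⁻ y in cube (x : E d) (r x), upperDensity Ω p L u.toFun y := hsum _
      _ ≤ ∑' x : t, (liminf (fun ε => energy L ε (cube (x : E d) (r x)) (v ε)) (𝓝[>] 0) +
          δ * volume (cube (x : E d) (r x))) := by
          refine ENNReal.tsum_le_tsum fun x => ((ht x x.2).2.2.2.1).trans ?_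
          gcongr
          exact lowerInf_le_liminf_energy hp hΩ hG hα hcoer hv (ht x x.2).1 ((hQO x x.2).trans hOΩ)
      _ = ∑' x : t, liminf (fun ε => energy L ε (cube (x : E d) (r x)) (v ε)) (𝓝[>] 0) +
          δ * ∑' x : t, volume (cube (x : E d) (r x)) := by
          rw [ENNReal.tsum_add, ENNReal.tsum_mul_left]
      _ ≤ liminf (fun ε => energy L ε O (v ε)) (𝓝[>] 0) + δ * volume Ω := by
          gcongr
          refine (tsum_liminf_le _).trans (liminf_le_liminf (Eventually.of_forall fun ε => ?_))
          simp only [energy]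
          rw [← hsum fun y => (L (ε⁻¹ • y) ((v ε).grad y) : ℝ≥0∞)]
          exact lintegral_mono_set hUO
  have hlim : Tendsto (fun n : ℕ => liminf (fun ε => energy L ε O (v ε)) (𝓝[>] 0) +
      (n : ℝ≥0∞)⁻¹ * volume Ω) atTop
      (𝓝 (liminf (fun ε => energy L ε O (v ε)) (𝓝[>] 0) + 0 * volume Ω)) :=
    tendsto_const_nhds.add
      (ENNReal.Tendsto.mul_const ENNReal.tendsto_inv_nat_nhds_zero (Or.inr hvol))
  rw [zero_mul, add_zero] at hlim
  exact ge_of_tendsto' hlim fun n => key _ (by simp)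

end Densities

end Homogenization

/-! ### Countable gluing of Sobolev functions -/

namespace Homogenization

variable {d m : ℕ} {Ω : Set (E d)} {p : ℝ} {L : E d → Mat m d → ℝ≥0} {ε : ℝ}

lemma exists_glue {ι α F : Type*} [Zero F] {Q : ι → Set α} (hdis : Pairwise (Function.onFun Disjoint Q))
    (f : ι → α → F) : ∃ g : α → F, (∀ i, ∀ y ∈ Q i, g y = f i y) ∧ ∀ y, y ∉ ⋃ i, Q i → g y = 0 := by
  classical
  refine ⟨fun y => if h : ∃ i, y ∈ Q i then f h.choose y else 0, fun i y hy => ?_, fun y hy => ?_⟩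
  · have h : ∃ i, y ∈ Q i := ⟨i, hy⟩
    have e : h.choose = i := by
      by_contra hne
      exact disjoint_left.1 (hdis hne) h.choose_spec hy
    simp only [h, dif_pos]
    rw [e]
  · exact dif_neg fun h => hy (mem_iUnion.2 h)

lemma lintegral_glue {ι F : Type*} [Countable ι] [NormedAddCommGroup F] {Q : ι → Set (E d)}
    (hQ : ∀ i, MeasurableSet (Q i)) (hΩ : ∀ i, Q i ⊆ Ω) (hdis : Pairwise (Function.onFun Disjoint Q))
    (hp : 0 < p) {f : ι → E d → F} {g : E d → F} (hg : ∀ i, ∀ y ∈ Q i, g y = f i y)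
    (hg0 : ∀ y, y ∉ ⋃ i, Q i → g y = 0) :
    ∫⁻ y in Ω, ‖g y‖ₑ ^ p = ∑' i, ∫⁻ y in Q i, ‖f i y‖ₑ ^ p := by
  have hU : MeasurableSet (⋃ i, Q i) := MeasurableSet.iUnion hQ
  have h1 := setLIntegral_eq_of_ae_eq_zero hU (F := fun y => ‖g y‖ₑ ^ p)
    (ae_of_all _ fun y hy => by simp [hg0 y hy, hp])
  have h2 : ∫⁻ y in Ω, ‖g y‖ₑ ^ p = ∫⁻ y in ⋃ i, Q i, ‖g y‖ₑ ^ p :=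
    le_antisymm ((setLIntegral_le_lintegral _ _).trans h1.ge) (lintegral_mono_set (iUnion_subset hΩ))
  rw [h2, lintegral_iUnion hQ hdis]
  exact tsum_congr fun i => setLIntegral_congr_fun (hQ i) fun y hy => by simp only [hg i y hy]

lemma memLp_glue {ι F : Type*} [Countable ι] [NormedAddCommGroup F] {Q : ι → Set (E d)}
    (hQ : ∀ i, MeasurableSet (Q i)) (hΩ : ∀ i, Q i ⊆ Ω) (hdis : Pairwise (Function.onFun Disjoint Q))
    (hp : 1 < p) {f : ι → E d → F} {g : E d → F} (hg : ∀ i, ∀ y ∈ Q i, g y = f i y)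
    (hg0 : ∀ y, y ∉ ⋃ i, Q i → g y = 0)
    (hf : ∀ i, MemLp (f i) (ENNReal.ofReal p) (volume.restrict Ω))
    (hs : ∑' i, ∫⁻ y in Q i, ‖f i y‖ₑ ^ p ≠ ⊤) : MemLp g (ENNReal.ofReal p) (volume.restrict Ω) := by
  have hp0 : 0 < p := by linarith
  have hU : MeasurableSet (⋃ i, Q i) := MeasurableSet.iUnion hQ
  constructor
  · have hi : g = (⋃ i, Q i).indicator g := by
      funext y
      by_cases hy : y ∈ ⋃ i, Q i
      · rw [indicator_of_mem hy]
      · rw [indicator_of_notMem hy, hg0 y hy]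
    rw [hi]
    refine ((aestronglyMeasurable_indicator_iff hU).2
      (aestronglyMeasurable_iUnion_iff.2 fun i => ?_)).mono_measure Measure.restrict_le_self
    refine ((hf i).1.mono_measure (Measure.restrict_mono (hΩ i) le_rfl)).congr ?_
    exact ae_restrict_of_forall_mem (hQ i) fun y hy => (hg i y hy).symm
  · rw [eLpNorm_lt_top_iff_lintegral_rpow_enorm_lt_top (by simpa using hp0) ENNReal.ofReal_ne_top,
      ENNReal.toReal_ofReal hp0.le, lintegral_glue hQ hΩ hdis hp0 hg hg0]
    exact hs.lt_top

namespace Sobolev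

lemma ae_eq_zero_compl_cube (hp : 1 < p) (hΩ : IsOpen Ω) (z : Sobolev Ω p m) {x : E d} {r : ℝ}
    (hr : 0 < r) (hz : ∀ᵐ y ∂(volume.restrict (Ω \ cube x r)), z.toFun y = 0) :
    ∀ᵐ y ∂(volume.restrict Ω), y ∉ cube x r → z.toFun y = 0 ∧ z.grad y = 0 := by
  have hQ := measurableSet_cube x r
  have hA : IsOpen (Ω \ closedCube x r) := hΩ.sdiff (isClosed_closedCube x r)
  have h1 := z.grad_ae_eq_zero hp hA sdiff_subset (ae_restrict_of_ae_restrict_of_subset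
    (sdiff_subset_sdiff_right (cube_subset_closedCube x r)) hz)
  rw [ae_restrict_iff' (hΩ.measurableSet.diff hQ)] at hz
  rw [ae_restrict_iff' hA.measurableSet] at h1
  rw [ae_restrict_iff' hΩ.measurableSet]
  have h0 : ∀ᵐ y, y ∉ closedCube x r \ cube x r :=
    measure_eq_zero_iff_ae_notMem.1 (volume_closedCube_diff_cube x hr)
  filter_upwards [hz, h1, h0] with y h2 h3 h4 hyΩ hyQ
  exact ⟨h2 ⟨hyΩ, hyQ⟩, h3 ⟨hyΩ, fun h => h4 ⟨h, hyQ⟩⟩⟩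

/-- The sum of Sobolev functions supported in disjoint cubes. -/
lemma exists_glue (hp : 1 < p) (hΩ : IsOpen Ω) {ι : Type*} [Countable ι] {x : ι → E d} {r : ι → ℝ}
    (hr : ∀ i, 0 < r i) (hQΩ : ∀ i, cube (x i) (r i) ⊆ Ω)
    (hdis : Pairwise (Function.onFun Disjoint fun i => cube (x i) (r i))) (z : ι → Sobolev Ω p m)
    (hz : ∀ i, ∀ᵐ y ∂(volume.restrict (Ω \ cube (x i) (r i))), (z i).toFun y = 0)
    (hs : ∑' i, ∫⁻ y in cube (x i) (r i), ‖(z i).toFun y‖ₑ ^ p ≠ ⊤)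
    (hs' : ∑' i, ∫⁻ y in cube (x i) (r i), ‖(z i).grad y‖ₑ ^ p ≠ ⊤) :
    ∃ Z : Sobolev Ω p m, (∀ i, ∀ y ∈ cube (x i) (r i), Z.toFun y = (z i).toFun y ∧
      Z.grad y = (z i).grad y) ∧ ∀ y, y ∉ ⋃ i, cube (x i) (r i) → Z.toFun y = 0 := by
  have hp0 : 0 < p := by linarith
  have hq := one_le_ofReal hp
  have hQ := fun i => measurableSet_cube (x i) (r i)
  obtain ⟨f, hf, hf0⟩ := Homogenization.exists_glue hdis fun i => (z i).toFun
  obtain ⟨g, hg, hg0⟩ := Homogenization.exists_glue hdis fun i => (z i).grad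
  have mf := memLp_glue hQ hQΩ hdis hp hf hf0 (fun i => (z i).memLp_toFun) hs
  have mg := memLp_glue hQ hQΩ hdis hp hg hg0 (fun i => (z i).memLp_grad) hs'
  refine ⟨⟨f, g, mf, mg, fun φ h1 h2 h3 i j => ?_⟩, fun k y hy => ⟨hf k y hy, hg k y hy⟩, hf0⟩
  set U := ⋃ i, cube (x i) (r i) with hU
  have hUm : MeasurableSet U := MeasurableSet.iUnion hQ
  have hUΩ : U ⊆ Ω := iUnion_subset hQΩ
  have hI1 : Integrable (fun y => partialDeriv j φ y * f y i) (volume.restrict Ω) :=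
    integrable_mul_of_hasCompactSupport (continuous_partialDeriv h1 j)
      (hasCompactSupport_partialDeriv h2 j) ((mf.eval_piLp i).locallyIntegrable hq)
  have hI2 : Integrable (fun y => φ y * g y (i, j)) (volume.restrict Ω) :=
    integrable_mul_of_hasCompactSupport h1.continuous h2 ((mg.eval_piLp (i, j)).locallyIntegrable hq)
  have hsupp : ∀ F : E d → ℝ, (∀ y, y ∉ U → F y = 0) → ∫ y in Ω, F y = ∫ y in U, F y := fun F hF =>
    (setIntegral_eq_of_subset_of_forall_sdiff_eq_zero hΩ.measurableSet hUΩ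
      fun y hy => hF y hy.2)
  -- The support of `φ` may cross the boundary of the cube. The formula for `z k` on all of `Ω`
  -- nevertheless reduces to the cube, since `z k` and its gradient vanish almost everywhere outside
  -- it.
  have hk : ∀ k, ∫ y in cube (x k) (r k), partialDeriv j φ y * f y i =
      - ∫ y in cube (x k) (r k), φ y * g y (i, j) := by
    intro k
    have h4 := (z k).isWeakGradient φ h1 h2 h3 i j
    have h5 := ae_eq_zero_compl_cube hp hΩ (z k) (hr k) (hz k)
    rw [ae_restrict_iff' hΩ.measurableSet] at h5
    rw [setIntegral_eq_of_subset_of_ae_sdiff_eq_zero hΩ.measurableSet.nullMeasurableSet (hQΩ k)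
      (h5.mono fun y hy hy' => by rw [(hy hy'.1 hy'.2).1]; simp),
      setIntegral_eq_of_subset_of_ae_sdiff_eq_zero hΩ.measurableSet.nullMeasurableSet (hQΩ k)
      (h5.mono fun y hy hy' => by rw [(hy hy'.1 hy'.2).2]; simp)] at h4
    have e1 : ∫ y in cube (x k) (r k), partialDeriv j φ y * f y i =
        ∫ y in cube (x k) (r k), partialDeriv j φ y * (z k).toFun y i :=
      setIntegral_congr_fun (hQ k) fun y hy => by simp only [hf k y hy]
    have e2 : ∫ y in cube (x k) (r k), φ y * g y (i, j) =
        ∫ y in cube (x k) (r k), φ y * (z k).grad y (i, j) :=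
      setIntegral_congr_fun (hQ k) fun y hy => by simp only [hg k y hy]
    rw [e1, e2]
    exact h4
  rw [hsupp _ fun y hy => by rw [hf0 y hy]; simp, hsupp _ fun y hy => by rw [hg0 y hy]; simp,
    integral_iUnion hQ hdis (IntegrableOn.mono_set hI1 hUΩ),
    integral_iUnion hQ hdis (IntegrableOn.mono_set hI2 hUΩ), ← tsum_neg]
  exact tsum_congr hk

end Sobolev

end Homogenization

/-! ### Recovery families and the upper bound -/

namespace Homogenization

variable {d m : ℕ} {Ω : Set (E d)} {p : ℝ} {L : E d → Mat m d → ℝ≥0} {ε : ℝ}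

lemma exists_dirichletInf_near_minimizer {u : E d → E m} {O : Set (E d)}
    (hfin : dirichletInf Ω p L ε u O ≠ ⊤) {κ : ℝ≥0∞} (hκ : κ ≠ 0) :
    ∃ v : Sobolev Ω p m, (∀ᵐ x ∂(volume.restrict (Ω \ O)), v.toFun x = u x) ∧
      energy L ε O v ≤ dirichletInf Ω p L ε u O + κ := by
  have h : dirichletInf Ω p L ε u O < dirichletInf Ω p L ε u O + κ := ENNReal.lt_add_right hfin hκ
  conv_lhs at h => unfold dirichletInf
  simp only [iInf_lt_iff] at h
  obtain ⟨v, hv, hlt⟩ := h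
  exact ⟨v, hv, hlt.le⟩

/-- Gluing of near minimizers on disjoint small cubes. -/
lemma exists_competitor (hd : 1 ≤ d) (hp : 1 < p) (hΩ : IsOpen Ω) {β : ℝ≥0} {ν : Measure (E d)}
    [IsFiniteMeasure ν] (hG : GrowthBound Ω p L β ν) {α : ℝ} (hα : 0 < α)
    (hcoer : ∀ x ξ, α * ‖ξ‖ ^ p ≤ (L x ξ : ℝ)) (u : Sobolev Ω p m) {O : Set (E d)} (hOΩ : O ⊆ Ω)
    (hΩt : volume Ω ≠ ⊤)
    {ι : Type*} [Countable ι] {x : ι → E d} {r : ι → ℝ} {η : ℝ} (hr : ∀ i, 0 < r i) (hrη : ∀ i, r i ≤ η)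
    (hcc : ∀ i, closedCube (x i) (r i) ⊆ O)
    (hdis : Pairwise (Function.onFun Disjoint fun i => cube (x i) (r i)))
    (hcov : volume (O \ ⋃ i, cube (x i) (r i)) = 0) {δ : ℝ≥0∞} (hδ : δ ≠ 0) (hδt : δ ≠ ⊤)
    (h0 : 0 < ε) (h1 : ε ≤ 1) :
    ∃ w : Sobolev Ω p m, ∫⁻ y in Ω, ‖w.toFun y - u.toFun y‖ₑ ^ p ≤
        2 ^ p * 2 ^ p * ENNReal.ofReal η ^ p * (2 ^ p * (ENNReal.ofReal α⁻¹ *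
          (β * u.growthMeasure ν univ + δ * volume Ω) + u.growthMeasure ν univ)) ∧
      energy L ε O w ≤ ∑' i, dirichletInf Ω p L ε u.toFun (cube (x i) (r i)) + δ * volume Ω := by
  have hp0 : 0 < p := by linarith
  have h2t : (2 : ℝ≥0∞) ^ p ≠ ⊤ := ENNReal.rpow_ne_top_of_nonneg hp0.le (by simp)
  have := u.isFiniteMeasure_growthMeasure (ν := ν) hp
  set μ := u.growthMeasure ν with hμ
  have hQm := fun i => measurableSet_cube (x i) (r i)
  have hQO : ∀ i, cube (x i) (r i) ⊆ O := fun i => (cube_subset_closedCube _ _).trans (hcc i)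
  have hQΩ : ∀ i, cube (x i) (r i) ⊆ Ω := fun i => (hQO i).trans hOΩ
  have hmle : ∀ i, dirichletInf Ω p L ε u.toFun (cube (x i) (r i)) ≤ β * μ (cube (x i) (r i)) := fun i =>
    hG.dirichletInf_le u (isOpen_cube _ _) (hQΩ i) h0 h1
  have hmt : ∀ i, dirichletInf Ω p L ε u.toFun (cube (x i) (r i)) ≠ ⊤ := fun i =>
    ne_top_of_le_ne_top (ENNReal.mul_ne_top ENNReal.coe_ne_top (measure_ne_top _ _)) (hmle i)
  -- Each cube is allowed an error proportional to its volume, so the total error is at most `δ *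
  -- volume Ω`.
  choose v hv hve using fun i => exists_dirichletInf_near_minimizer (hmt i) (κ := δ * volume
    (cube (x i) (r i))) (mul_ne_zero hδ (by rw [volume_cube _ (hr i)]; exact ofReal_pow_ne_zero (hr i)))
  have hsum : ∀ M : Measure (E d), ∑' i, M (cube (x i) (r i)) = M (⋃ i, cube (x i) (r i)) := fun M =>
    (measure_iUnion hdis hQm).symm
  have hμs : ∑' i, μ (cube (x i) (r i)) ≤ μ univ := (hsum μ).trans_le (measure_mono (subset_univ _))
  have hvs : ∑' i, volume (cube (x i) (r i)) ≤ volume Ω :=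
    (hsum volume).trans_le (measure_mono (iUnion_subset hQΩ))
  let z : ι → Sobolev Ω p m := fun i => (v i).sub hp u
  have hz : ∀ i, ∀ᵐ y ∂(volume.restrict (Ω \ cube (x i) (r i))), (z i).toFun y = 0 := fun i =>
    (hv i).mono fun y hy => by simp [z, Sobolev.sub, hy]
  set M : ℝ≥0∞ := 2 ^ p * (ENNReal.ofReal α⁻¹ * (β * μ univ + δ * volume Ω) + μ univ) with hM
  have hMt : M ≠ ⊤ := by
    have : μ univ ≠ ⊤ := measure_ne_top _ _
    rw [hM]
    finiteness
  -- Coercivity bounds `∇v_i` by the energy, which near minimality and the growth bound estimate by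
  -- `β μ` and `δ` times the volume of the cube. The bound `M` does not depend on the size of the
  -- cubes.
  have hgrad : ∑' i, ∫⁻ y in cube (x i) (r i), ‖(z i).grad y‖ₑ ^ p ≤ M := by
    calc ∑' i, ∫⁻ y in cube (x i) (r i), ‖(z i).grad y‖ₑ ^ p
        ≤ ∑' i, 2 ^ p * (ENNReal.ofReal α⁻¹ * (β * μ (cube (x i) (r i)) +
            δ * volume (cube (x i) (r i))) + μ (cube (x i) (r i))) := by
          refine ENNReal.tsum_le_tsum fun i => ?_
          have a1 : AEStronglyMeasurable (z i).grad (volume.restrict (cube (x i) (r i))) :=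
            (z i).memLp_grad.1.mono_measure (Measure.restrict_mono (hQΩ i) le_rfl)
          have a2 : AEStronglyMeasurable (fun y => - u.grad y) (volume.restrict (cube (x i) (r i))) :=
            (u.memLp_grad.1.mono_measure (Measure.restrict_mono (hQΩ i) le_rfl)).neg
          have a3 := lintegral_rpow_le_of_sub hp0.le a1 a2
          have a4 : ∀ y, (z i).grad y - - u.grad y = (v i).grad y := fun y => by
            simp [z, Sobolev.sub]
          simp only [a4, enorm_neg] at a3
          refine a3.trans ?_
          gcongr
          · exact (lintegral_grad_rpow_le_energy hp hα hcoer (v i) _).trans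
              (mul_le_mul_right ((hve i).trans (by gcongr; exact hmle i)) _)
          · rw [hμ, u.growthMeasure_apply (hQm i) (hQΩ i), ← add_assoc]
            exact le_add_self
      _ = 2 ^ p * (ENNReal.ofReal α⁻¹ * (β * ∑' i, μ (cube (x i) (r i)) +
            δ * ∑' i, volume (cube (x i) (r i))) + ∑' i, μ (cube (x i) (r i))) := by
          rw [ENNReal.tsum_mul_left, ENNReal.tsum_add, ENNReal.tsum_mul_left, ENNReal.tsum_add,
            ENNReal.tsum_mul_left, ENNReal.tsum_mul_left]
      _ ≤ M := by rw [hM]; gcongr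
  -- Poincaré's inequality on cubes of side at most `η` turns the gradient bound into smallness of
  -- the functions.
  have hfun : ∑' i, ∫⁻ y in cube (x i) (r i), ‖(z i).toFun y‖ₑ ^ p ≤
      2 ^ p * 2 ^ p * ENNReal.ofReal η ^ p * M := by
    calc _ ≤ ∑' i, 2 ^ p * 2 ^ p * ENNReal.ofReal η ^ p *
          ∫⁻ y in cube (x i) (r i), ‖(z i).grad y‖ₑ ^ p := by
          refine ENNReal.tsum_le_tsum fun i => ((z i).lintegral_rpow_le_of_zero hd hp hΩ (hr i)
            ((hcc i).trans hOΩ) (hz i)).trans ?_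
          gcongr
          exact hrη i
      _ ≤ _ := by
          rw [ENNReal.tsum_mul_left]
          gcongr
  obtain ⟨Z, hZ, hZ0⟩ := Sobolev.exists_glue hp hΩ hr hQΩ hdis z hz (ne_top_of_le_ne_top (by finiteness) hfun)
    (ne_top_of_le_ne_top hMt hgrad)
  refine ⟨u.add hp Z, ?_, ?_⟩
  · have e : ∀ y, (u.add hp Z).toFun y - u.toFun y = Z.toFun y := fun y => by simp [Sobolev.add]
    simp only [e]
    rw [lintegral_glue hQm hQΩ hdis hp0 (fun i y hy => (hZ i y hy).1) hZ0]
    exact hfun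
  · calc energy L ε O (u.add hp Z) ≤ energy L ε (⋃ i, cube (x i) (r i)) (u.add hp Z) :=
          lintegral_mono' (Measure.restrict_mono_ae (ae_le_set.2 hcov)) le_rfl
      _ = ∑' i, energy L ε (cube (x i) (r i)) (v i) := by
          unfold energy
          rw [lintegral_iUnion hQm hdis]
          refine tsum_congr fun i => setLIntegral_congr_fun (hQm i) fun y hy => ?_
          have : (u.add hp Z).grad y = (v i).grad y := by
            simp [Sobolev.add, (hZ i y hy).2, z, Sobolev.sub]
          simp only [this]
      _ ≤ ∑' i, (dirichletInf Ω p L ε u.toFun (cube (x i) (r i)) + δ * volume (cube (x i) (r i))) :=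
          ENNReal.tsum_le_tsum hve
      _ ≤ _ := by
          rw [ENNReal.tsum_add, ENNReal.tsum_mul_left]
          gcongr

lemma exists_pos_ofReal_rpow_mul_le (hp : 0 < p) {M κ : ℝ≥0∞} (hM : M ≠ ⊤) (hκ : κ ≠ 0) :
    ∃ η : ℝ, 0 < η ∧ ENNReal.ofReal η ^ p * M ≤ κ := by
  have h1 : Tendsto (fun η : ℝ => ENNReal.ofReal η ^ p * M) (𝓝[>] 0) (𝓝 (ENNReal.ofReal 0 ^ p * M)) :=
    ENNReal.Tendsto.mul_const (((ENNReal.continuous_rpow_const.comp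
      ENNReal.continuous_ofReal).tendsto 0).mono_left nhdsWithin_le_nhds) (Or.inr hM)
  rw [ENNReal.ofReal_zero, ENNReal.zero_rpow_of_pos hp, zero_mul] at h1
  obtain ⟨η, h2, h3⟩ := ((ENNReal.tendsto_nhds_zero.1 h1 κ (pos_iff_ne_zero.2 hκ)).and
    eventually_mem_nhdsWithin).exists
  exact ⟨η, h3, h2⟩

section UpperBound

variable {u : Sobolev Ω p m}

/-- The covering depends on `κ` but not on `ε`. Once it is fixed, the reverse Fatou lemma controls
the sum of the Dirichlet infima as `ε → 0`, and gluing near minimizers realizes this sum. -/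
lemma eventually_exists_competitor (hd : 1 ≤ d) (hp : 1 < p) (hΩ : IsOpen Ω)
    (hΩb : Bornology.IsBounded Ω) {β : ℝ≥0} {ν : Measure (E d)} [IsFiniteMeasure ν]
    (hG : GrowthBound Ω p L β ν) {α : ℝ} (hα : 0 < α) (hcoer : ∀ x ξ, α * ‖ξ‖ ^ p ≤ (L x ξ : ℝ))
    (hm : AEMeasurable (upperDensity Ω p L u.toFun) (volume.restrict Ω))
    (hu : ∀ᵐ x ∂(volume.restrict Ω), lowerDensity Ω p L u.toFun x = upperDensity Ω p L u.toFun x ∧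
      upperDensity Ω p L u.toFun x ≠ ⊤) {O : Set (E d)} (hO : IsOpen O) (hOΩ : O ⊆ Ω)
    {κ : ℝ≥0∞} (hκ : κ ≠ 0) (hκt : κ ≠ ⊤) :
    ∀ᶠ ε in 𝓝[>] (0 : ℝ), ∃ w : Sobolev Ω p m, ∫⁻ y in Ω, ‖w.toFun y - u.toFun y‖ₑ ^ p ≤ κ ∧
      energy L ε O w ≤ (∫⁻ x in O, upperDensity Ω p L u.toFun x) + κ := by
  have hp0 : 0 < p := by linarith
  have h2t : (2 : ℝ≥0∞) ^ p ≠ ⊤ := ENNReal.rpow_ne_top_of_nonneg hp0.le (by simp)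
  have := u.isFiniteMeasure_growthMeasure (ν := ν) hp
  have hμt : u.growthMeasure ν univ ≠ ⊤ := measure_ne_top _ _
  have hfin := lintegral_upperDensity_ne_top hp hΩ hG u
  have hΩt : volume Ω ≠ ⊤ := hΩb.measure_lt_top.ne
  set ℓ := ∫⁻ x in O, upperDensity Ω p L u.toFun x with hℓ
  have hℓt : ℓ ≠ ⊤ := ne_top_of_le_ne_top hfin (lintegral_mono_set hOΩ)
  have hVt : volume Ω + 1 + volume Ω ≠ ⊤ := by finiteness
  have hV0 : volume Ω + 1 + volume Ω ≠ 0 := by simp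
  -- Three errors must add up to `κ`: `δ * volume Ω` from the covering, `δ` from the upper limit in
  -- `ε`, and `δ * volume Ω` from near minimality.
  set δ : ℝ≥0∞ := κ / (volume Ω + 1 + volume Ω) with hδ
  have hδ0 : δ ≠ 0 := by simp [hδ, hκ, hVt]
  have hδt : δ ≠ ⊤ := ENNReal.div_ne_top hκt hV0
  have hδκ : δ * volume Ω + δ + δ * volume Ω = κ := by
    rw [← ENNReal.div_mul_cancel hV0 hVt (b := κ), ← hδ]
    ring
  obtain ⟨η, hη, hηκ⟩ := exists_pos_ofReal_rpow_mul_le (p := p) hp0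
    (M := 2 ^ p * 2 ^ p * (2 ^ p * (ENNReal.ofReal α⁻¹ *
      (β * u.growthMeasure ν univ + δ * volume Ω) + u.growthMeasure ν univ))) (by finiteness) hκ
  obtain ⟨t, r, htc, ht, hdis, hcov⟩ := exists_disjoint_closedCube_covering hO
    (ae_restrict_of_ae_restrict_of_subset hOΩ (ae_eventually_close hΩ hm hfin hu hδ0)) hη
  have : Countable t := htc
  have hQO : ∀ x ∈ t, cube x (r x) ⊆ O := fun x hx =>
    (cube_subset_closedCube x _).trans (ht x hx).2.2.1
  have hdis' : t.PairwiseDisjoint fun x => cube x (r x) :=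
    hdis.mono fun x => cube_subset_closedCube x _
  have hdis'' : Pairwise (Function.onFun Disjoint fun x : t => cube (x : E d) (r x)) :=
    fun a b hab => hdis' a.2 b.2 fun h => hab (Subtype.ext h)
  have hQm : ∀ x : t, MeasurableSet (cube (x : E d) (r x)) := fun x => measurableSet_cube _ _
  have hUO : ⋃ x : t, cube (x : E d) (r x) ⊆ O := iUnion_subset fun x => hQO x x.2
  have hvs : ∑' x : t, volume (cube (x : E d) (r x)) ≤ volume Ω := by
    rw [← measure_iUnion hdis'' hQm]
    exact measure_mono (hUO.trans hOΩ)
  have hμs : ∑' x : t, β * u.growthMeasure ν (cube (x : E d) (r x)) ≠ ⊤ := by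
    rw [ENNReal.tsum_mul_left, ← measure_iUnion hdis'' hQm]
    exact ENNReal.mul_ne_top ENNReal.coe_ne_top (measure_ne_top _ _)
  have hlim : limsup (fun ε => ∑' x : t, dirichletInf Ω p L ε u.toFun (cube (x : E d) (r x))) (𝓝[>] 0) ≤
      ℓ + δ * volume Ω := by
    refine (limsup_tsum_le (f := fun ε (x : t) => dirichletInf Ω p L ε u.toFun (cube (x : E d) (r x)))
      (eventually_le_one_nhdsGT.mono fun ε hε x =>
      hG.dirichletInf_le u (isOpen_cube _ _) ((hQO x x.2).trans hOΩ) hε.1 hε.2) hμs).trans ?_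
    calc ∑' x : t, upperInf Ω p L u.toFun (cube (x : E d) (r x))
        ≤ ∑' x : t, ((∫⁻ y in cube (x : E d) (r x), upperDensity Ω p L u.toFun y) +
          δ * volume (cube (x : E d) (r x))) := ENNReal.tsum_le_tsum fun x => (ht x x.2).2.2.2.2
      _ = (∫⁻ y in ⋃ x : t, cube (x : E d) (r x), upperDensity Ω p L u.toFun y) +
          δ * ∑' x : t, volume (cube (x : E d) (r x)) := by
          rw [ENNReal.tsum_add, ENNReal.tsum_mul_left, lintegral_iUnion hQm hdis'']
      _ ≤ _ := add_le_add (lintegral_mono_set hUO) (mul_le_mul_right hvs _)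
  have hlt : ℓ + δ * volume Ω < ℓ + δ * volume Ω + δ := ENNReal.lt_add_right (by finiteness) hδ0
  filter_upwards [eventually_lt_of_limsup_lt (hlim.trans_lt hlt), eventually_le_one_nhdsGT] with ε hε hε1
  obtain ⟨w, hw1, hw2⟩ := exists_competitor hd hp hΩ hG hα hcoer u hOΩ hΩt
    (x := fun x : t => (x : E d)) (r := fun x : t => r x) (η := η) (fun x => (ht x x.2).1)
    (fun x => (ht x x.2).2.1.le) (fun x => (ht x x.2).2.2.1) hdis''
    (by rwa [biUnion_eq_iUnion] at hcov) hδ0 hδt hε1.1 hε1.2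
  refine ⟨w, hw1.trans (le_trans (le_of_eq (by ring)) hηκ), hw2.trans ?_⟩
  calc _ ≤ ℓ + δ * volume Ω + δ + δ * volume Ω := by gcongr
    _ = ℓ + κ := by rw [← hδκ]; ring

/-- The upper bound for the `Γ`-limit. -/
theorem gammaLimsup_le_lintegral_upperDensity (hd : 1 ≤ d) (hp : 1 < p) (hΩ : IsOpen Ω)
    (hΩb : Bornology.IsBounded Ω) {β : ℝ≥0} {ν : Measure (E d)} [IsFiniteMeasure ν]
    (hG : GrowthBound Ω p L β ν) {α : ℝ} (hα : 0 < α) (hcoer : ∀ x ξ, α * ‖ξ‖ ^ p ≤ (L x ξ : ℝ))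
    (hm : AEMeasurable (upperDensity Ω p L u.toFun) (volume.restrict Ω))
    (hu : ∀ᵐ x ∂(volume.restrict Ω), lowerDensity Ω p L u.toFun x = upperDensity Ω p L u.toFun x ∧
      upperDensity Ω p L u.toFun x ≠ ⊤) {O : Set (E d)} (hO : IsOpen O) (hOΩ : O ⊆ Ω) :
    gammaLimsup (fun ε => energy L ε O) u ≤ ∫⁻ x in O, upperDensity Ω p L u.toFun x := by
  have hp0 : 0 < p := by linarith
  set ℓ := ∫⁻ x in O, upperDensity Ω p L u.toFun x with hℓ
  have hℓt : ℓ ≠ ⊤ := ne_top_of_le_ne_top (lintegral_upperDensity_ne_top hp hΩ hG u)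
    (lintegral_mono_set hOΩ)
  -- `Φ` measures the distance to `u` and the excess energy at once. Its infimum tends to zero, so
  -- near minimizers of `Φ ε` form a recovery family and no diagonal sequence is needed.
  let Φ : ℝ → Sobolev Ω p m → ℝ≥0∞ := fun ε w =>
    max (∫⁻ y in Ω, ‖w.toFun y - u.toFun y‖ₑ ^ p) (energy L ε O w - ℓ)
  -- The function `u` serves as a default value when `ε ≤ 0` or the infimum is infinite.
  have hex : ∀ ε : ℝ, ∃ w, 0 < ε → Φ ε w ≤ (⨅ w, Φ ε w) + ENNReal.ofReal ε := by
    intro ε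
    rcases eq_or_ne (⨅ w, Φ ε w) ⊤ with h | h
    · exact ⟨u, fun _ => by rw [h, top_add]; exact le_top⟩
    · by_cases hε : 0 < ε
      · obtain ⟨w, hw⟩ := iInf_lt_iff.1 (ENNReal.lt_add_right h (b := ENNReal.ofReal ε)
          (by simpa using hε))
        exact ⟨w, fun _ => hw.le⟩
      · exact ⟨u, fun h => absurd h hε⟩
  choose v hv using hex
  have hΦ : Tendsto (fun ε => Φ ε (v ε)) (𝓝[>] 0) (𝓝 0) := by
    refine ENNReal.tendsto_nhds_zero.2 fun κ hκ => ?_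
    have hκ2 : min κ 1 / 2 ≠ 0 := by simp [hκ.ne']
    have hκt : min κ 1 / 2 ≠ ⊤ :=
      ENNReal.div_ne_top (ne_top_of_le_ne_top ENNReal.one_ne_top (min_le_right _ _)) (by simp)
    have h1 : Tendsto (fun ε : ℝ => ENNReal.ofReal ε) (𝓝[>] 0) (𝓝 0) := by
      simpa using (ENNReal.continuous_ofReal.tendsto 0).mono_left nhdsWithin_le_nhds
    filter_upwards [eventually_exists_competitor hd hp hΩ hΩb hG hα hcoer hm hu hO hOΩ hκ2 hκt,
      ENNReal.tendsto_nhds_zero.1 h1 _ (pos_iff_ne_zero.2 hκ2), eventually_mem_nhdsWithin]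
      with ε ⟨w, hw1, hw2⟩ h2 h3
    calc Φ ε (v ε) ≤ (⨅ w, Φ ε w) + ENNReal.ofReal ε := hv ε h3
      _ ≤ min κ 1 / 2 + min κ 1 / 2 := by
          gcongr
          exact (iInf_le _ w).trans (max_le hw1 (tsub_le_iff_left.2 hw2))
      _ = min κ 1 := ENNReal.add_halves _
      _ ≤ κ := min_le_left _ _
  have hconv : ConvergesLp v u := by
    have h1 : Tendsto (fun ε => ∫⁻ y in Ω, ‖(v ε).toFun y - u.toFun y‖ₑ ^ p) (𝓝[>] 0) (𝓝 0) :=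
      tendsto_of_tendsto_of_tendsto_of_le_of_le tendsto_const_nhds hΦ (fun _ => zero_le)
        fun ε => le_max_left _ _
    have h2 := ((ENNReal.continuous_rpow_const (y := 1 / p)).tendsto 0).comp h1
    rw [ENNReal.zero_rpow_of_pos (by positivity)] at h2
    refine h2.congr fun ε => ?_
    rw [eLpNorm_eq_rpow hp, Function.comp_apply]
  refine (iInf₂_le v hconv).trans ?_
  have h1 : limsup (fun ε => energy L ε O (v ε)) (𝓝[>] 0) ≤
      limsup (fun _ : ℝ => ℓ) (𝓝[>] (0 : ℝ)) + 0 :=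
    limsup_le_limsup_add (h := fun ε => Φ ε (v ε)) (Eventually.of_forall fun ε =>
      tsub_le_iff_left.1 (le_max_right _ _)) hΦ.limsup_eq.le
  simpa using h1

end UpperBound

end Homogenization

/-! ### Conclusion: both Γ-limits equal the integral of the density -/

theorem mainTheorem6 (d m : ℕ) (hd : 1 ≤ d) (hm : 1 ≤ m) (p : ℝ) (hp : 1 < p)
    (Ω : Set (Homogenization.E d)) (hΩ : IsOpen Ω) (hΩb : Bornology.IsBounded Ω)
    (L : Homogenization.E d → Homogenization.Mat m d → ℝ≥0)
    (hL : Measurable (fun q : Homogenization.E d × Homogenization.Mat m d => L q.1 q.2))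
    (hcoer : ∃ α : ℝ, 0 < α ∧ ∀ x ξ, α * ‖ξ‖ ^ p ≤ (L x ξ : ℝ))
    (hG1 : Homogenization.GrowthG1 Ω p L)
    (hH : Homogenization.IsHIntegrand Ω p L) :
    ∀ O : Set (Homogenization.E d), IsOpen O → O ⊆ Ω →
      (∀ u : Homogenization.Sobolev Ω p m,
        AEMeasurable (fun x => Homogenization.Lhom p L x (u.grad x)) (volume.restrict O) ∧
        Homogenization.GammaConvergesAt (fun ε => Homogenization.energy L ε O) u
          (∫⁻ x in O, Homogenization.Lhom p L x (u.grad x))) ∧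
      (∀ x ∈ O, ∀ (v : Homogenization.E m) (ξ : Homogenization.Mat m d),
        Homogenization.Lhom p L x ξ = Homogenization.L0 Ω p L x v ξ) := by
  obtain ⟨α, hα, hcoer⟩ := hcoer
  obtain ⟨β, ν, hν, hac, hG⟩ := hG1.exists_growthBound hΩb
  refine fun O hO hOΩ => ⟨fun u => ?_,
    fun x hx v ξ => Homogenization.Lhom_eq_L0 hp hΩ hΩb (hOΩ hx) v ξ⟩
  have hae := Homogenization.ae_density_eq hp hΩ hΩb hG hH u
  have hu := hae.mono fun x hx => hx.2
  have hmeas := Homogenization.aemeasurable_upperDensity hp hΩ hac hG u (hu.mono fun x hx => hx.1)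
  have haeO := ae_restrict_of_ae_restrict_of_subset hOΩ hae
  have hint : ∫⁻ x in O, Homogenization.Lhom p L x (u.grad x) =
      ∫⁻ x in O, Homogenization.upperDensity Ω p L u.toFun x :=
    lintegral_congr_ae (haeO.mono fun x hx => hx.1.symm)
  have hlow : ∫⁻ x in O, Homogenization.upperDensity Ω p L u.toFun x ≤
      Homogenization.gammaLiminf (fun ε => Homogenization.energy L ε O) u :=
    le_iInf₂ fun v hv => Homogenization.lintegral_upperDensity_le_liminf hp hΩ hΩb hG hα hcoer hmeas hu
      hO hOΩ hv
  have hup := Homogenization.gammaLimsup_le_lintegral_upperDensity hd hp hΩ hΩb hG hα hcoer hmeas hu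
    hO hOΩ
  have hle : Homogenization.gammaLiminf (fun ε => Homogenization.energy L ε O) u ≤
      Homogenization.gammaLimsup (fun ε => Homogenization.energy L ε O) u :=
    iInf₂_mono fun v _ => liminf_le_limsup
  refine ⟨(hmeas.mono_measure (Measure.restrict_mono hOΩ le_rfl)).congr (haeO.mono fun x hx => hx.1), ?_⟩
  rw [hint]
  exact ⟨le_antisymm (hle.trans hup) hlow, le_antisymm hup (hlow.trans hle)⟩
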